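/- Let $n\ge 1$ and let $(M,HM,J,\eta)$ be a pseudohermitian manifold of dimension $2n+1$: $M$ is a smooth (Hausdorff) manifold, $\eta$ is a nowhere vanishing smooth $1$-form, $HM=\ker\eta$, $J$ is a smooth bundle endomorphism of $HM$ with $J^2=-I$ such that for all local smooth sections $X,Y$ of $HM$ one has $[X,Y]-[JX,JY]\in HM$ and $[JX,JY]-[X,Y]-J([JX,Y]+[X,JY])=0$, and the Levi form $L_\eta(X,Y)=-d\eta(X,JY)$ is positive definite on $HM$; here $2\,d\eta(X,Y)=X\eta(Y)-Y\eta(X)-\eta([X,Y])$. Let $\xi$ be the vector field with $\eta(\xi)=1$, $d\eta(\xi,\cdot)=0$; let $\varphi$ be the $(1,1)$-tensor field with $\varphi\xi=0$, $\varphi|_{HM}=J$; and let $g_\eta$ be the Webster metric, i.e. the Riemannian metric with $g_\eta=L_\eta$ on $HM$, $g_\eta(HM,\xi)=0$, $g_\eta(\xi,\xi)=1$. Assume that $g_\eta$ is Sasakian, i.e. $h:=\frac12\mathcal L_\xi\varphi=0$. Definitions. - $g_\eta$ is locally $CR$-symmetric if every $x\in M$ has an open neighbourhood $U$ with an isometric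 $CR$-diffeomorphism $\sigma:U\to U$ such that $\sigma(x)=x$ and $(d\sigma)_x=-\mathrm{Id}$ on $H_xM$; it is (globally) $CR$-symmetric if for every $x\in M$ there is such a $\sigma$ with $U=M$. - The characteristic reflection at $x$ is the geodesic reflection with respect to the integral curve of $\xi$ through $x$: it sends $\gamma(t)$ to $\gamma(-t)$ for each geodesic $\gamma$ of $g_\eta$ with $\gamma(0)$ on that integral curve and $\gamma'(0)\perp\xi$. (On an open set $U\ni x$ only the arcs of the integral curve through $x$ and the geodesic segments $\gamma|_{(-\varepsilon,\varepsilon)}$ lying in $U$ are considered.) $M$ is locally $\varphi$-symmetric if the characteristic reflections are local isometries, i.e. every $x\in M$ has an open neighbourhood $U$ with an isometric diffeomorphism $U\to U$ which is the characteristic reflection at $x$ on $U$. - $M$ is a (globally) $\varphi$-symmetric space if it is locally $\varphi$-symmetric, for each $x\in M$ there is an isometric diffeomorphism $M\to M$ which is the characteristic reflection at $x$ on all of $M$, and $\xi$ generates a global one-parameter group of automorphisms of the contact metric structure $(\varphi,\xi,\eta,g_\eta)$. Then: (1) $g_\eta$ is locally $CR$-symmetric if and only if $M$ is locally $\varphi$-symmetric;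 (2) if $M$ is connected, $g_\eta$ is (globally) $CR$-symmetric if and only if $M$ is a (globally) $\varphi$-symmetric space. -/

import Mathlib

open Set Manifold
open scoped ContDiff

noncomputable section

namespace CRGeometry

variable {E : Type*} [NormedAddCommGroup E] [NormedSpace ℝ E]
  {M : Type*} [TopologicalSpace M] [ChartedSpace E M]

/-! ### One-forms and vector fields -/

/-- The coordinate expression, in the chart at `p`, of a one-form `η`. -/
def coordForm (η : (x : M) → TangentSpace 𝓘(ℝ, E) x →L[ℝ] ℝ) (p : M) (y : E) : E →L[ℝ] ℝ :=
  (η ((extChartAt 𝓘(ℝ, E) p).symm y)).comp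
    (mfderiv 𝓘(ℝ, E) 𝓘(ℝ, E) (extChartAt 𝓘(ℝ, E) p).symm y)

/-- A one-form is smooth if all its coordinate expressions are. -/
def SmoothOneForm (η : (x : M) → TangentSpace 𝓘(ℝ, E) x →L[ℝ] ℝ) : Prop :=
  ∀ p : M, ContDiffOn ℝ ∞ (coordForm η p) (extChartAt 𝓘(ℝ, E) p).target

/-- The exterior derivative of a one-form, with the convention of contact metric geometry
`2 dη(X, Y) = X (η Y) - Y (η X) - η [X, Y]`, computed in the chart at `x`. -/
def extDer (η : (x : M) → TangentSpace 𝓘(ℝ, E) x →L[ℝ] ℝ) (x : M) :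
    LinearMap.BilinForm ℝ (TangentSpace 𝓘(ℝ, E) x) :=
  let D : E →L[ℝ] E →L[ℝ] ℝ := fderiv ℝ (coordForm η x) (extChartAt 𝓘(ℝ, E) x x)
  let c : TangentSpace 𝓘(ℝ, E) x →L[ℝ] E := mfderiv 𝓘(ℝ, E) 𝓘(ℝ, E) (extChartAt 𝓘(ℝ, E) x) x
  LinearMap.mk₂ ℝ (fun u v => (1 / 2 : ℝ) * (D (c u) (c v) - D (c v) (c u)))
    (fun u u' v => by simp only [map_add, add_apply]; ring)
    (fun a u v => by simp only [map_smul, smul_apply, smul_eq_mul]; ring)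
    (fun u v v' => by simp only [map_add, add_apply]; ring)
    (fun a u v => by simp only [map_smul, smul_apply, smul_eq_mul]; ring)

theorem extDer_apply (η : (x : M) → TangentSpace 𝓘(ℝ, E) x →L[ℝ] ℝ) (x : M)
    (u v : TangentSpace 𝓘(ℝ, E) x) :
    extDer η x u v = (1 / 2 : ℝ) *
      (fderiv ℝ (coordForm η x) (extChartAt 𝓘(ℝ, E) x x)
          (mfderiv 𝓘(ℝ, E) 𝓘(ℝ, E) (extChartAt 𝓘(ℝ, E) x) x u)
          (mfderiv 𝓘(ℝ, E) 𝓘(ℝ, E) (extChartAt 𝓘(ℝ, E) x) x v)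
        - fderiv ℝ (coordForm η x) (extChartAt 𝓘(ℝ, E) x x)
          (mfderiv 𝓘(ℝ, E) 𝓘(ℝ, E) (extChartAt 𝓘(ℝ, E) x) x v)
          (mfderiv 𝓘(ℝ, E) 𝓘(ℝ, E) (extChartAt 𝓘(ℝ, E) x) x u)) := rfl

theorem extDer_self (η : (x : M) → TangentSpace 𝓘(ℝ, E) x →L[ℝ] ℝ) (x : M)
    (v : TangentSpace 𝓘(ℝ, E) x) : extDer η x v v = 0 := by
  simp [extDer]

theorem extDer_swap (η : (x : M) → TangentSpace 𝓘(ℝ, E) x →L[ℝ] ℝ) (x : M)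
    (u v : TangentSpace 𝓘(ℝ, E) x) : extDer η x u v = -extDer η x v u := by
  simp only [extDer, LinearMap.mk₂_apply]; ring

variable [IsManifold 𝓘(ℝ, E) ∞ M]

/-- The vector field `X` is smooth on the set `U`. -/
def SmoothVectorFieldOn (X : (x : M) → TangentSpace 𝓘(ℝ, E) x) (U : Set M) : Prop :=
  ContMDiffOn 𝓘(ℝ, E) 𝓘(ℝ, E).tangent ∞ (fun x => (⟨x, X x⟩ : TangentBundle 𝓘(ℝ, E) M)) U

/-! ### Pseudohermitian manifolds -/

variable (E M) in
/-- A pseudohermitian structure of hypersurface type: a nowhere zero smooth one-form `η` and a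
smooth complex structure `J` on the bundle `HM = ker η`, such that `(HM, J)` is a `CR` structure
and the Levi form `L_η(X, Y) = -dη(X, J Y)` is positive definite on `HM`. Local sections of `HM`
over `U` are families `X` of vectors of `ker η` that are smooth on `U`. -/
structure PseudohermitianStructure where
  /-- the pseudohermitian one-form -/
  η : (x : M) → TangentSpace 𝓘(ℝ, E) x →L[ℝ] ℝ
  smooth_η : SmoothOneForm η
  η_ne_zero : ∀ x, η x ≠ 0
  /-- the partial complex structure -/
  J : (x : M) → LinearMap.ker (η x).toLinearMap →ₗ[ℝ] LinearMap.ker (η x).toLinearMap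
  smooth_J : ∀ (U : Set M) (X : (x : M) → LinearMap.ker (η x).toLinearMap), IsOpen U →
    SmoothVectorFieldOn (fun x => (X x).1) U → SmoothVectorFieldOn (fun x => (J x (X x)).1) U
  J_J : ∀ x X, J x (J x X) = -X
  /-- `[X, Y] - [J X, J Y]` is a section of `HM` -/
  bracket_mem : ∀ (U : Set M) (X Y : (x : M) → LinearMap.ker (η x).toLinearMap), IsOpen U →
    SmoothVectorFieldOn (fun x => (X x).1) U → SmoothVectorFieldOn (fun x => (Y x).1) U →
    ∀ x ∈ U,
      VectorField.mlieBracket 𝓘(ℝ, E) (fun x => (X x).1) (fun x => (Y x).1) x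
        - VectorField.mlieBracket 𝓘(ℝ, E) (fun x => (J x (X x)).1) (fun x => (J x (Y x)).1) x
        ∈ LinearMap.ker (η x).toLinearMap
  /-- formal integrability: `[J X, J Y] - [X, Y] - J ([J X, Y] + [X, J Y]) = 0`; here `Z` is
  `[J X, Y] + [X, J Y]`, which lies in `HM` by the previous condition -/
  integrable : ∀ (U : Set M) (X Y : (x : M) → LinearMap.ker (η x).toLinearMap), IsOpen U →
    SmoothVectorFieldOn (fun x => (X x).1) U → SmoothVectorFieldOn (fun x => (Y x).1) U →
    ∀ x ∈ U, ∀ Z : LinearMap.ker (η x).toLinearMap,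
      Z.1 = VectorField.mlieBracket 𝓘(ℝ, E) (fun x => (J x (X x)).1) (fun x => (Y x).1) x
        + VectorField.mlieBracket 𝓘(ℝ, E) (fun x => (X x).1) (fun x => (J x (Y x)).1) x →
      VectorField.mlieBracket 𝓘(ℝ, E) (fun x => (J x (X x)).1) (fun x => (J x (Y x)).1) x
        - VectorField.mlieBracket 𝓘(ℝ, E) (fun x => (X x).1) (fun x => (Y x).1) x
        - (J x Z).1 = 0
  /-- strong pseudoconvexity -/
  levi_pos : ∀ (x : M) (X : LinearMap.ker (η x).toLinearMap), X ≠ 0 →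
    0 < -extDer η x X.1 (J x X).1

namespace PseudohermitianStructure

variable (P : PseudohermitianStructure E M)

/-- The holomorphic tangent space `H_x M = ker η_x`. -/
abbrev H (x : M) : Submodule ℝ (TangentSpace 𝓘(ℝ, E) x) := LinearMap.ker (P.η x).toLinearMap

/-- There is a unique vector `ξ_x` with `η(ξ_x) = 1` and `dη(ξ_x, ·) = 0`. -/
theorem existsUnique_reeb [FiniteDimensional ℝ E] (x : M) :
    ∃! v : TangentSpace 𝓘(ℝ, E) x, P.η x v = 1 ∧ ∀ w, extDer P.η x v w = 0 := by
  have : FiniteDimensional ℝ (TangentSpace 𝓘(ℝ, E) x) := inferInstanceAs (FiniteDimensional ℝ E)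
  set B := extDer P.η x with hB
  let b : P.H x →ₗ[ℝ] Module.Dual ℝ (P.H x) := B.compl₁₂ (P.H x).subtype (P.H x).subtype
  have hb : ∀ u w : P.H x, b u w = B u.1 w.1 := fun u w => rfl
  have hinj : Function.Injective b := by
    rw [← LinearMap.ker_eq_bot, LinearMap.ker_eq_bot']
    intro u hu
    by_contra hne
    have h1 := P.levi_pos x u hne
    have h2 : b u (P.J x u) = 0 := by rw [hu]; rfl
    rw [hb] at h2
    rw [← hB, h2] at h1
    simp at h1
  have hsurj : Function.Surjective b :=
    (LinearMap.injective_iff_surjective_of_finrank_eq_finrank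
      Subspace.dual_finrank_eq.symm).1 hinj
  obtain ⟨v₁, hv₁⟩ : ∃ v, P.η x v ≠ 0 := by
    by_contra hcon
    push Not at hcon
    exact P.η_ne_zero x (ContinuousLinearMap.ext hcon)
  set v₀ := (P.η x v₁)⁻¹ • v₁ with hv₀
  have h0 : P.η x v₀ = 1 := by
    rw [hv₀, map_smul, smul_eq_mul, inv_mul_cancel₀ hv₁]
  obtain ⟨h, hh⟩ := hsurj ((B v₀).comp (P.H x).subtype)
  have hBh : ∀ w : P.H x, B h.1 w.1 = B v₀ w.1 := fun w => by
    rw [← hb, hh]; rfl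
  have hhη : P.η x h.1 = 0 := h.2
  have hkey : ∀ v : TangentSpace 𝓘(ℝ, E) x, P.η x v = 1 →
      ((∀ w, B v w = 0) ↔ ∀ w : P.H x, B v w.1 = 0) := by
    intro v hv
    refine ⟨fun h w => h w.1, fun hH w => ?_⟩
    have hw : w - P.η x w • v ∈ P.H x := by
      change P.η x (w - P.η x w • v) = 0
      rw [map_sub, map_smul, hv, smul_eq_mul, mul_one, sub_self]
    have h1 := hH ⟨_, hw⟩
    rw [map_sub, map_smul, hB, extDer_self, smul_zero, sub_zero] at h1
    exact h1
  refine ⟨v₀ - h.1, ⟨?_, ?_⟩, ?_⟩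
  · rw [map_sub, h0, hhη, sub_zero]
  · refine (hkey _ (by rw [map_sub, h0, hhη, sub_zero])).2 fun w => ?_
    rw [map_sub, LinearMap.sub_apply, hBh, sub_self]
  · rintro v ⟨hv1, hv2⟩
    have hmem : v - (v₀ - h.1) ∈ P.H x := by
      change P.η x (v - (v₀ - h.1)) = 0
      rw [map_sub, map_sub, hv1, h0, hhη]; norm_num
    have : (⟨_, hmem⟩ : P.H x) = 0 := by
      apply hinj
      rw [map_zero]
      ext w
      rw [hb]
      change B (v - (v₀ - h.1)) w.1 = 0
      rw [map_sub, map_sub, LinearMap.sub_apply, LinearMap.sub_apply, hBh, hv2]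
      simp
    exact sub_eq_zero.1 (congrArg Subtype.val this)

variable [FiniteDimensional ℝ E]

/-- The characteristic (Reeb) vector field `ξ`: `η(ξ) = 1` and `dη(ξ, ·) = 0`. -/
def ξ (x : M) : TangentSpace 𝓘(ℝ, E) x := (P.existsUnique_reeb x).choose

theorem η_ξ (x : M) : P.η x (P.ξ x) = 1 := (P.existsUnique_reeb x).choose_spec.1.1

theorem extDer_ξ (x : M) (w : TangentSpace 𝓘(ℝ, E) x) : extDer P.η x (P.ξ x) w = 0 :=
  (P.existsUnique_reeb x).choose_spec.1.2 w

/-- The projection `v ↦ v - η(v) ξ` of `T_x M` onto `H_x M`. -/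
def proj (x : M) : TangentSpace 𝓘(ℝ, E) x →ₗ[ℝ] P.H x :=
  LinearMap.codRestrict (P.H x)
    (LinearMap.id - (P.η x).toLinearMap.smulRight (P.ξ x)) fun v => by
      change P.η x (v - P.η x v • P.ξ x) = 0
      rw [map_sub, map_smul, P.η_ξ, smul_eq_mul, mul_one, sub_self]

/-- The tensor field `φ` of type `(1,1)`, which extends `J` by `φ ξ = 0`. -/
def φ (x : M) : TangentSpace 𝓘(ℝ, E) x →ₗ[ℝ] TangentSpace 𝓘(ℝ, E) x :=
  (P.H x).subtype ∘ₗ P.J x ∘ₗ P.proj x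

/-- The Webster metric: `g_η = L_η` on `HM`, `g_η(·, ξ) = 0` on `HM`, `g_η(ξ, ξ) = 1`. -/
def webster (x : M) : LinearMap.BilinForm ℝ (TangentSpace 𝓘(ℝ, E) x) :=
  -(extDer P.η x).compl₂ (P.φ x) +
    LinearMap.smulRight (P.η x).toLinearMap (P.η x).toLinearMap

theorem φ_ξ (x : M) : P.φ x (P.ξ x) = 0 := by
  have : P.proj x (P.ξ x) = 0 := by
    ext
    change P.ξ x - P.η x (P.ξ x) • P.ξ x = 0
    rw [P.η_ξ, one_smul, sub_self]
  simp [φ, this]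

theorem φ_of_mem (x : M) (X : P.H x) : P.φ x X.1 = (P.J x X).1 := by
  have hX : P.η x X.1 = 0 := X.2
  have : P.proj x X.1 = X := by
    ext
    change X.1 - P.η x X.1 • P.ξ x = X.1
    rw [hX, zero_smul, sub_zero]
  simp [φ, this]

theorem webster_apply (x : M) (u v : TangentSpace 𝓘(ℝ, E) x) :
    P.webster x u v = -extDer P.η x u (P.φ x v) + P.η x u * P.η x v := by
  simp [webster]

theorem webster_of_mem (x : M) (X Y : P.H x) :
    P.webster x X.1 Y.1 = -extDer P.η x X.1 (P.J x Y).1 := by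
  have hX : P.η x X.1 = 0 := X.2
  rw [webster_apply, φ_of_mem, hX, zero_mul, add_zero]

theorem webster_ξ_right (x : M) (X : P.H x) : P.webster x X.1 (P.ξ x) = 0 := by
  have hX : P.η x X.1 = 0 := X.2
  rw [webster_apply, φ_ξ, hX]; simp

theorem webster_ξ_left (x : M) (X : P.H x) : P.webster x (P.ξ x) X.1 = 0 := by
  have hX : P.η x X.1 = 0 := X.2
  rw [webster_apply, extDer_ξ, hX]; simp

theorem webster_ξ_ξ (x : M) : P.webster x (P.ξ x) (P.ξ x) = 1 := by
  rw [webster_apply, extDer_ξ, η_ξ]; simp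

/-- `h X = (1/2) (L_ξ φ) X = (1/2) ([ξ, φ X] - φ [ξ, X])`. -/
def h (X : (x : M) → TangentSpace 𝓘(ℝ, E) x) (x : M) : TangentSpace 𝓘(ℝ, E) x :=
  (1 / 2 : ℝ) • (VectorField.mlieBracket 𝓘(ℝ, E) P.ξ (fun y => P.φ y (X y)) x
    - P.φ x (VectorField.mlieBracket 𝓘(ℝ, E) P.ξ X x))

/-- The Webster metric is Sasakian: the tensor field `h` vanishes. -/
def IsSasakian : Prop :=
  ∀ (U : Set M) (X : (x : M) → TangentSpace 𝓘(ℝ, E) x), IsOpen U → SmoothVectorFieldOn X U →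
    ∀ x ∈ U, P.h X x = 0

/-! ### Geodesics of the Webster metric -/

/-- The coefficient `g(u, v)` of the Webster metric in the chart at `p`, for constant
coordinate vectors `u`, `v`. -/
def coordMetric (p : M) (u v : E) (y : E) : ℝ :=
  P.webster ((extChartAt 𝓘(ℝ, E) p).symm y)
    (mfderiv 𝓘(ℝ, E) 𝓘(ℝ, E) (extChartAt 𝓘(ℝ, E) p).symm y u)
    (mfderiv 𝓘(ℝ, E) 𝓘(ℝ, E) (extChartAt 𝓘(ℝ, E) p).symm y v)

/-- The Christoffel symbol of the first kind `Γ(u, v; w) = g(∇_u v, w)` of the Levi-Civita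
connection of the Webster metric, in the chart at `p`. -/
def christoffel (p : M) (u v w : E) (y : E) : ℝ :=
  (1 / 2 : ℝ) * (fderiv ℝ (P.coordMetric p v w) y u + fderiv ℝ (P.coordMetric p u w) y v
    - fderiv ℝ (P.coordMetric p u v) y w)

/-- The smooth curve `γ` is a geodesic of the Webster metric on the open set `s` of parameters:
in each chart, `g(γ'', w) + Γ(γ', γ'; w) = 0` for every `w`. Constant curves are allowed. -/
def IsGeodesicOn (γ : ℝ → M) (s : Set ℝ) : Prop :=
  ContMDiffOn 𝓘(ℝ, ℝ) 𝓘(ℝ, E) ∞ γ s ∧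
    ∀ t ∈ s, ∀ p : M, γ t ∈ (extChartAt 𝓘(ℝ, E) p).source → ∀ w : E,
      let c : ℝ → E := fun r => extChartAt 𝓘(ℝ, E) p (γ r)
      P.coordMetric p (deriv (deriv c) t) w (c t)
        + P.christoffel p (deriv c t) (deriv c t) w (c t) = 0

/-! ### Maps -/

/-- `σ` preserves the Webster metric at all points of `U`. -/
def PreservesMetricOn (σ : M → M) (U : Set M) : Prop :=
  ∀ x ∈ U, ∀ u v : TangentSpace 𝓘(ℝ, E) x,
    P.webster (σ x) (mfderiv 𝓘(ℝ, E) 𝓘(ℝ, E) σ x u) (mfderiv 𝓘(ℝ, E) 𝓘(ℝ, E) σ x v)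
      = P.webster x u v

/-- `σ` is a `CR` map on `U`: its differential maps `HM` to `HM` and commutes with `J`. -/
def IsCRMapOn (σ : M → M) (U : Set M) : Prop :=
  ∀ x ∈ U, ∀ X : P.H x, ∃ hX : mfderiv 𝓘(ℝ, E) 𝓘(ℝ, E) σ x X.1 ∈ P.H (σ x),
    (P.J (σ x) ⟨_, hX⟩).1 = mfderiv 𝓘(ℝ, E) 𝓘(ℝ, E) σ x (P.J x X).1

/-- `σ` preserves the contact metric structure `(φ, ξ, η, g_η)`. -/
def IsContactMetricMap (σ : M → M) : Prop :=
  P.PreservesMetricOn σ univ ∧ ∀ x : M,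
    mfderiv 𝓘(ℝ, E) 𝓘(ℝ, E) σ x (P.ξ x) = P.ξ (σ x) ∧
    ∀ v : TangentSpace 𝓘(ℝ, E) x,
      P.η (σ x) (mfderiv 𝓘(ℝ, E) 𝓘(ℝ, E) σ x v) = P.η x v ∧
      P.φ (σ x) (mfderiv 𝓘(ℝ, E) 𝓘(ℝ, E) σ x v) = mfderiv 𝓘(ℝ, E) 𝓘(ℝ, E) σ x (P.φ x v)

/-- The differential of `σ` at `x` fixes the base point `x` and is `-Id` on `H_x M`. -/
def ReflectsAt (σ : M → M) (x : M) : Prop :=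
  ∀ X : P.H x, tangentMap 𝓘(ℝ, E) 𝓘(ℝ, E) σ ⟨x, X.1⟩ = (⟨x, -X.1⟩ : TangentBundle 𝓘(ℝ, E) M)

/-! ### `CR`-symmetry -/

/-- `g_η` is locally `CR`-symmetric: every point `x` has an open neighbourhood `U` with a
`CR`-diffeomorphism `U → U` which is isometric and is a symmetry at `x`. -/
def IsLocallyCRSymmetric : Prop :=
  ∀ x : M, ∃ σ : OpenPartialHomeomorph M M, σ.target = σ.source ∧ x ∈ σ.source ∧
    ContMDiffOn 𝓘(ℝ, E) 𝓘(ℝ, E) ∞ σ σ.source ∧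
    ContMDiffOn 𝓘(ℝ, E) 𝓘(ℝ, E) ∞ σ.symm σ.target ∧
    P.PreservesMetricOn σ σ.source ∧ P.IsCRMapOn σ σ.source ∧ P.ReflectsAt σ x

/-- `g_η` is (globally) `CR`-symmetric: for every point `x` there is an isometric
`CR`-diffeomorphism `M → M` which is a symmetry at `x`. -/
def IsCRSymmetric : Prop :=
  ∀ x : M, ∃ σ : Diffeomorph 𝓘(ℝ, E) 𝓘(ℝ, E) M M ∞,
    P.PreservesMetricOn σ univ ∧ P.IsCRMapOn σ univ ∧ P.ReflectsAt σ x

/-! ### `φ`-symmetry -/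

/-- `s` is, on `U`, the characteristic reflection at `x`, i.e. the geodesic reflection with respect
to the integral curve `c` of `ξ` through `x`: it maps `γ t` to `γ (-t)` for every geodesic `γ`
which starts at a point of `c` orthogonally to `ξ`. Only the arcs of `c` through `x` and the
geodesic segments that lie in `U` are considered. -/
def IsCharacteristicReflectionOn (x : M) (s : M → M) (U : Set M) : Prop :=
  ∀ (c : ℝ → M) (a b : ℝ), a < 0 → 0 < b → c 0 = x →
    IsMIntegralCurveOn (I := 𝓘(ℝ, E)) c P.ξ (Ioo a b) → (∀ τ ∈ Ioo a b, c τ ∈ U) →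
    ∀ τ ∈ Ioo a b, ∀ (γ : ℝ → M) (ε : ℝ), 0 < ε → γ 0 = c τ →
      P.IsGeodesicOn γ (Ioo (-ε) ε) → (∀ t ∈ Ioo (-ε) ε, γ t ∈ U) →
      P.webster (γ 0) (mfderiv 𝓘(ℝ, ℝ) 𝓘(ℝ, E) γ 0 (1 : ℝ)) (P.ξ (γ 0)) = 0 →
      ∀ t ∈ Ioo (-ε) ε, s (γ t) = γ (-t)

/-- `M` is locally `φ`-symmetric: the characteristic reflections are local isometries. -/
def IsLocallyPhiSymmetric : Prop :=
  ∀ x : M, ∃ s : OpenPartialHomeomorph M M, s.target = s.source ∧ x ∈ s.source ∧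
    ContMDiffOn 𝓘(ℝ, E) 𝓘(ℝ, E) ∞ s s.source ∧
    ContMDiffOn 𝓘(ℝ, E) 𝓘(ℝ, E) ∞ s.symm s.target ∧
    P.PreservesMetricOn s s.source ∧ P.IsCharacteristicReflectionOn x s s.source

/-- `ξ` generates a global one-parameter group of automorphisms of the contact metric structure. -/
def ReebGeneratesAutomorphisms : Prop :=
  ∃ Φ : ℝ → M → M,
    ContMDiff (𝓘(ℝ, ℝ).prod 𝓘(ℝ, E)) 𝓘(ℝ, E) ∞ (fun q : ℝ × M => Φ q.1 q.2) ∧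
    (∀ x, Φ 0 x = x) ∧ (∀ r t x, Φ (r + t) x = Φ r (Φ t x)) ∧
    (∀ x, IsMIntegralCurve (I := 𝓘(ℝ, E)) (fun t => Φ t x) P.ξ) ∧
    ∀ t, P.IsContactMetricMap (Φ t)

/-- `M` is a (globally) `φ`-symmetric space: it is locally `φ`-symmetric, its characteristic
reflections are globally defined isometries, and `ξ` generates a global one-parameter group of
automorphisms. -/
def IsPhiSymmetric : Prop :=
  P.IsLocallyPhiSymmetric ∧
  (∀ x : M, ∃ s : Diffeomorph 𝓘(ℝ, E) 𝓘(ℝ, E) M M ∞,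
    P.PreservesMetricOn s univ ∧ P.IsCharacteristicReflectionOn x s univ) ∧
  P.ReebGeneratesAutomorphisms

end PseudohermitianStructure

end CRGeometry

end

/-!
Both halves of the equivalence compare a symmetry at a point `x` with the reflection in the Reeb
orbit through `x`; on a Sasakian manifold the differential of either at `x` is
`v ↦ -v + 2 η(v) ξ`.

*From `CR`-symmetries to reflections.* An isometric `CR` map `σ` satisfies `σ^* η = f η`, and
comparing the Levi forms gives `f = 1` (`preservesFormOn_of_isCRMapOn`); hence `σ` preserves `ξ`
and fixes the Reeb orbit of its centre pointwise. Along the orbit the differential of `σ` satisfies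
a linear differential equation, of which `v ↦ -v + 2 η(v) ξ` is a solution
(`differential_eq_reflection`). So `σ` reverses the initial velocities of the geodesics orthogonal
to the orbit, and uniqueness of geodesics gives
`isCharacteristicReflectionOn_of_isCRMapOn`.

*From reflections to `CR`-symmetries.* Let `σ` be an isometric characteristic reflection at `x`. On
a Sasakian manifold `ξ` is a Killing field, and so is the difference `K` of the pullback of `ξ` by
`σ` and of `ξ`. The differential of `σ` at `x` preserves `η` and `dη`, so `K` and the exterior
derivative of its dual one-form vanish at `x`, and hence so does `DK`. A Killing field with
vanishing first-order jet at one point of a connected set vanishes there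
(`eventually_eq_zero_of_killing`), so `σ` preserves `η`, hence `dη` and `φ`
(`IsSasakian.isCRMapOn_of_isCharacteristicReflectionOn`). For the local statement this is applied on
the connected component of `x` in the given domain, which `σ` preserves.

*Completeness of `ξ`.* In the global statement, `CR`-symmetries must also produce the flow of `ξ`.
The symmetry at the midpoint of a horizontal geodesic interchanges its end points, so the maximal
domain of the Reeb orbit is the same at both. Near a point `y` every point is reached by a
horizontal geodesic followed by a Reeb arc of length `τ`, where `dτ = η` at `y`. If the domain at
`y` is not the whole line, it is not invariant under translations, so the functions `τ` at nearby
centres differ by constants, and `dτ = η` near `y`. This contradicts `dη ≠ 0`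
(`IsCRSymmetric.reebDomain_eq_univ`). The flow is smooth because local flows are
(`exists_smooth_local_flow`, by the inverse function theorem on a space of paths), and it preserves
`η` and the metric because `ξ` does infinitesimally (`IsReebFlow.preservesForm_and_metric`).
-/

noncomputable section

set_option maxSynthPendingDepth 3
set_option linter.unusedSectionVars false

open Filter Topology Metric

namespace CRGeometry

/-! ### Smooth dependence of integral curves on the initial point -/

section Superposition

variable {K : Type*} [TopologicalSpace K] [CompactSpace K]
  {E : Type*} [NormedAddCommGroup E] [NormedSpace ℝ E]

/-- Pointwise application of a continuous family of continuous linear maps to a continuous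
function, as a bounded bilinear map on spaces of continuous functions. -/
def pointwiseApply (K E F : Type*) [TopologicalSpace K] [CompactSpace K]
    [NormedAddCommGroup E] [NormedSpace ℝ E] [NormedAddCommGroup F] [NormedSpace ℝ F] :
    C(K, E →L[ℝ] F) →L[ℝ] C(K, E) →L[ℝ] C(K, F) :=
  LinearMap.mkContinuous₂
    (LinearMap.mk₂ ℝ (fun (A : C(K, E →L[ℝ] F)) (h : C(K, E)) =>
        (⟨fun k => A k (h k), A.continuous.clm_apply h.continuous⟩ : C(K, F)))
      (fun A A' h => by ext; simp) (fun c A h => by ext; simp)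
      (fun A h h' => by ext; simp) (fun c A h => by ext; simp)) 1
    (fun A h => by
      rw [one_mul]
      refine (ContinuousMap.norm_le _ (by positivity)).2 fun k => ?_
      exact ((A k).le_opNorm _).trans (mul_le_mul (A.norm_coe_le_norm k) (h.norm_coe_le_norm k)
        (by positivity) (by positivity)))

/-- The superposition operator `γ ↦ f ∘ γ` has the derivative `h ↦ (f' ∘ γ) h`. The uniform estimate
comes from the continuity of `γ ↦ f' ∘ γ` in the compact-open topology. -/
theorem hasFDerivAt_superposition {F : Type*} [NormedAddCommGroup F] [NormedSpace ℝ F]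
    (f : C(E, F)) (f' : C(E, E →L[ℝ] F)) (hf : ∀ x, HasFDerivAt f (f' x) x) (γ : C(K, E)) :
    HasFDerivAt (fun γ : C(K, E) => f.comp γ) (pointwiseApply K E F (f'.comp γ)) γ := by
  rw [hasFDerivAt_iff_isLittleO_nhds_zero, Asymptotics.isLittleO_iff]
  intro ε hε
  have hcont : Continuous (fun γ : C(K, E) => f'.comp γ) := ContinuousMap.continuous_postcomp f'
  obtain ⟨δ, hδ, hball⟩ := (Metric.continuousAt_iff (f := fun γ : C(K, E) => f'.comp γ)).1
    hcont.continuousAt ε hε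
  filter_upwards [Metric.ball_mem_nhds (0 : C(K, E)) hδ] with h hh
  rw [mem_ball_zero_iff] at hh
  refine (ContinuousMap.norm_le _ (by positivity)).2 fun k => ?_
  have hk : ‖h k‖ < δ := (h.norm_coe_le_norm k).trans_lt hh
  have hbound : ∀ e ∈ ball (γ k) δ, ‖f' e - f' (γ k)‖ ≤ ε := by
    intro e he
    -- move `γ` by the constant vector `e - γ k`
    have h1 : dist (γ + ContinuousMap.const K (e - γ k)) γ < δ := by
      rw [dist_eq_norm, add_sub_cancel_left]
      refine (ContinuousMap.norm_lt_iff _ hδ).2 fun _ => ?_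
      simpa [dist_eq_norm] using he
    have h2 := (hball h1).le
    have h3 := (ContinuousMap.dist_apply_le_dist k).trans h2
    simpa [dist_eq_norm] using h3
  have := (convex_ball (γ k) δ).norm_image_sub_le_of_norm_hasFDerivWithin_le'
    (fun e _ => (hf e).hasFDerivWithinAt) hbound (mem_ball_self hδ)
    (show γ k + h k ∈ ball (γ k) δ by simpa [dist_eq_norm] using hk)
  rw [add_sub_cancel_left] at this
  exact this.trans (mul_le_mul_of_nonneg_left (h.norm_coe_le_norm k) hε.le)

/-- The superposition operator `γ ↦ f ∘ γ` on continuous functions is as smooth as `f`. -/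
theorem contDiff_superposition.{u, w} {K : Type w} [TopologicalSpace K] [CompactSpace K]
    {E : Type u} [NormedAddCommGroup E] [NormedSpace ℝ E] (n : ℕ) :
    ∀ {F : Type u} [NormedAddCommGroup F] [NormedSpace ℝ F] (f : C(E, F)), ContDiff ℝ n f →
      ContDiff ℝ n (fun γ : C(K, E) => f.comp γ) := by
  induction n with
  | zero =>
    intro F _ _ f _
    exact contDiff_zero.2 (ContinuousMap.continuous_postcomp f)
  | succ n ih =>
    intro F _ _ f hf
    obtain ⟨f', hf', hd⟩ := contDiff_succ_iff_hasFDerivAt.1 (by exact_mod_cast hf)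
    have hp : ContDiff ℝ n (pointwiseApply K E F) :=
      ContinuousLinearMap.contDiff (E := C(K, E →L[ℝ] F)) (F := C(K, E) →L[ℝ] C(K, F)) _
    have h := contDiff_succ_iff_hasFDerivAt (𝕜 := ℝ) (n := n)
      (f := fun γ : C(K, E) => f.comp γ) |>.2
      ⟨fun γ => pointwiseApply K E F ((⟨f', hf'.continuous⟩ : C(E, E →L[ℝ] F)).comp γ),
        hp.comp (ih ⟨f', hf'.continuous⟩ hf'),
        fun γ => hasFDerivAt_superposition f ⟨f', hf'.continuous⟩ hd γ⟩
    exact_mod_cast h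

end Superposition

section LocalFlow

variable {E : Type*} [NormedAddCommGroup E] [NormedSpace ℝ E]

/-- The Volterra operator `g ↦ ∫₀ g` on continuous functions on `[0, 1]`. -/
def volterra (E : Type*) [NormedAddCommGroup E] [NormedSpace ℝ E] :
    C(Icc (0 : ℝ) 1, E) →L[ℝ] C(Icc (0 : ℝ) 1, E) :=
  LinearMap.mkContinuous
    { toFun := fun g => ⟨fun s => ∫ r in (0 : ℝ)..s, IccExtend zero_le_one g r,
        (intervalIntegral.continuous_primitive
          (fun _ _ => (g.continuous.Icc_extend' (h := zero_le_one)).intervalIntegrable _ _) 0).comp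
            continuous_subtype_val⟩
      map_add' := fun g g' => by
        ext s
        exact intervalIntegral.integral_add
          ((g.continuous.Icc_extend' (h := zero_le_one)).intervalIntegrable _ _)
          ((g'.continuous.Icc_extend' (h := zero_le_one)).intervalIntegrable _ _)
      map_smul' := fun c g => by
        ext s
        exact intervalIntegral.integral_smul c _ } 1
    (fun g => by
      rw [one_mul]
      refine (ContinuousMap.norm_le _ (norm_nonneg _)).2 fun s => ?_
      have h := intervalIntegral.norm_integral_le_of_norm_le_const (a := 0) (b := s.1)
        (f := IccExtend zero_le_one g) (C := ‖g‖) fun r _ => g.norm_coe_le_norm _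
      refine h.trans ?_
      rw [sub_zero, abs_of_nonneg s.2.1]
      exact mul_le_of_le_one_right (norm_nonneg _) s.2.2)

/-- The shear `(q, h) ↦ (q, h - L q)`. -/
def shearEquiv {Q C : Type*} [NormedAddCommGroup Q] [NormedSpace ℝ Q] [NormedAddCommGroup C]
    [NormedSpace ℝ C] (L : Q →L[ℝ] C) : (Q × C) ≃L[ℝ] (Q × C) :=
  ContinuousLinearEquiv.equivOfInverse
    ((ContinuousLinearMap.fst ℝ Q C).prod
      (ContinuousLinearMap.snd ℝ Q C - L.comp (ContinuousLinearMap.fst ℝ Q C)))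
    ((ContinuousLinearMap.fst ℝ Q C).prod
      (ContinuousLinearMap.snd ℝ Q C + L.comp (ContinuousLinearMap.fst ℝ Q C)))
    (fun x => by ext <;> simp) (fun x => by ext <;> simp)

/-- Near a point at which the derivative of a smooth map is invertible, the map has a smooth local
inverse. -/
theorem exists_smooth_local_inverse {X Y : Type*} [NormedAddCommGroup X] [NormedSpace ℝ X]
    [CompleteSpace X] [NormedAddCommGroup Y] [NormedSpace ℝ Y]
    {f : X → Y} (hf : ContDiff ℝ ∞ f) {a : X} (e : X ≃L[ℝ] Y)
    (he : HasFDerivAt f (e : X →L[ℝ] Y) a) :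
    ∃ g : Y → X, (∀ᶠ x in 𝓝 a, g (f x) = x) ∧ ∃ V : Set Y, IsOpen V ∧ f a ∈ V ∧
      ContDiffOn ℝ ∞ g V := by
  let φ := hf.contDiffAt.toOpenPartialHomeomorph f he (by simp)
  have hφ : (φ : X → Y) = f := rfl
  have ha : a ∈ φ.source := hf.contDiffAt.mem_toOpenPartialHomeomorph_source he (by simp)
  have hfa : f a ∈ φ.target := hf.contDiffAt.image_mem_toOpenPartialHomeomorph_target he (by simp)
  refine ⟨φ.symm, ?_, ?_⟩
  · filter_upwards [φ.open_source.mem_nhds ha] with x hx using φ.left_inv hx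
  have hopen : IsOpen {x | ∃ e' : X ≃L[ℝ] Y, (e' : X →L[ℝ] Y) = fderiv ℝ f x} :=
    (ContinuousLinearEquiv.isOpen (𝕜 := ℝ) (E := X) (F := Y)).preimage
      (hf.continuous_fderiv (by simp))
  refine ⟨φ.target ∩ φ.symm ⁻¹' {x | ∃ e' : X ≃L[ℝ] Y, (e' : X →L[ℝ] Y) = fderiv ℝ f x},
    φ.isOpen_inter_preimage_symm hopen, ⟨hfa, ?_⟩, ?_⟩
  · refine ⟨e, ?_⟩
    rw [show φ.symm (f a) = a from φ.left_inv ha, he.fderiv]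
  · rintro y ⟨hy, e', he'⟩
    refine (φ.contDiffAt_symm hy (f₀' := e') ?_ hf.contDiffAt).contDiffWithinAt
    rw [he']
    exact ((hf.differentiable (by simp)) _).hasFDerivAt

/-- The inclusion of constant functions into continuous functions on `[0, 1]`. -/
def constPath (E : Type*) [NormedAddCommGroup E] [NormedSpace ℝ E] :
    E →L[ℝ] C(Icc (0 : ℝ) 1, E) :=
  LinearMap.mkContinuous
    { toFun := fun x => ContinuousMap.const _ x
      map_add' := fun _ _ => rfl
      map_smul' := fun _ _ => rfl } 1
    (fun x => by
      rw [one_mul]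
      exact (ContinuousMap.norm_le _ (norm_nonneg _)).2 fun _ => le_rfl)

/-- The local flow of a bounded smooth vector field is jointly smooth. The rescaled integral curve
`s ↦ α (t s)`, `0 ≤ s ≤ 1`, through `x` is the solution `γ` of `γ - x - t ∫₀ f ∘ γ = 0`, so the
inverse function theorem in the space of continuous paths applies. -/
theorem exists_smooth_flow_of_bounded [CompleteSpace E] {f : E → E} (hf : ContDiff ℝ ∞ f) {B : ℝ}
    (hB : ∀ x, ‖f x‖ ≤ B) (x₀ : E) :
    ∃ ε > 0, ∃ ψ : E × ℝ → E, ContDiffOn ℝ ∞ ψ (ball x₀ ε ×ˢ Ioo (-ε) ε) ∧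
      ∀ x ∈ ball x₀ ε, ψ (x, 0) = x ∧
        ∀ t ∈ Ioo (-ε) ε, HasDerivAt (fun t => ψ (x, t)) (f (ψ (x, t))) t := by
  have hB0 : 0 ≤ B := (norm_nonneg _).trans (hB x₀)
  let fc : C(E, E) := ⟨f, hf.continuous⟩
  have hN : ContDiff ℝ ∞ (fun γ : C(Icc (0 : ℝ) 1, E) => fc.comp γ) :=
    contDiff_infty.2 fun n => contDiff_superposition n fc (hf.of_le (by exact_mod_cast le_top))
  let Ψ : (E × ℝ) × C(Icc (0 : ℝ) 1, E) → (E × ℝ) × C(Icc (0 : ℝ) 1, E) := fun p =>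
    (p.1, p.2 - constPath E p.1.1 - p.1.2 • volterra E (fc.comp p.2))
  have hW : ContDiff ℝ ∞ (fun p : (E × ℝ) × C(Icc (0 : ℝ) 1, E) => volterra E (fc.comp p.2)) :=
    (volterra E).contDiff.comp (hN.comp contDiff_snd)
  have hΨ : ContDiff ℝ ∞ Ψ :=
    contDiff_fst.prodMk ((contDiff_snd.sub ((constPath E).contDiff.comp
      (contDiff_fst.comp contDiff_fst))).sub ((contDiff_snd.comp contDiff_fst).smul hW))
  let p₀ : (E × ℝ) × C(Icc (0 : ℝ) 1, E) := ((x₀, 0), constPath E x₀)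
  have hΨp₀ : Ψ p₀ = ((x₀, 0), 0) := by simp [Ψ, p₀]
  let c := volterra E (fc.comp (constPath E x₀))
  let L : E × ℝ →L[ℝ] C(Icc (0 : ℝ) 1, E) :=
    (constPath E).comp (ContinuousLinearMap.fst ℝ E ℝ) +
      (ContinuousLinearMap.snd ℝ E ℝ).smulRight c
  have hder : HasFDerivAt Ψ (shearEquiv L : _ →L[ℝ] _) p₀ := by
    have h1 : HasFDerivAt (fun p : (E × ℝ) × C(Icc (0 : ℝ) 1, E) => p.1.2)
        ((ContinuousLinearMap.snd ℝ E ℝ).comp (ContinuousLinearMap.fst ℝ (E × ℝ) _)) p₀ :=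
      ((ContinuousLinearMap.snd ℝ E ℝ).comp
        (ContinuousLinearMap.fst ℝ (E × ℝ) C(Icc (0 : ℝ) 1, E))).hasFDerivAt
    have h2 := h1.smul (hW.differentiable (by simp) p₀).hasFDerivAt
    have h3 : HasFDerivAt (fun p : (E × ℝ) × C(Icc (0 : ℝ) 1, E) => p.2 - constPath E p.1.1)
        (ContinuousLinearMap.snd ℝ (E × ℝ) _ - (constPath E).comp
          ((ContinuousLinearMap.fst ℝ E ℝ).comp (ContinuousLinearMap.fst ℝ (E × ℝ) _))) p₀ :=
      (ContinuousLinearMap.snd ℝ (E × ℝ) _ - (constPath E).comp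
          ((ContinuousLinearMap.fst ℝ E ℝ).comp
            (ContinuousLinearMap.fst ℝ (E × ℝ) C(Icc (0 : ℝ) 1, E)))).hasFDerivAt
    have h4 := (hasFDerivAt_fst (𝕜 := ℝ) (p := p₀)).prodMk (h3.sub h2)
    refine h4.congr_fderiv ?_
    refine ContinuousLinearMap.ext fun q => ?_
    refine Prod.ext rfl ?_
    change q.2 - constPath E q.1.1 - ((0 : ℝ) • _ + q.1.2 • c) =
      q.2 - (constPath E q.1.1 + q.1.2 • c)
    rw [zero_smul, zero_add, sub_sub]
  obtain ⟨g, hg, V, hV, hpV, hgV⟩ := exists_smooth_local_inverse hΨ _ hder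
  rw [hΨp₀] at hpV
  obtain ⟨δ, hδ, hgδ⟩ := Metric.eventually_nhds_iff_ball.1 hg
  obtain ⟨δ', hδ', hVδ⟩ := Metric.isOpen_iff.1 hV _ hpV
  obtain ⟨r, hr, ε₁, hε₁, hex⟩ :=
    (hf.contDiffAt (x := x₀)).of_le (show (1 : WithTop ℕ∞) ≤ ∞ by simp)
    |>.exists_forall_mem_closedBall_exists_eq_forall_mem_Ioo_hasDerivAt 0
  obtain ⟨ε, hε, hεr, hεε₁, hεδ', hεδ⟩ :
      ∃ ε > 0, ε ≤ r ∧ ε ≤ ε₁ ∧ ε ≤ δ' ∧ (B + 1) * ε < δ := by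
    refine ⟨min (min r ε₁) (min δ' (δ / (B + 2))), by positivity, by simp, by simp, by simp, ?_⟩
    calc (B + 1) * min (min r ε₁) (min δ' (δ / (B + 2))) ≤ (B + 1) * (δ / (B + 2)) := by
          gcongr; simp
      _ < (B + 2) * (δ / (B + 2)) := by gcongr; linarith
      _ = δ := by field_simp
  -- the local inverse `g` of `Ψ` recovers the integral curves of Picard's theorem
  have key : ∀ x ∈ ball x₀ ε, ∃ α : ℝ → E, α 0 = x ∧
      ∀ t ∈ Ioo (-ε) ε, HasDerivAt α (f (α t)) t ∧ (g ((x, t), 0)).2 ⟨1, by simp⟩ = α t := by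
    intro x hx
    obtain ⟨α, hα0, hα⟩ := hex x (closedBall_subset_closedBall hεr (ball_subset_closedBall hx))
    have hα' : ∀ t ∈ Ioo (-ε) ε, HasDerivAt α (f (α t)) t := fun t ht =>
      hα t ⟨by linarith [ht.1], by linarith [ht.2]⟩
    have hbd : ∀ t ∈ Ioo (-ε) ε, ‖α t - x‖ ≤ B * |t| := by
      intro t ht
      have := (convex_Ioo (-ε) ε).norm_image_sub_le_of_norm_hasDerivWithin_le
        (fun s hs => (hα' s hs).hasDerivWithinAt) (fun s _ => hB (α s))
        (show (0 : ℝ) ∈ Ioo (-ε) ε by simp [hε]) ht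
      simpa [hα0] using this
    refine ⟨α, hα0, fun t ht => ⟨hα' t ht, ?_⟩⟩
    have hmul : ∀ s ∈ Icc (0 : ℝ) 1, t * s ∈ Ioo (-ε) ε := fun s hs => by
      rw [mem_Ioo, ← abs_lt] at ht ⊢
      rw [abs_mul, abs_of_nonneg hs.1]
      exact (mul_le_of_le_one_right (abs_nonneg _) hs.2).trans_lt ht
    let γ : C(Icc (0 : ℝ) 1, E) := ⟨fun s => α (t * s), by
      refine continuous_iff_continuousAt.2 fun s => ?_
      exact ContinuousAt.comp (f := fun s : Icc (0 : ℝ) 1 => t * (s : ℝ)) (g := α)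
        (hα' _ (hmul s s.2)).continuousAt (by fun_prop)⟩
    have hball : (((x, t), γ) : (E × ℝ) × C(Icc (0 : ℝ) 1, E)) ∈ ball p₀ δ := by
      have hx' : dist x x₀ < ε := hx
      have ht' : |t| < ε := abs_lt.2 ht
      have hεδ2 : ε < δ := by nlinarith
      rw [mem_ball, Prod.dist_eq, Prod.dist_eq]
      refine max_lt (max_lt (hx'.trans hεδ2) ?_) ?_
      · simpa [p₀] using ht'.trans hεδ2
      · refine lt_of_le_of_lt ((ContinuousMap.dist_le (by positivity)).2 fun s => ?_) hεδ
        change dist (α (t * s)) x₀ ≤ _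
        have h1 := hbd _ (hmul s s.2)
        have h2 : |t * s| ≤ ε := (abs_lt.2 (hmul s s.2)).le
        calc dist (α (t * s)) x₀ ≤ dist (α (t * s)) x + dist x x₀ := dist_triangle _ _ _
          _ ≤ B * ε + ε := add_le_add
            (by rw [dist_eq_norm]; exact h1.trans (by gcongr)) hx'.le
          _ = (B + 1) * ε := by ring
    have hzero : Ψ ((x, t), γ) = ((x, t), 0) := by
      refine Prod.ext rfl ?_
      ext s
      change α (t * s) - x - t • (∫ r in (0 : ℝ)..s, IccExtend zero_le_one (fc.comp γ) r) = 0
      have hs := s.2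
      have hsub : uIcc (0 : ℝ) s ⊆ Icc 0 1 := by
        rw [uIcc_of_le hs.1]; exact Icc_subset_Icc_right hs.2
      have h1 : t • (∫ r in (0 : ℝ)..s, IccExtend zero_le_one (fc.comp γ) r) =
          ∫ r in (0 : ℝ)..s, t • f (α (t * r)) := by
        rw [← intervalIntegral.integral_smul]
        refine intervalIntegral.integral_congr fun r hr => ?_
        simp only [IccExtend_of_mem zero_le_one _ (hsub hr)]
        rfl
      have h2 : ∀ r ∈ uIcc (0 : ℝ) s, HasDerivAt (fun r => α (t * r)) (t • f (α (t * r))) r := by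
        intro r hr
        have := (hα' _ (hmul r (hsub hr))).scomp r ((hasDerivAt_id r).const_mul t)
        rw [mul_one] at this
        exact this
      have h3 : ContinuousOn (fun r => t • f (α (t * r))) (uIcc (0 : ℝ) s) :=
        (hf.continuous.comp_continuousOn fun r hr => (h2 r hr).continuousAt.continuousWithinAt
          ).const_smul t
      rw [h1, intervalIntegral.integral_eq_sub_of_hasDerivAt h2 h3.intervalIntegrable]
      simp [hα0]
    have := hgδ _ hball
    rw [hzero] at this
    rw [this]
    change α (t * 1) = α t
    rw [mul_one]
  refine ⟨ε, hε, fun q => (g (q, 0)).2 ⟨1, by simp⟩, ?_, fun x hx => ?_⟩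
  · have heval : ContDiff ℝ ∞ fun γ : C(Icc (0 : ℝ) 1, E) => γ ⟨1, by simp⟩ :=
      (ContinuousMap.evalCLM (M := E) ℝ (⟨1, by simp⟩ : Icc (0 : ℝ) 1)).contDiff
    refine heval.comp_contDiffOn (contDiff_snd.comp_contDiffOn (hgV.comp
      (contDiff_id.prodMk contDiff_const).contDiffOn ?_))
    rintro ⟨x, t⟩ ⟨hx, ht⟩
    refine hVδ ?_
    have ht' : |t| < ε := abs_lt.2 ht
    have hx' : dist x x₀ < ε := hx
    simp only [mem_ball, Prod.dist_eq]
    refine max_lt (max_lt (hx'.trans_le hεδ') ?_) (by simpa using hδ')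
    simpa using ht'.trans_le hεδ'
  · obtain ⟨α, hα0, hα⟩ := key x hx
    refine ⟨(hα 0 (by simp [hε])).2.trans hα0, fun t ht => ?_⟩
    have h1 := (hα t ht).1
    rw [← (hα t ht).2] at h1
    refine h1.congr_of_eventuallyEq ?_
    filter_upwards [isOpen_Ioo.mem_nhds ht] with s hs using (hα s hs).2

/-- A smooth vector field on an open subset of a finite-dimensional space has a jointly smooth local
flow near every point, which may be taken to stay in any prescribed neighbourhood of the point. -/
theorem exists_smooth_local_flow [FiniteDimensional ℝ E] {f : E → E} {Ω : Set E} (hΩ : IsOpen Ω)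
    (hf : ContDiffOn ℝ ∞ f Ω) {x₀ : E} (hx₀ : x₀ ∈ Ω) :
    ∃ ε > 0, ∃ ψ : E × ℝ → E, ContDiffOn ℝ ∞ ψ (ball x₀ ε ×ˢ Ioo (-ε) ε) ∧
      ∀ x ∈ ball x₀ ε, ψ (x, 0) = x ∧ ∀ t ∈ Ioo (-ε) ε, ψ (x, t) ∈ Ω ∧
        HasDerivAt (fun t => ψ (x, t)) (f (ψ (x, t))) t := by
  have : CompleteSpace E := FiniteDimensional.complete ℝ E
  obtain ⟨r, hr, hrΩ⟩ := Metric.isOpen_iff.1 hΩ x₀ hx₀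
  -- cut the vector field off outside a small ball
  let b : ContDiffBump x₀ := ⟨r / 3, r / 2, by positivity, by linarith⟩
  have hb : b.rOut = r / 2 := rfl
  let F : E → E := fun x => b x • f x
  have hF : ContDiff ℝ ∞ F := by
    refine contDiff_iff_contDiffAt.2 fun x => ?_
    by_cases hx : x ∈ ball x₀ r
    · exact b.contDiff.contDiffAt.smul (hf.contDiffAt (hΩ.mem_nhds (hrΩ hx)))
    · have hx' : x ∈ (closedBall x₀ (r / 2))ᶜ := fun h =>
        hx (closedBall_subset_ball (by linarith) h)
      refine (contDiffAt_const (c := (0 : E))).congr_of_eventuallyEq ?_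
      filter_upwards [isClosed_closedBall.isOpen_compl.mem_nhds hx'] with z hz
      have : b z = 0 := b.zero_of_le_dist (by
        rw [hb]; exact (not_le.1 fun h => hz h).le)
      simp [F, this]
  have hsupp : HasCompactSupport F := b.hasCompactSupport.smul_right
  obtain ⟨B, hB⟩ := hsupp.exists_bound_of_continuous hF.continuous
  obtain ⟨ε, hε, ψ, hψ, hflow⟩ := exists_smooth_flow_of_bounded hF hB x₀
  have hcont : ContinuousAt ψ (x₀, 0) :=
    hψ.continuousOn.continuousAt
      ((isOpen_ball.prod isOpen_Ioo).mem_nhds ⟨by simp [hε], by simp [hε]⟩)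
  have hψ0 : ψ (x₀, 0) = x₀ := (hflow x₀ (by simp [hε])).1
  obtain ⟨ε', hε', hball⟩ := Metric.continuousAt_iff.1 hcont (r / 3) (by positivity)
  have hle : ball x₀ (min ε ε') ×ˢ Ioo (-min ε ε') (min ε ε') ⊆ ball x₀ ε ×ˢ Ioo (-ε) ε :=
    prod_mono (ball_subset_ball (min_le_left _ _))
      (Ioo_subset_Ioo (neg_le_neg (min_le_left _ _)) (min_le_left _ _))
  refine ⟨min ε ε', by positivity, ψ, hψ.mono hle, fun x hx => ?_⟩
  obtain ⟨h0, h1⟩ := hflow x (ball_subset_ball (min_le_left _ _) hx)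
  refine ⟨h0, fun t ht => ?_⟩
  have ht' : |t| < min ε ε' := abs_lt.2 ht
  have hmem : ψ (x, t) ∈ ball x₀ (r / 3) := by
    have := @hball (x, t) (by
      rw [Prod.dist_eq]
      refine max_lt ((mem_ball.1 hx).trans_le (min_le_right _ _)) ?_
      simpa using ht'.trans_le (min_le_right _ _))
    rwa [hψ0] at this
  refine ⟨hrΩ (ball_subset_ball (by linarith) hmem), ?_⟩
  have h2 := h1 t (by rw [mem_Ioo, ← abs_lt]; exact ht'.trans_le (min_le_left _ _))
  have h3 : b (ψ (x, t)) = 1 := b.one_of_mem_closedBall (ball_subset_closedBall hmem)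
  simpa [F, h3] using h2

end LocalFlow

/-! ### Uniqueness of integral curves -/

section Uniqueness

variable {E : Type*} [NormedAddCommGroup E] [NormedSpace ℝ E]

/-- A property of points of an interval which, near each point, passes from any parameter to any
other, passes from any parameter to any other globally. -/
theorem forall_mem_Ioo_of_locally {a b : ℝ} {Q : ℝ → Prop}
    (hloc : ∀ t ∈ Ioo a b, ∃ δ > 0, ∀ t₁ ∈ Ioo (t - δ) (t + δ), ∀ t₂ ∈ Ioo (t - δ) (t + δ),
      t₁ ∈ Ioo a b → t₂ ∈ Ioo a b → Q t₁ → Q t₂)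
    {t₀ : ℝ} (ht₀ : t₀ ∈ Ioo a b) (h₀ : Q t₀) : ∀ t ∈ Ioo a b, Q t := by
  intro t ht
  refine isPreconnected_Ioo.induction₂ (fun t₁ t₂ => t₁ ∈ Ioo a b → t₂ ∈ Ioo a b → (Q t₁ ↔ Q t₂))
    ?_ ?_ ?_ ht₀ ht ht₀ ht |>.1 h₀
  · intro s hs
    obtain ⟨δ, hδ, h⟩ := hloc s hs
    have : ∀ᶠ y in 𝓝[Ioo a b] s, y ∈ Ioo (s - δ) (s + δ) :=
      nhdsWithin_le_nhds (Ioo_mem_nhds (by linarith) (by linarith))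
    filter_upwards [this] with y hy hs' hy'
    have hss : s ∈ Ioo (s - δ) (s + δ) := ⟨by linarith, by linarith⟩
    exact ⟨h s hss y hy hs' hy', h y hy s hss hy' hs'⟩
  · intro x y z _ hy _ h1 h2 hx hz
    exact (h1 hx hy).trans (h2 hy hz)
  · intro x y _ _ h hy hx
    exact (h hx hy).symm

/-- Integral curves of a `C¹` vector field on an open set which agree at one parameter agree on
the whole interval. -/
theorem eqOn_Ioo_of_hasDerivAt {f : E → E} {Ω : Set E} (hΩ : IsOpen Ω) (hf : ContDiffOn ℝ 1 f Ω)
    {a b : ℝ} {z w : ℝ → E} (hz : ∀ t ∈ Ioo a b, z t ∈ Ω ∧ HasDerivAt z (f (z t)) t)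
    (hw : ∀ t ∈ Ioo a b, w t ∈ Ω ∧ HasDerivAt w (f (w t)) t) {t₀ : ℝ} (ht₀ : t₀ ∈ Ioo a b)
    (h₀ : z t₀ = w t₀) : ∀ t ∈ Ioo a b, z t = w t := by
  refine forall_mem_Ioo_of_locally (fun t ht => ?_) ht₀ h₀
  by_cases hzw : z t = w t
  · obtain ⟨K, s, hs, hK⟩ := (hf.contDiffAt (hΩ.mem_nhds (hz t ht).1)).exists_lipschitzOnWith
    have h1 : ∀ᶠ r in 𝓝 t, r ∈ Ioo a b ∧ z r ∈ s ∧ w r ∈ s :=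
      (isOpen_Ioo.eventually_mem ht).and (((hz t ht).2.continuousAt.eventually_mem hs).and
        ((hw t ht).2.continuousAt.eventually_mem (hzw ▸ hs)))
    obtain ⟨δ, hδ, h2⟩ := Metric.eventually_nhds_iff_ball.1 h1
    rw [Real.ball_eq_Ioo] at h2
    refine ⟨δ, hδ, fun t₁ h₁ t₂ h₂ _ _ heq => ?_⟩
    exact ODE_solution_unique_of_mem_Ioo (v := fun _ => f) (s := fun _ => s) (fun _ _ => hK) h₁
      (fun r hr => ⟨(hz r (h2 r hr).1).2, (h2 r hr).2.1⟩)
      (fun r hr => ⟨(hw r (h2 r hr).1).2, (h2 r hr).2.2⟩) heq h₂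
  · have h1 : ∀ᶠ r in 𝓝 t, z r ≠ w r :=
      (hz t ht).2.continuousAt.ne_iff_eventually_ne (hw t ht).2.continuousAt |>.1 hzw
    obtain ⟨δ, hδ, h2⟩ := Metric.eventually_nhds_iff_ball.1 h1
    rw [Real.ball_eq_Ioo] at h2
    exact ⟨δ, hδ, fun t₁ h₁ _ _ _ _ heq => absurd heq (h2 t₁ h₁)⟩

/-- Solutions of a homogeneous linear differential equation which vanish somewhere vanish
identically. -/
theorem eqOn_zero_of_linear_ode {a b : ℝ} {B : ℝ → E →L[ℝ] E} (hB : ContinuousOn B (Ioo a b))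
    {z : ℝ → E} (hz : ∀ t ∈ Ioo a b, HasDerivAt z (B t (z t)) t) {t₀ : ℝ} (ht₀ : t₀ ∈ Ioo a b)
    (h₀ : z t₀ = 0) : ∀ t ∈ Ioo a b, z t = 0 := by
  refine forall_mem_Ioo_of_locally (fun t ht => ?_) ht₀ h₀
  have hBt : ContinuousAt B t := hB.continuousAt (isOpen_Ioo.mem_nhds ht)
  have h1 : ∀ᶠ r in 𝓝 t, r ∈ Ioo a b ∧ ‖B r‖ < ‖B t‖ + 1 :=
    (isOpen_Ioo.eventually_mem ht).and (hBt.norm.eventually_lt_const (by linarith))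
  obtain ⟨δ, hδ, h2⟩ := Metric.eventually_nhds_iff_ball.1 h1
  rw [Real.ball_eq_Ioo] at h2
  refine ⟨δ, hδ, fun t₁ h₁ t₂ h₂ _ _ heq => ?_⟩
  have := ODE_solution_unique_of_mem_Ioo (v := fun r x => B r x) (s := fun _ => univ)
    (K := ⟨‖B t‖ + 1, by positivity⟩) (f := z) (g := fun _ => 0)
    (fun r hr => ((B r).lipschitz.weaken (by exact_mod_cast (h2 r hr).2.le)).lipschitzOnWith) h₁
    (fun r hr => ⟨hz r (h2 r hr).1, mem_univ _⟩)
    (fun r hr => ⟨by simpa using hasDerivAt_const r (0 : E), mem_univ _⟩) heq h₂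
  exact this

end Uniqueness

/-! ### Tensor calculus on open subsets of a vector space -/

section Calculus

variable {E : Type*} [NormedAddCommGroup E] [NormedSpace ℝ E]

theorem hasFDerivAt_eq_zero_of_eventually_const {F : Type*} [NormedAddCommGroup F]
    [NormedSpace ℝ F] {f : E → F} {L : E →L[ℝ] F} {y : E} (h : HasFDerivAt f L y) {c : F}
    (hc : ∀ᶠ z in 𝓝 y, f z = c) : L = 0 :=
  h.unique ((hasFDerivAt_const c y).congr_of_eventuallyEq hc)

/-- The exterior derivative `½ (Dη(u) v - Dη(v) u)` of a one-form on a vector space. -/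
def flatExtDer (η : E → E →L[ℝ] ℝ) (y u v : E) : ℝ :=
  (1 / 2 : ℝ) * (fderiv ℝ η y u v - fderiv ℝ η y v u)

/-- The Killing equation `(L_X g)(y) = 0` for a field `g` of bilinear forms on a vector space. -/
def KillingAt (g : E → E →L[ℝ] E →L[ℝ] ℝ) (X : E → E) (y : E) : Prop :=
  ∀ u v, fderiv ℝ g y (X y) u v + g y (fderiv ℝ X y u) v + g y u (fderiv ℝ X y v) = 0

/-- The geodesic equation at a point `y` for a velocity `v` and an acceleration `a`. -/
def GeodesicEq (g : E → E →L[ℝ] E →L[ℝ] ℝ) (y v a : E) : Prop :=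
  ∀ w, g y a w + (fderiv ℝ g y v v w - (1 / 2 : ℝ) * fderiv ℝ g y w v v) = 0

/-- The first-order consequence of `η(ξ) = 1` and `dη(ξ, ·) = 0`: the form `η` is invariant along
`ξ`. -/
theorem lieDeriv_form_eq_zero {η : E → E →L[ℝ] ℝ} {ξ : E → E} {y : E}
    (hη : DifferentiableAt ℝ η y) (hξ : DifferentiableAt ℝ ξ y)
    (h1 : ∀ᶠ z in 𝓝 y, η z (ξ z) = 1)
    (hd : ∀ v, fderiv ℝ η y (ξ y) v = fderiv ℝ η y v (ξ y)) (v : E) :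
    fderiv ℝ η y (ξ y) v + η y (fderiv ℝ ξ y v) = 0 := by
  have h := hasFDerivAt_eq_zero_of_eventually_const (hη.hasFDerivAt.clm_apply hξ.hasFDerivAt) h1
  have h' := DFunLike.congr_fun h v
  simp at h'
  rw [hd]; linarith

/-- The exterior derivative of an invariant form is invariant. -/
theorem lieDeriv_flatExtDer_eq_zero {η : E → E →L[ℝ] ℝ} {ξ : E → E} {y : E}
    (hη : ContDiffAt ℝ 2 η y) (hξ : ContDiffAt ℝ 2 ξ y)
    (hL : ∀ᶠ z in 𝓝 y, ∀ v, fderiv ℝ η z (ξ z) v + η z (fderiv ℝ ξ z v) = 0) (u v : E) :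
    (1 / 2 : ℝ) * (fderiv ℝ (fderiv ℝ η) y (ξ y) u v - fderiv ℝ (fderiv ℝ η) y (ξ y) v u)
      + flatExtDer η y (fderiv ℝ ξ y u) v + flatExtDer η y u (fderiv ℝ ξ y v) = 0 := by
  have hη1 := (hη.differentiableAt (by simp)).hasFDerivAt
  have hξ1 := (hξ.differentiableAt (by simp)).hasFDerivAt
  have hη2 := ((hη.fderiv_right (m := 1) (by norm_num)).differentiableAt (by simp)).hasFDerivAt
  have hξ2 := ((hξ.fderiv_right (m := 1) (by norm_num)).differentiableAt (by simp)).hasFDerivAt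
  have key : ∀ u v, fderiv ℝ (fderiv ℝ η) y u (ξ y) v + fderiv ℝ η y (fderiv ℝ ξ y u) v
      + (fderiv ℝ η y u (fderiv ℝ ξ y v) + η y (fderiv ℝ (fderiv ℝ ξ) y u v)) = 0 := by
    intro u v
    have h1 := (hη2.clm_apply hξ1).clm_apply (hasFDerivAt_const v y)
    have h2 := hη1.clm_apply (hξ2.clm_apply (hasFDerivAt_const v y))
    have h := hasFDerivAt_eq_zero_of_eventually_const (h1.add h2) (hL.mono fun z hz => hz v)
    have h' := DFunLike.congr_fun h u
    simp at h'
    linarith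
  have hs : ∀ u v, fderiv ℝ (fderiv ℝ η) y u v = fderiv ℝ (fderiv ℝ η) y v u := fun u v =>
    (hη.isSymmSndFDerivAt (by simp)).eq u v
  have hs' : ∀ u v, fderiv ℝ (fderiv ℝ ξ) y u v = fderiv ℝ (fderiv ℝ ξ) y v u := fun u v =>
    (hξ.isSymmSndFDerivAt (by simp)).eq u v
  have k1 := key u v
  have k2 := key v u
  rw [hs u (ξ y)] at k1
  rw [hs v (ξ y), hs' v u] at k2
  unfold flatExtDer
  linarith

/-- Exterior derivatives commute with pullback. -/
theorem flatExtDer_pullback {η η' : E → E →L[ℝ] ℝ} {F : E → E} {y : E}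
    (hF : ContDiffAt ℝ 2 F y) (hη' : DifferentiableAt ℝ η' (F y))
    (h : ∀ᶠ z in 𝓝 y, ∀ u, η z u = η' (F z) (fderiv ℝ F z u)) (u v : E) :
    flatExtDer η y u v = flatExtDer η' (F y) (fderiv ℝ F y u) (fderiv ℝ F y v) := by
  have hF1 := (hF.differentiableAt (by simp)).hasFDerivAt
  have hF2 := ((hF.fderiv_right (m := 1) (by norm_num)).differentiableAt (by simp)).hasFDerivAt
  have h1 := (hη'.hasFDerivAt.comp y hF1).clm_comp hF2
  have h2 : HasFDerivAt η _ y := h1.congr_of_eventuallyEq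
    (h.mono fun z hz => ContinuousLinearMap.ext fun u => hz u)
  have hs : ∀ u v, fderiv ℝ (fderiv ℝ F) y u v = fderiv ℝ (fderiv ℝ F) y v u := fun u v =>
    (hF.isSymmSndFDerivAt (by simp)).eq u v
  have key : ∀ u v, fderiv ℝ η y u v = η' (F y) (fderiv ℝ (fderiv ℝ F) y u v) +
      fderiv ℝ η' (F y) (fderiv ℝ F y u) (fderiv ℝ F y v) := by
    intro u v
    rw [h2.fderiv]
    simp
  unfold flatExtDer
  rw [key u v, key v u, hs u v]
  ring

/-- The first derivatives of a pulled back field of bilinear forms. -/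
theorem fderiv_metric_pullback {g g' : E → E →L[ℝ] E →L[ℝ] ℝ} {F : E → E} {y : E}
    (hF : ContDiffAt ℝ 2 F y) (hg : DifferentiableAt ℝ g y) (hg' : DifferentiableAt ℝ g' (F y))
    (h : ∀ᶠ z in 𝓝 y, ∀ u v, g z u v = g' (F z) (fderiv ℝ F z u) (fderiv ℝ F z v)) (w u v : E) :
    fderiv ℝ g y w u v = fderiv ℝ g' (F y) (fderiv ℝ F y w) (fderiv ℝ F y u) (fderiv ℝ F y v)
      + g' (F y) (fderiv ℝ (fderiv ℝ F) y w u) (fderiv ℝ F y v)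
      + g' (F y) (fderiv ℝ F y u) (fderiv ℝ (fderiv ℝ F) y w v) := by
  have hF1 := (hF.differentiableAt (by simp)).hasFDerivAt
  have hF2 := ((hF.fderiv_right (m := 1) (by norm_num)).differentiableAt (by simp)).hasFDerivAt
  have h0 : HasFDerivAt (fun z => g' (F z)) ((fderiv ℝ g' (F y)).comp (fderiv ℝ F y)) y :=
    HasFDerivAt.comp (G := E →L[ℝ] E →L[ℝ] ℝ) y hg'.hasFDerivAt hF1
  have h1 := (h0.clm_apply
    (hF2.clm_apply (hasFDerivAt_const u y))).clm_apply (hF2.clm_apply (hasFDerivAt_const v y))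
  have h2 := (hg.hasFDerivAt.clm_apply (hasFDerivAt_const u y)).clm_apply (hasFDerivAt_const v y)
  have h3 := (h2.congr_of_eventuallyEq (h.mono fun z hz => (hz u v).symm)).unique h1
  have h4 := DFunLike.congr_fun h3 w
  simp at h4
  rw [h4]; ring

/-- Isometries preserve the geodesic equation; the acceleration of the image of a curve is
`D²F(v, v) + DF(a)`. -/
theorem GeodesicEq.map {g g' : E → E →L[ℝ] E →L[ℝ] ℝ} {F : E → E} {y : E}
    (hF : ContDiffAt ℝ 2 F y) (hg : DifferentiableAt ℝ g y) (hg' : DifferentiableAt ℝ g' (F y))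
    (h : ∀ᶠ z in 𝓝 y, ∀ u v, g z u v = g' (F z) (fderiv ℝ F z u) (fderiv ℝ F z v))
    (hsymm : ∀ u v, g' (F y) u v = g' (F y) v u)
    (hsurj : Function.Surjective (fderiv ℝ F y)) {v a : E} (hva : GeodesicEq g y v a) :
    GeodesicEq g' (F y) (fderiv ℝ F y v) (fderiv ℝ (fderiv ℝ F) y v v + fderiv ℝ F y a) := by
  intro w'
  obtain ⟨w, rfl⟩ := hsurj w'
  have hs : fderiv ℝ (fderiv ℝ F) y v w = fderiv ℝ (fderiv ℝ F) y w v :=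
    (hF.isSymmSndFDerivAt (by simp)).eq v w
  have h0 := hva w
  have e1 := fderiv_metric_pullback hF hg hg' h v v w
  have e2 := fderiv_metric_pullback hF hg hg' h w v v
  have e3 := h.self_of_nhds a w
  rw [e1, e2, e3, hs, hsymm (fderiv ℝ (fderiv ℝ F) y w v) (fderiv ℝ F y v)] at h0
  rw [map_add, add_apply]
  linarith

theorem KillingAt.sub {g : E → E →L[ℝ] E →L[ℝ] ℝ} {X Y : E → E} {y : E}
    (hX : DifferentiableAt ℝ X y) (hY : DifferentiableAt ℝ Y y) (h1 : KillingAt g X y)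
    (h2 : KillingAt g Y y) : KillingAt g (fun z => X z - Y z) y := by
  intro u v
  rw [fderiv_fun_sub hX hY]
  simp only [map_sub, sub_apply]
  linarith [h1 u v, h2 u v]

/-- The inner product of the velocity of a geodesic with a Killing field is constant. -/
theorem hasDerivAt_inner_killing {g : E → E →L[ℝ] E →L[ℝ] ℝ} {X : E → E} {c c' : ℝ → E} {a : E}
    {t : ℝ} (hg : DifferentiableAt ℝ g (c t)) (hX : DifferentiableAt ℝ X (c t))
    (hsymm : ∀ u v, g (c t) u v = g (c t) v u)
    (hc : HasDerivAt c (c' t) t) (hc' : HasDerivAt c' a t) (hgeo : GeodesicEq g (c t) (c' t) a)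
    (hK : KillingAt g X (c t)) : HasDerivAt (fun r => g (c r) (c' r) (X (c r))) 0 t := by
  have h1 : HasDerivAt (fun r => g (c r)) (fderiv ℝ g (c t) (c' t)) t :=
    HasFDerivAt.comp_hasDerivAt (E := E →L[ℝ] E →L[ℝ] ℝ) (f := c) t hg.hasFDerivAt hc
  have h2 : HasDerivAt (fun r => X (c r)) (fderiv ℝ X (c t) (c' t)) t :=
    HasFDerivAt.comp_hasDerivAt (f := c) t hX.hasFDerivAt hc
  have h3 := (h1.clm_apply hc').clm_apply h2
  refine h3.congr_deriv ?_
  have e1 := hgeo (X (c t))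
  have e2 := hK (c' t) (c' t)
  rw [hsymm (fderiv ℝ X (c t) (c' t))] at e2
  simp only [add_apply]
  linarith

end Calculus

/-! ### Rigidity of Killing fields -/

section Rigidity

variable {E : Type*} [NormedAddCommGroup E] [NormedSpace ℝ E]

/-- Grönwall's inequality along segments. -/
theorem eq_zero_of_norm_fderiv_le {F : Type*} [NormedAddCommGroup F] [NormedSpace ℝ F] {Z : E → F}
    {y₀ : E} {r C : ℝ} (hd : ∀ z ∈ ball y₀ r, DifferentiableAt ℝ Z z)
    (hb : ∀ z ∈ ball y₀ r, ‖fderiv ℝ Z z‖ ≤ C * ‖Z z‖) (h0 : Z y₀ = 0) :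
    ∀ z ∈ ball y₀ r, Z z = 0 := by
  intro z hz
  have hr : 0 < r := pos_of_mem_ball hz
  have hseg : ∀ t ∈ Icc (0 : ℝ) 1, y₀ + t • (z - y₀) ∈ ball y₀ r := fun t ht =>
    (convex_ball y₀ r).add_smul_sub_mem (mem_ball_self hr) hz ht
  have hder : ∀ t ∈ Icc (0 : ℝ) 1, HasDerivAt (fun t : ℝ => Z (y₀ + t • (z - y₀)))
      (fderiv ℝ Z (y₀ + t • (z - y₀)) (z - y₀)) t := by
    intro t ht
    have h1 : HasDerivAt (fun t : ℝ => y₀ + t • (z - y₀)) (z - y₀) t := by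
      simpa using ((hasDerivAt_id t).smul_const (z - y₀)).const_add y₀
    exact HasFDerivAt.comp_hasDerivAt (f := fun t : ℝ => y₀ + t • (z - y₀)) t
      (hd _ (hseg t ht)).hasFDerivAt h1
  have := eq_zero_of_abs_deriv_le_mul_abs_self_of_eq_zero_right (K := C * ‖z - y₀‖)
    (fun t ht => (hder t ht).continuousAt.continuousWithinAt)
    (fun t ht => (hder t (Ico_subset_Icc_self ht)).hasDerivWithinAt) (by simpa using h0)
    (fun t ht => by
      calc _ ≤ ‖fderiv ℝ Z (y₀ + t • (z - y₀))‖ * ‖z - y₀‖ := ContinuousLinearMap.le_opNorm _ _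
        _ ≤ (C * ‖Z (y₀ + t • (z - y₀))‖) * ‖z - y₀‖ := by
          gcongr; exact hb _ (hseg t (Ico_subset_Icc_self ht))
        _ = _ := by ring) 1 (by simp)
  simpa using this

/-- Differentiating the Killing equation and permuting the arguments expresses all second
derivatives of a Killing field by its values and first derivatives. -/
theorem KillingAt.inner_snd_fderiv {g : E → E →L[ℝ] E →L[ℝ] ℝ} {X : E → E} {y : E}
    (hg : ContDiffAt ℝ 2 g y) (hX : ContDiffAt ℝ 2 X y) (hsymm : ∀ u v, g y u v = g y v u)
    (hK : ∀ᶠ z in 𝓝 y, KillingAt g X z) (w u v : E) :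
    let R : E → E → E → ℝ := fun w u v =>
      fderiv ℝ (fderiv ℝ g) y w (X y) u v + fderiv ℝ g y (fderiv ℝ X y w) u v
        + fderiv ℝ g y w (fderiv ℝ X y u) v + fderiv ℝ g y w u (fderiv ℝ X y v)
    g y (fderiv ℝ (fderiv ℝ X) y w u) v = -(1 / 2 : ℝ) * (R w u v + R u v w - R v w u) := by
  intro R
  have hg1 := (hg.differentiableAt (by simp)).hasFDerivAt
  have hX1 := (hX.differentiableAt (by simp)).hasFDerivAt
  have hg2 := ((hg.fderiv_right (m := 1) (by norm_num)).differentiableAt (by simp)).hasFDerivAt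
  have hX2 := ((hX.fderiv_right (m := 1) (by norm_num)).differentiableAt (by simp)).hasFDerivAt
  -- the Killing equation differentiated in the direction `w`
  have key : ∀ w u v, R w u v + g y (fderiv ℝ (fderiv ℝ X) y w u) v
      + g y (fderiv ℝ (fderiv ℝ X) y w v) u = 0 := by
    intro w u v
    have cu := hasFDerivAt_const (𝕜 := ℝ) u y
    have cv := hasFDerivAt_const (𝕜 := ℝ) v y
    have h1 := ((hg2.clm_apply hX1).clm_apply cu).clm_apply cv
    have h2 := (hg1.clm_apply (hX2.clm_apply cu)).clm_apply cv
    have h3 := (hg1.clm_apply cu).clm_apply (hX2.clm_apply cv)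
    have h := hasFDerivAt_eq_zero_of_eventually_const ((h1.add h2).add h3)
      (hK.mono fun z hz => hz u v)
    have h' := DFunLike.congr_fun h w
    simp at h'
    rw [hsymm (fderiv ℝ (fderiv ℝ X) y w v) u]
    simp only [R]
    linarith
  have hs : ∀ u v, fderiv ℝ (fderiv ℝ X) y u v = fderiv ℝ (fderiv ℝ X) y v u := fun u v =>
    (hX.isSymmSndFDerivAt (by simp)).eq u v
  have k1 := key w u v
  have k2 := key u v w
  have k3 := key v w u
  rw [hs u w] at k2
  rw [hs v u, hs v w] at k3
  linarith

theorem exists_equiv_of_injective [FiniteDimensional ℝ E] {A : E →L[ℝ] E →L[ℝ] ℝ}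
    (hA : ∀ u, A u = 0 → u = 0) : ∃ e : E ≃L[ℝ] (E →L[ℝ] ℝ), (e : E →L[ℝ] E →L[ℝ] ℝ) = A := by
  have hinj : Function.Injective A := (injective_iff_map_eq_zero A).2 hA
  have hfin : Module.finrank ℝ E = Module.finrank ℝ (E →L[ℝ] ℝ) := by
    rw [← (LinearMap.toContinuousLinearMap (E := E) (F' := ℝ) (𝕜 := ℝ)).finrank_eq]
    exact Subspace.dual_finrank_eq.symm
  exact ⟨(LinearEquiv.ofInjectiveOfFinrankEq A.toLinearMap hinj hfin).toContinuousLinearEquiv, by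
    ext; rfl⟩

/-- The second derivatives of a Killing field are bounded by a multiple of its first-order jet. -/
theorem KillingAt.norm_snd_fderiv_le {g : E → E →L[ℝ] E →L[ℝ] ℝ} {X : E → E} {z : E}
    (hg : ContDiffAt ℝ 2 g z) (hX : ContDiffAt ℝ 2 X z) (hsymm : ∀ u v, g z u v = g z v u)
    (hK : ∀ᶠ x in 𝓝 z, KillingAt g X x) {B0 B1 B2 N : ℝ}
    (hinv : (g z).IsInvertible) (c0 : ‖(g z).inverse‖ ≤ B0) (c1 : ‖fderiv ℝ g z‖ ≤ B1)
    (c2 : ‖fderiv ℝ (fderiv ℝ g) z‖ ≤ B2) (hXn : ‖X z‖ ≤ N) (hDn : ‖fderiv ℝ X z‖ ≤ N) :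
    ‖fderiv ℝ (fderiv ℝ X) z‖ ≤ B0 * (3 / 2 * (B2 + 3 * B1)) * N := by
  have hB0 : 0 ≤ B0 := (norm_nonneg _).trans c0
  have hB1 : 0 ≤ B1 := (norm_nonneg _).trans c1
  have hB2 : 0 ≤ B2 := (norm_nonneg (fderiv ℝ (fderiv ℝ g) z)).trans c2
  have hN : 0 ≤ N := (norm_nonneg _).trans hXn
  have hDu : ∀ u, ‖fderiv ℝ X z u‖ ≤ N * ‖u‖ := fun u =>
    (ContinuousLinearMap.le_opNorm _ _).trans (by gcongr)
  have hg1 : ∀ a b c, |fderiv ℝ g z a b c| ≤ B1 * ‖a‖ * ‖b‖ * ‖c‖ := fun a b c => by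
    rw [← Real.norm_eq_abs]
    calc ‖fderiv ℝ g z a b c‖ ≤ ‖fderiv ℝ g z a‖ * ‖b‖ * ‖c‖ :=
          ContinuousLinearMap.le_opNorm₂ _ _ _
      _ ≤ (‖fderiv ℝ g z‖ * ‖a‖) * ‖b‖ * ‖c‖ := by
          gcongr; exact ContinuousLinearMap.le_opNorm _ _
      _ ≤ _ := by gcongr
  have hg2 : ∀ a b c d, |fderiv ℝ (fderiv ℝ g) z a b c d| ≤ B2 * ‖a‖ * ‖b‖ * ‖c‖ * ‖d‖ :=
    fun a b c d => by
    rw [← Real.norm_eq_abs]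
    calc ‖fderiv ℝ (fderiv ℝ g) z a b c d‖ ≤ ‖fderiv ℝ (fderiv ℝ g) z a b‖ * ‖c‖ * ‖d‖ :=
          ContinuousLinearMap.le_opNorm₂ _ _ _
      _ ≤ (‖fderiv ℝ (fderiv ℝ g) z‖ * ‖a‖ * ‖b‖) * ‖c‖ * ‖d‖ := by
          gcongr; exact ContinuousLinearMap.le_opNorm₂ _ _ _
      _ ≤ _ := by gcongr
  let R : E → E → E → ℝ := fun w u v =>
    fderiv ℝ (fderiv ℝ g) z w (X z) u v + fderiv ℝ g z (fderiv ℝ X z w) u v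
      + fderiv ℝ g z w (fderiv ℝ X z u) v + fderiv ℝ g z w u (fderiv ℝ X z v)
  have hR : ∀ w u v, |R w u v| ≤ (B2 + 3 * B1) * N * (‖w‖ * ‖u‖ * ‖v‖) := by
    intro w u v
    have e1 : |fderiv ℝ (fderiv ℝ g) z w (X z) u v| ≤ B2 * ‖w‖ * N * ‖u‖ * ‖v‖ :=
      (hg2 _ _ _ _).trans (by gcongr)
    have e2 : |fderiv ℝ g z (fderiv ℝ X z w) u v| ≤ B1 * (N * ‖w‖) * ‖u‖ * ‖v‖ :=
      (hg1 _ _ _).trans (by gcongr; exact hDu w)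
    have e3 : |fderiv ℝ g z w (fderiv ℝ X z u) v| ≤ B1 * ‖w‖ * (N * ‖u‖) * ‖v‖ :=
      (hg1 _ _ _).trans (by gcongr; exact hDu u)
    have e4 : |fderiv ℝ g z w u (fderiv ℝ X z v)| ≤ B1 * ‖w‖ * ‖u‖ * (N * ‖v‖) :=
      (hg1 _ _ _).trans (by gcongr; exact hDu v)
    calc |R w u v| ≤ _ := (abs_add_le _ _).trans (add_le_add ((abs_add_le _ _).trans
          (add_le_add ((abs_add_le _ _).trans (add_le_add e1 e2)) e3)) e4)
      _ = _ := by ring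
  refine ContinuousLinearMap.opNorm_le_bound₂ _ (by positivity) fun w u => ?_
  have hgx : ‖g z (fderiv ℝ (fderiv ℝ X) z w u)‖ ≤
      3 / 2 * ((B2 + 3 * B1) * N) * (‖w‖ * ‖u‖) := by
    refine ContinuousLinearMap.opNorm_le_bound _ (by positivity) fun v => ?_
    have hz2 : g z (fderiv ℝ (fderiv ℝ X) z w u) v =
        -(1 / 2 : ℝ) * (R w u v + R u v w - R v w u) :=
      KillingAt.inner_snd_fderiv hg hX hsymm hK w u v
    rw [hz2, Real.norm_eq_abs, abs_mul]
    have a1 := hR w u v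
    have a2 := hR u v w
    have a3 := hR v w u
    have h3 : |R w u v + R u v w - R v w u| ≤ |R w u v| + |R u v w| + |R v w u| :=
      (abs_sub _ _).trans (add_le_add (abs_add_le _ _) le_rfl)
    have h12 : |(-(1 / 2) : ℝ)| = 1 / 2 := by norm_num
    rw [h12]
    have h4 := mul_le_mul_of_nonneg_left (h3.trans (add_le_add (add_le_add a1 a2) a3))
      (show (0 : ℝ) ≤ 1 / 2 by norm_num)
    exact h4.trans (le_of_eq (by ring))
  have hx : fderiv ℝ (fderiv ℝ X) z w u =
      (g z).inverse (g z (fderiv ℝ (fderiv ℝ X) z w u)) := by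
    obtain ⟨e', he'⟩ := hinv
    rw [← he', ContinuousLinearMap.inverse_equiv]; simp
  rw [hx]
  calc _ ≤ B0 * (3 / 2 * ((B2 + 3 * B1) * N) * (‖w‖ * ‖u‖)) :=
      (ContinuousLinearMap.le_opNorm _ _).trans (by gcongr)
    _ = _ := by ring

/-- A Killing field whose value and first derivatives vanish at a point vanishes near it. -/
theorem eventually_eq_zero_of_killing [FiniteDimensional ℝ E] {g : E → E →L[ℝ] E →L[ℝ] ℝ}
    {X : E → E} {y₀ : E} (hg : ∀ᶠ z in 𝓝 y₀, ContDiffAt ℝ 2 g z)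
    (hX : ∀ᶠ z in 𝓝 y₀, ContDiffAt ℝ 2 X z)
    (hsymm : ∀ᶠ z in 𝓝 y₀, ∀ u v, g z u v = g z v u) (hnd : ∀ u, g y₀ u = 0 → u = 0)
    (hK : ∀ᶠ z in 𝓝 y₀, KillingAt g X z) (h0 : X y₀ = 0) (h1 : fderiv ℝ X y₀ = 0) :
    ∀ᶠ z in 𝓝 y₀, X z = 0 := by
  obtain ⟨e, he⟩ := exists_equiv_of_injective hnd
  have hgc : ContDiffAt ℝ 2 g y₀ := hg.self_of_nhds
  have b0 : ∀ᶠ z in 𝓝 y₀, ‖(g z).inverse‖ < ‖(g y₀).inverse‖ + 1 := by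
    have hi := contDiffAt_map_inverse (𝕜 := ℝ) (n := 0) e
    rw [he] at hi
    have : ContinuousAt (fun z => ‖(g z).inverse‖) y₀ :=
      ContinuousAt.comp (g := fun A : E →L[ℝ] E →L[ℝ] ℝ => ‖A.inverse‖) (f := g)
        hi.continuousAt.norm hgc.continuousAt
    exact this.eventually_lt_const (by linarith)
  have binv : ∀ᶠ z in 𝓝 y₀, (g z).IsInvertible :=
    hgc.continuousAt.eventually_mem ((ContinuousLinearEquiv.isOpen (𝕜 := ℝ) (E := E)
      (F := E →L[ℝ] ℝ)).mem_nhds ⟨e, he⟩)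
  have hg1 : ContDiffAt ℝ 1 (fderiv ℝ g) y₀ := hgc.fderiv_right (m := 1) (by norm_num)
  have hg2 : ContDiffAt ℝ 0 (fderiv ℝ (fderiv ℝ g)) y₀ := hg1.fderiv_right (m := 0) (by norm_num)
  have b1 : ∀ᶠ z in 𝓝 y₀, ‖fderiv ℝ g z‖ < ‖fderiv ℝ g y₀‖ + 1 :=
    hg1.continuousAt.norm.eventually_lt_const (by linarith)
  have b2 : ∀ᶠ z in 𝓝 y₀, ‖fderiv ℝ (fderiv ℝ g) z‖ < ‖fderiv ℝ (fderiv ℝ g) y₀‖ + 1 :=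
    (ContinuousAt.norm (E := E →L[ℝ] E →L[ℝ] E →L[ℝ] E →L[ℝ] ℝ)
      hg2.continuousAt).eventually_lt_const (by linarith)
  obtain ⟨r, hr, hall⟩ := Metric.eventually_nhds_iff_ball.1 ((hg.and (hX.and hsymm)).and
    (b0.and (binv.and (b1.and (b2.and hK.eventually_nhds)))))
  set C := (‖(g y₀).inverse‖ + 1) *
    (3 / 2 * ((‖fderiv ℝ (fderiv ℝ g) y₀‖ + 1) + 3 * (‖fderiv ℝ g y₀‖ + 1)))
  -- the first-order jet of `X` satisfies a differential inequality
  let Z : E → E × (E →L[ℝ] E) := fun z => (X z, fderiv ℝ X z)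
  have hZ : ∀ z ∈ ball y₀ r, HasFDerivAt Z ((fderiv ℝ X z).prod (fderiv ℝ (fderiv ℝ X) z)) z :=
    fun z hz => by
      have hXz := (hall z hz).1.2.1
      exact (hXz.differentiableAt (by simp)).hasFDerivAt.prodMk
        ((hXz.fderiv_right (m := 1) (by norm_num)).differentiableAt (by simp)).hasFDerivAt
  have hfin := eq_zero_of_norm_fderiv_le (Z := Z) (y₀ := y₀) (r := r) (C := max 1 C)
    (fun z hz => (hZ z hz).differentiableAt) (fun z hz => by
      obtain ⟨⟨d1, d2, d3⟩, c0, hinv, c1, c2, hKz⟩ := hall z hz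
      have hbound : ‖fderiv ℝ (fderiv ℝ X) z‖ ≤ C * ‖Z z‖ :=
        KillingAt.norm_snd_fderiv_le d1 d2 d3 hKz hinv c0.le c1.le c2.le
          (norm_fst_le (Z z)) (norm_snd_le (Z z))
      rw [(hZ z hz).fderiv]
      refine ContinuousLinearMap.opNorm_le_bound _ (by positivity) fun u => ?_
      rw [ContinuousLinearMap.prod_apply, Prod.norm_def]
      have hle1 : (1 : ℝ) ≤ max 1 C := le_max_left _ _
      have hleC : C ≤ max 1 C := le_max_right _ _
      refine max_le ?_ ?_
      · refine (ContinuousLinearMap.le_opNorm _ _).trans ?_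
        gcongr
        calc ‖fderiv ℝ X z‖ ≤ 1 * ‖Z z‖ := by rw [one_mul]; exact norm_snd_le (Z z)
          _ ≤ _ := by gcongr
      · refine (ContinuousLinearMap.le_opNorm _ _).trans ?_
        gcongr
        exact hbound.trans (by gcongr)) (by simp [Z, h0, h1])
  filter_upwards [ball_mem_nhds y₀ hr] with z hz
  exact congrArg Prod.fst (hfin z hz)

end Rigidity

/-! ### Geodesics in a coordinate domain -/

section Spray

variable {E : Type*} [NormedAddCommGroup E] [NormedSpace ℝ E]

/-- The geodesic acceleration of a field `g` of nondegenerate bilinear forms at a point `y` for the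
velocity `v`. -/
def spray (g : E → E →L[ℝ] E →L[ℝ] ℝ) (y v : E) : E :=
  -(g y).inverse (fderiv ℝ g y v v - (1 / 2 : ℝ) • ((fderiv ℝ g y).flip v).flip v)

theorem geodesicEq_iff {g : E → E →L[ℝ] E →L[ℝ] ℝ} {y v a : E} (hg : (g y).IsInvertible) :
    GeodesicEq g y v a ↔ a = spray g y v := by
  obtain ⟨e, he⟩ := hg
  have h1 : GeodesicEq g y v a ↔
      g y a = -(fderiv ℝ g y v v - (1 / 2 : ℝ) • ((fderiv ℝ g y).flip v).flip v) := by
    refine ⟨fun h => ContinuousLinearMap.ext fun w => ?_, fun h w => ?_⟩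
    · have := h w
      simp
      linarith
    · rw [h]
      simp
  rw [h1, spray, ← map_neg, ← he, ContinuousLinearMap.inverse_equiv]
  exact ⟨fun h => by rw [← h]; simp, fun h => by rw [h]; simp⟩

theorem spray_smul (g : E → E →L[ℝ] E →L[ℝ] ℝ) (y v : E) (s : ℝ) :
    spray g y (s • v) = (s * s) • spray g y v := by
  have : fderiv ℝ g y (s • v) (s • v) -
      (1 / 2 : ℝ) • ((fderiv ℝ g y).flip (s • v)).flip (s • v) =
      (s * s) • (fderiv ℝ g y v v - (1 / 2 : ℝ) • ((fderiv ℝ g y).flip v).flip v) := by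
    ext w
    simp
    ring
  rw [spray, this, map_smul, spray, smul_neg]

theorem contDiffOn_spray [FiniteDimensional ℝ E] {g : E → E →L[ℝ] E →L[ℝ] ℝ} {Ω : Set E}
    (hΩ : IsOpen Ω) (hg : ContDiffOn ℝ ∞ g Ω) (hinv : ∀ y ∈ Ω, (g y).IsInvertible) :
    ContDiffOn ℝ ∞ (fun p : E × E => spray g p.1 p.2) (Ω ×ˢ univ) := by
  have : CompleteSpace E := FiniteDimensional.complete ℝ E
  have h1 : ContDiffOn ℝ ∞ (fun p : E × E => (g p.1).inverse) (Ω ×ˢ univ) := by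
    rintro ⟨y, v⟩ ⟨hy, -⟩
    exact ContDiffAt.comp_contDiffWithinAt (y, v) (hinv y hy).contDiffAt_map_inverse
      ((hg.comp contDiffOn_fst (fun p (hp : p ∈ Ω ×ˢ (univ : Set E)) => hp.1)) (y, v)
        ⟨hy, mem_univ v⟩)
  have h2 : ContDiffOn ℝ ∞ (fun p : E × E => fderiv ℝ g p.1) (Ω ×ˢ univ) :=
    (hg.fderiv_of_isOpen (m := ∞) hΩ (by simp)).comp contDiffOn_fst (fun p hp => hp.1)
  have h3 : ContDiffOn ℝ ∞ (fun p : E × E => fderiv ℝ g p.1 p.2 p.2 -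
      (1 / 2 : ℝ) • ((fderiv ℝ g p.1).flip p.2).flip p.2) (Ω ×ˢ univ) := by
    refine contDiffOn_clm_apply.2 fun w => ?_
    change ContDiffOn ℝ ∞ (fun p : E × E => fderiv ℝ g p.1 p.2 p.2 w -
      (1 / 2 : ℝ) • (fderiv ℝ g p.1 w p.2 p.2)) (Ω ×ˢ univ)
    have a1 := ((h2.clm_apply contDiffOn_snd).clm_apply contDiffOn_snd).clm_apply
      (contDiffOn_const (c := w))
    have a2 := ((h2.clm_apply (contDiffOn_const (c := w))).clm_apply contDiffOn_snd).clm_apply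
      contDiffOn_snd
    exact a1.sub (a2.const_smul _)
  exact (h1.clm_apply h3).neg

/-- The geodesics issuing from a point `x₀` with small initial velocities `u` exist for a uniform
time, depend smoothly on `u` and on time, and satisfy `γ_u(t) = x₀ + t u + o(u)`. -/
theorem exists_exponential [FiniteDimensional ℝ E] {g : E → E →L[ℝ] E →L[ℝ] ℝ} {Ω : Set E}
    (hΩ : IsOpen Ω) (hg : ContDiffOn ℝ ∞ g Ω) (hinv : ∀ y ∈ Ω, (g y).IsInvertible) {x₀ : E}
    (hx₀ : x₀ ∈ Ω) : ∃ ε > 0, ∃ γ γ' : E → ℝ → E,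
      ContDiffOn ℝ ∞ (fun q : E × ℝ => γ q.1 q.2) (ball 0 ε ×ˢ Ioo (-ε) ε) ∧
      (∀ t ∈ Ioo (-ε) ε, HasFDerivAt (fun u => γ u t) (t • ContinuousLinearMap.id ℝ E) 0) ∧
      ∀ u ∈ ball 0 ε, γ u 0 = x₀ ∧ γ' u 0 = u ∧ ∀ t ∈ Ioo (-ε) ε, γ u t ∈ Ω ∧
        HasDerivAt (γ u) (γ' u t) t ∧ HasDerivAt (γ' u) (spray g (γ u t) (γ' u t)) t := by
  let f : E × E → E × E := fun p => (p.2, spray g p.1 p.2)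
  have hf : ContDiffOn ℝ ∞ f (Ω ×ˢ univ) :=
    contDiff_snd.contDiffOn.prodMk (contDiffOn_spray hΩ hg hinv)
  have hΩ' : IsOpen (Ω ×ˢ (univ : Set E)) := hΩ.prod isOpen_univ
  obtain ⟨ε, hε, ψ, hψ, hflow⟩ :=
    exists_smooth_local_flow hΩ' hf (x₀ := (x₀, 0)) ⟨hx₀, mem_univ _⟩
  have hmem : ∀ u ∈ ball (0 : E) ε, (x₀, u) ∈ ball (x₀, (0 : E)) ε := fun u hu => by
    rw [mem_ball, Prod.dist_eq]
    exact max_lt (by simpa using hε) hu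
  have hsol : ∀ u ∈ ball (0 : E) ε, ∀ t ∈ Ioo (-ε) ε, (ψ ((x₀, u), t)).1 ∈ Ω ∧
      HasDerivAt (fun t => (ψ ((x₀, u), t)).1) (ψ ((x₀, u), t)).2 t ∧
      HasDerivAt (fun t => (ψ ((x₀, u), t)).2)
        (spray g (ψ ((x₀, u), t)).1 (ψ ((x₀, u), t)).2) t := by
    intro u hu t ht
    obtain ⟨h1, h2⟩ := (hflow _ (hmem u hu)).2 t ht
    exact ⟨h1.1, h2.fst, h2.snd⟩
  have hsmooth : ContDiffOn ℝ ∞ (fun q : E × ℝ => (ψ ((x₀, q.1), q.2)).1)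
      (ball 0 ε ×ˢ Ioo (-ε) ε) := by
    refine contDiff_fst.comp_contDiffOn (hψ.comp (ContDiff.contDiffOn ?_) ?_)
    · exact (contDiff_const.prodMk contDiff_fst).prodMk contDiff_snd
    · rintro ⟨u, t⟩ ⟨hu, ht⟩
      exact ⟨hmem u hu, ht⟩
  refine ⟨ε, hε, fun u t => (ψ ((x₀, u), t)).1, fun u t => (ψ ((x₀, u), t)).2, hsmooth, ?_, ?_⟩
  · intro t ht
    have hε0 : (0 : E) ∈ ball (0 : E) ε := mem_ball_self hε
    have h0 : (0 : ℝ) ∈ Ioo (-ε) ε := ⟨by linarith, hε⟩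
    -- rescaling the velocity amounts to rescaling time
    have hhom : ∀ u ∈ ball (0 : E) ε, ∀ s ∈ Icc (-1 : ℝ) 1, ∀ t ∈ Ioo (-ε) ε,
        (ψ ((x₀, s • u), t)).1 = (ψ ((x₀, u), s * t)).1 := by
      intro u hu s hs t ht
      have hs' : |s| ≤ 1 := abs_le.2 hs
      have hsu : s • u ∈ ball (0 : E) ε := by
        rw [mem_ball_zero_iff] at hu ⊢
        rw [norm_smul, Real.norm_eq_abs]
        exact (mul_le_of_le_one_left (norm_nonneg _) hs').trans_lt hu
      have hst : ∀ t ∈ Ioo (-ε) ε, s * t ∈ Ioo (-ε) ε := fun t ht => by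
        rw [mem_Ioo, ← abs_lt] at ht ⊢
        rw [abs_mul]
        exact (mul_le_of_le_one_left (abs_nonneg _) hs').trans_lt ht
      have := eqOn_Ioo_of_hasDerivAt hΩ' (hf.of_le (by simp)) (a := -ε) (b := ε)
        (z := fun t => ψ ((x₀, s • u), t))
        (w := fun t => ((ψ ((x₀, u), s * t)).1, s • (ψ ((x₀, u), s * t)).2))
        (fun t ht => (hflow _ (hmem _ hsu)).2 t ht) (fun t ht => ?_) h0 ?_ t ht
      · rw [this]
      · obtain ⟨h1, h2, h3⟩ := hsol u hu _ (hst t ht)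
        refine ⟨⟨h1, mem_univ _⟩, ?_⟩
        have hm : HasDerivAt (fun t => s * t) s t := by simpa using (hasDerivAt_id t).const_mul s
        have h2' := HasDerivAt.scomp (h := fun t => s * t) t h2 hm
        have h3' := (HasDerivAt.scomp (h := fun t => s * t) t h3 hm).const_smul s
        refine (h2'.prodMk h3').congr_deriv ?_
        simp only [f, spray_smul, smul_smul]
      · simp only [mul_zero]
        rw [(hflow _ (hmem _ hsu)).1, (hflow _ (hmem _ hu)).1]
    have hd : DifferentiableAt ℝ (fun u => (ψ ((x₀, u), t)).1) 0 := by
      have h1 : ContDiffAt ℝ ∞ (fun q : E × ℝ => (ψ ((x₀, q.1), q.2)).1) (0, t) :=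
        hsmooth.contDiffAt ((isOpen_ball.prod isOpen_Ioo).mem_nhds ⟨hε0, ht⟩)
      have h2 : ContDiffAt ℝ ∞ (fun u => (ψ ((x₀, u), t)).1) 0 :=
        ContDiffAt.comp (g := fun q : E × ℝ => (ψ ((x₀, q.1), q.2)).1) (f := fun u : E => (u, t)) 0
          h1 (contDiffAt_id.prodMk contDiffAt_const)
      exact h2.differentiableAt (by simp)
    have hsmall : ∀ u ∈ ball (0 : E) ε, fderiv ℝ (fun u => (ψ ((x₀, u), t)).1) 0 u = t • u := by
      intro u hu
      have h1 : HasDerivAt (fun s : ℝ => s • u) u 0 := by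
        simpa using (hasDerivAt_id (0 : ℝ)).smul_const u
      have h2 : HasDerivAt (fun s : ℝ => (ψ ((x₀, s • u), t)).1)
          (fderiv ℝ (fun u => (ψ ((x₀, u), t)).1) 0 u) 0 :=
        HasFDerivAt.comp_hasDerivAt_of_eq (f := fun s : ℝ => s • u) 0 hd.hasFDerivAt h1 (by simp)
      have h3 : HasDerivAt (fun s : ℝ => s * t) t 0 := by
        simpa using (hasDerivAt_id (0 : ℝ)).mul_const t
      have h4 := HasDerivAt.scomp_of_eq (h := fun s : ℝ => s * t) (y := 0) 0
        (hsol u hu 0 h0).2.1 h3 (by simp)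
      rw [(hflow _ (hmem _ hu)).1] at h4
      refine h2.unique (h4.congr_of_eventuallyEq ?_)
      filter_upwards [Icc_mem_nhds (show (-1 : ℝ) < 0 by norm_num) (show (0 : ℝ) < 1 by norm_num)]
        with s hs using hhom u hu s hs t ht
    refine hd.hasFDerivAt.congr_fderiv (ContinuousLinearMap.ext fun u => ?_)
    obtain ⟨k, hk, hku⟩ : ∃ k : ℝ, k ≠ 0 ∧ k • u ∈ ball (0 : E) ε := by
      refine ⟨ε / (‖u‖ + 1), by positivity, ?_⟩
      rw [mem_ball_zero_iff, norm_smul, Real.norm_eq_abs, abs_of_pos (by positivity),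
        div_mul_eq_mul_div, div_lt_iff₀ (by positivity)]
      nlinarith
    have := hsmall _ hku
    rw [map_smul, smul_comm t k u] at this
    exact smul_right_injective E hk this
  · intro u hu
    refine ⟨?_, ?_, hsol u hu⟩
    · change (ψ ((x₀, u), 0)).1 = x₀
      rw [(hflow _ (hmem _ hu)).1]
    · change (ψ ((x₀, u), 0)).2 = u
      rw [(hflow _ (hmem _ hu)).1]

/-- Coordinates adapted to a vector field `ξ` transverse to a hyperplane `ker α`: every point `z`
near `x₀` is reached by following a geodesic issuing from `x₀` tangentially to `ker α` for a fixed
time, and then an integral curve of `ξ` for a time `τ z`, which is differentiable in `z`. -/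
theorem exists_transverse_coordinates [FiniteDimensional ℝ E] {g : E → E →L[ℝ] E →L[ℝ] ℝ}
    {ξ : E → E} {Ω : Set E} (hΩ : IsOpen Ω) (hg : ContDiffOn ℝ ∞ g Ω)
    (hinv : ∀ y ∈ Ω, (g y).IsInvertible) (hξ : ContDiffOn ℝ ∞ ξ Ω) {x₀ : E} (hx₀ : x₀ ∈ Ω)
    {α : E →L[ℝ] ℝ} (hα : α (ξ x₀) = 1) :
    ∃ ε > 0, ∃ τ : E → ℝ, HasFDerivAt τ α x₀ ∧ ∀ᶠ z in 𝓝 x₀, ∃ c v ρ : ℝ → E,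
      c 0 = x₀ ∧ α (v 0) = 0 ∧ ContDiffOn ℝ ∞ c (Ioo (-ε) ε) ∧
      (∀ t ∈ Ioo (-ε) ε, c t ∈ Ω ∧ HasDerivAt c (v t) t ∧ HasDerivAt v (spray g (c t) (v t)) t) ∧
      ρ 0 = c (ε / 2) ∧ τ z ∈ Ioo (-ε) ε ∧ ρ (τ z) = z ∧
      ∀ t ∈ Ioo (-ε) ε, ρ t ∈ Ω ∧ HasDerivAt ρ (ξ (ρ t)) t := by
  have : CompleteSpace E := FiniteDimensional.complete ℝ E
  obtain ⟨ε₁, hε₁, γ, γ', hγ, hγd, hγs⟩ := exists_exponential hΩ hg hinv hx₀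
  obtain ⟨ε₂, hε₂, ψ, hψ, hflow⟩ := exists_smooth_local_flow hΩ hξ hx₀
  set ε := min ε₁ ε₂ with hεdef
  have hε : 0 < ε := lt_min hε₁ hε₂
  have hle1 : Ioo (-ε) ε ⊆ Ioo (-ε₁) ε₁ :=
    Ioo_subset_Ioo (neg_le_neg (min_le_left _ _)) (min_le_left _ _)
  have hle2 : Ioo (-ε) ε ⊆ Ioo (-ε₂) ε₂ :=
    Ioo_subset_Ioo (neg_le_neg (min_le_right _ _)) (min_le_right _ _)
  set s := ε / 2 with hs
  have hspos : 0 < s := by positivity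
  have hsmem : s ∈ Ioo (-ε) ε := ⟨by linarith, by linarith⟩
  -- the horizontal initial velocity that reaches `P w = w - α(w) ξ` at time `s`
  let P : E →L[ℝ] E := s⁻¹ • (ContinuousLinearMap.id ℝ E - α.smulRight (ξ x₀))
  have hP : ∀ w, P w = s⁻¹ • (w - α w • ξ x₀) := fun w => rfl
  have hαP : ∀ w, α (P w) = 0 := fun w => by simp [hP, hα]
  -- `Θ` has the identity as its derivative at the origin; the coordinates are those of its inverse
  let Θ : E → E := fun w => ψ (γ (P w) s, α w)
  have hγ0 : γ 0 s = x₀ := by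
    -- the constant curve is the geodesic with velocity zero
    have := eqOn_Ioo_of_hasDerivAt (hΩ.prod isOpen_univ)
      (contDiff_snd.contDiffOn.prodMk (contDiffOn_spray hΩ hg hinv) |>.of_le (by simp))
      (a := -ε₁) (b := ε₁) (z := fun t => (γ 0 t, γ' 0 t)) (w := fun _ => (x₀, (0 : E)))
      (fun t ht => by
        obtain ⟨h1, h2, h3⟩ := (hγs 0 (mem_ball_self hε₁)).2.2 t ht
        exact ⟨⟨h1, mem_univ _⟩, h2.prodMk h3⟩)
      (fun t _ => ⟨⟨hx₀, mem_univ _⟩, by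
        have h0 : spray g x₀ 0 = 0 := by simpa using spray_smul g x₀ 0 0
        exact (hasDerivAt_const t (x₀, (0 : E))).congr_deriv (by simp only [h0]; rfl)⟩)
      (t₀ := 0) ⟨by linarith, hε₁⟩ (by
        obtain ⟨h1, h2, -⟩ := hγs 0 (mem_ball_self hε₁)
        simp [h1, h2]) s (hle1 hsmem)
    exact congrArg Prod.fst this
  have hΘ0 : Θ 0 = x₀ := by
    simp only [Θ, map_zero, hγ0]
    exact (hflow x₀ (mem_ball_self hε₂)).1
  have hψat : ContDiffAt ℝ ∞ ψ (x₀, 0) :=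
    hψ.contDiffAt ((isOpen_ball.prod isOpen_Ioo).mem_nhds ⟨mem_ball_self hε₂, by simp [hε₂]⟩)
  have hγat : ContDiffAt ℝ ∞ (fun u => γ u s) 0 :=
    ContDiffAt.comp (g := fun q : E × ℝ => γ q.1 q.2) (f := fun u : E => (u, s)) 0
      (hγ.contDiffAt ((isOpen_ball.prod isOpen_Ioo).mem_nhds ⟨mem_ball_self hε₁, hle1 hsmem⟩))
      (contDiffAt_id.prodMk contDiffAt_const)
  have hγP : ContDiffAt ℝ ∞ (fun w => γ (P w) s) 0 :=
    ContDiffAt.comp (g := fun u => γ u s) (f := P) 0 (by rw [map_zero]; exact hγat)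
      P.contDiff.contDiffAt
  have hΘ : ContDiffAt ℝ ∞ Θ 0 :=
    ContDiffAt.comp (g := ψ) (f := fun w => (γ (P w) s, α w)) 0
      (by simpa [hγ0] using hψat) (hγP.prodMk α.contDiff.contDiffAt)
  have hΘd : HasFDerivAt Θ ((ContinuousLinearEquiv.refl ℝ E : E ≃L[ℝ] E) : E →L[ℝ] E) 0 := by
    have h1 : HasFDerivAt (fun w => γ (P w) s) ((s • ContinuousLinearMap.id ℝ E).comp P) 0 :=
      HasFDerivAt.comp (g := fun u => γ u s) (f := P) 0 (by
        rw [map_zero]; exact hγd s (hle1 hsmem)) P.hasFDerivAt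
    have h2 := (hψat.differentiableAt (by simp)).hasFDerivAt
    have h3 : HasFDerivAt Θ _ 0 :=
      HasFDerivAt.comp (g := ψ) (f := fun w => (γ (P w) s, α w)) 0 (by simpa [hγ0] using h2)
        (h1.prodMk α.hasFDerivAt)
    refine h3.congr_fderiv (ContinuousLinearMap.ext fun w => ?_)
    -- the derivative of the flow at time zero
    have h4 : ∀ u, fderiv ℝ ψ (x₀, 0) (u, 0) = u := by
      intro u
      have a1 : HasFDerivAt (fun x : E => ψ (x, 0)) ((fderiv ℝ ψ (x₀, 0)).comp
          ((ContinuousLinearMap.id ℝ E).prod 0)) x₀ :=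
        HasFDerivAt.comp (g := ψ) (f := fun x : E => (x, (0 : ℝ))) x₀ h2
          ((hasFDerivAt_id x₀).prodMk (hasFDerivAt_const 0 x₀))
      have a2 : HasFDerivAt (fun x : E => ψ (x, 0)) (ContinuousLinearMap.id ℝ E) x₀ :=
        (hasFDerivAt_id x₀).congr_of_eventuallyEq (by
          filter_upwards [ball_mem_nhds x₀ hε₂] with x hx using (hflow x hx).1)
      exact DFunLike.congr_fun (a1.unique a2) u
    have h5 : fderiv ℝ ψ (x₀, 0) (0, 1) = ξ x₀ := by
      have a1 : HasDerivAt (fun t : ℝ => ψ (x₀, t)) (fderiv ℝ ψ (x₀, 0) (0, 1)) 0 :=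
        HasFDerivAt.comp_hasDerivAt (l := ψ) (f := fun t : ℝ => (x₀, t)) 0 h2
          ((hasDerivAt_const 0 x₀).prodMk (hasDerivAt_id 0))
      have a2 := ((hflow x₀ (mem_ball_self hε₂)).2 0 (by simp [hε₂])).2
      rw [(hflow x₀ (mem_ball_self hε₂)).1] at a2
      exact a1.unique a2
    have h6 : ((s • P w, α w) : E × ℝ) = (s • P w, 0) + α w • (0, 1) := by simp
    change fderiv ℝ ψ (x₀, 0) (s • P w, α w) = w
    rw [h6, map_add, map_smul, h4, h5, hP, smul_smul, mul_inv_cancel₀ hspos.ne', one_smul]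
    abel
  have hstrict : HasStrictFDerivAt Θ ((ContinuousLinearEquiv.refl ℝ E : E ≃L[ℝ] E) : E →L[ℝ] E) 0 :=
    hΘ.hasStrictFDerivAt' hΘd (by simp)
  set Ψ := hstrict.localInverse Θ _ _
  have hΨd : HasFDerivAt Ψ (ContinuousLinearMap.id ℝ E) x₀ := by
    have := hstrict.to_localInverse.hasFDerivAt
    rw [hΘ0] at this
    exact this
  have hΨ0 : Ψ x₀ = 0 := by rw [← hΘ0]; exact hstrict.localInverse_apply_image
  have hΨr : ∀ᶠ z in 𝓝 x₀, Θ (Ψ z) = z := by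
    have := hstrict.eventually_right_inverse
    rwa [hΘ0] at this
  refine ⟨ε, hε, fun z => α (Ψ z), α.hasFDerivAt.comp x₀ hΨd, ?_⟩
  have hnear : ∀ᶠ w in 𝓝 (0 : E), P w ∈ ball (0 : E) ε₁ ∧ α w ∈ Ioo (-ε) ε ∧
      γ (P w) s ∈ ball x₀ ε₂ := by
    refine (P.continuous.continuousAt.eventually_mem ?_).and
      ((α.continuous.continuousAt.eventually_mem ?_).and (hγP.continuousAt.eventually_mem ?_))
    · rw [map_zero]; exact ball_mem_nhds _ hε₁
    · rw [map_zero]; exact isOpen_Ioo.mem_nhds (by simp [hε])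
    · rw [map_zero, hγ0]; exact ball_mem_nhds _ hε₂
  have hΨt : Tendsto Ψ (𝓝 x₀) (𝓝 0) := by
    have := hΨd.continuousAt.tendsto
    rwa [hΨ0] at this
  filter_upwards [hΨr, hΨt.eventually hnear] with z hz hw
  obtain ⟨hw1, hw2, hw3⟩ := hw
  obtain ⟨b1, b2, b3⟩ := hγs _ hw1
  refine ⟨γ (P (Ψ z)), γ' (P (Ψ z)), fun t => ψ (γ (P (Ψ z)) s, t), b1, by rw [b2, hαP], ?_,
    fun t ht => b3 t (hle1 ht), (hflow _ hw3).1, hw2, hz, fun t ht => (hflow _ hw3).2 t (hle2 ht)⟩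
  exact hγ.comp (contDiffOn_const.prodMk contDiffOn_id) fun t ht => ⟨hw1, hle1 ht⟩

end Spray

/-! ### Differentials of maps and flows along an integral curve -/

section Variation

variable {E : Type*} [NormedAddCommGroup E] [NormedSpace ℝ E]

/-- Let `F` preserve a vector field `ξ` and fix an integral curve `c` of `ξ` pointwise. If, for an
invariant form `η`, the differential of `F` is `v ↦ -v + 2 η(v) ξ` at one point of `c`, then it is
so at all points: the difference satisfies `Z' = [Dξ, Z]`. -/
theorem fderiv_eq_reflection_of_integralCurve {F ξ : E → E} {η : E → E →L[ℝ] ℝ} {c : ℝ → E}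
    {a b : ℝ} (hξ : ∀ t ∈ Ioo a b, ContDiffAt ℝ 1 ξ (c t))
    (hη : ∀ t ∈ Ioo a b, DifferentiableAt ℝ η (c t))
    (hF : ∀ t ∈ Ioo a b, ContDiffAt ℝ 2 F (c t)) (hfix : ∀ t ∈ Ioo a b, F (c t) = c t)
    (hc : ∀ t ∈ Ioo a b, HasDerivAt c (ξ (c t)) t)
    (hFξ : ∀ t ∈ Ioo a b, ∀ᶠ z in 𝓝 (c t), ξ (F z) = fderiv ℝ F z (ξ z))
    (hL : ∀ t ∈ Ioo a b, ∀ v,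
      fderiv ℝ η (c t) (ξ (c t)) v + η (c t) (fderiv ℝ ξ (c t) v) = 0)
    {t₁ : ℝ} (ht₁ : t₁ ∈ Ioo a b)
    (h₁ : ∀ v, fderiv ℝ F (c t₁) v = -v + (2 * η (c t₁) v) • ξ (c t₁)) :
    ∀ t ∈ Ioo a b, ∀ v, fderiv ℝ F (c t) v = -v + (2 * η (c t) v) • ξ (c t) := by
  let Z : ℝ → E →L[ℝ] E := fun t =>
    fderiv ℝ F (c t) + ContinuousLinearMap.id ℝ E - (2 : ℝ) • (η (c t)).smulRight (ξ (c t))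
  let B : ℝ → (E →L[ℝ] E) →L[ℝ] (E →L[ℝ] E) := fun t =>
    ContinuousLinearMap.compL ℝ E E E (fderiv ℝ ξ (c t)) -
      (ContinuousLinearMap.compL ℝ E E E).flip (fderiv ℝ ξ (c t))
  have hcc : ∀ t ∈ Ioo a b, ContinuousAt c t := fun t ht => (hc t ht).continuousAt
  have hB : ContinuousOn B (Ioo a b) := fun t ht => by
    have h1 : ContinuousAt (fun t => fderiv ℝ ξ (c t)) t :=
      ContinuousAt.comp (g := fderiv ℝ ξ) (f := c)
        ((hξ t ht).fderiv_right (m := 0) (by simp)).continuousAt (hcc t ht)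
    refine ContinuousAt.continuousWithinAt ?_
    exact ((ContinuousLinearMap.compL ℝ E E E).continuous.continuousAt.comp h1).sub
      ((ContinuousLinearMap.compL ℝ E E E).flip.continuous.continuousAt.comp h1)
  have hZ : ∀ t ∈ Ioo a b, HasDerivAt Z (B t (Z t)) t := by
    intro t ht
    have hF2 := (((hF t ht).fderiv_right (m := 1) (by norm_num)).differentiableAt
      (by simp)).hasFDerivAt
    have hF1 := ((hF t ht).differentiableAt (by simp)).hasFDerivAt
    have hξ1 := ((hξ t ht).differentiableAt (by simp)).hasFDerivAt
    have h1 : HasDerivAt (fun t => fderiv ℝ F (c t)) (fderiv ℝ (fderiv ℝ F) (c t) (ξ (c t))) t :=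
      HasFDerivAt.comp_hasDerivAt (f := c) t hF2 (hc t ht)
    have h2 : HasDerivAt (fun t => η (c t)) (fderiv ℝ η (c t) (ξ (c t))) t :=
      HasFDerivAt.comp_hasDerivAt (f := c) t (hη t ht).hasFDerivAt (hc t ht)
    have h3 : HasDerivAt (fun t => ξ (c t)) (fderiv ℝ ξ (c t) (ξ (c t))) t :=
      HasFDerivAt.comp_hasDerivAt (f := c) t hξ1 (hc t ht)
    -- differentiate the relation `ξ ∘ F = DF ξ`
    have h4 : ∀ u, fderiv ℝ ξ (c t) (fderiv ℝ F (c t) u) =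
        fderiv ℝ (fderiv ℝ F) (c t) u (ξ (c t)) + fderiv ℝ F (c t) (fderiv ℝ ξ (c t) u) := by
      intro u
      have a1 : HasFDerivAt (fun z => ξ (F z))
          ((fderiv ℝ ξ (c t)).comp (fderiv ℝ F (c t))) (c t) :=
        HasFDerivAt.comp (g := ξ) (f := F) (c t) (by rw [hfix t ht]; exact hξ1) hF1
      have a2 := DFunLike.congr_fun
        ((a1.congr_of_eventuallyEq ((hFξ t ht).mono fun z hz => hz.symm)).unique
          (hF2.clm_apply hξ1)) u
      simp at a2
      rw [a2]; abel
    have hs : ∀ u v, fderiv ℝ (fderiv ℝ F) (c t) u v = fderiv ℝ (fderiv ℝ F) (c t) v u :=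
      fun u v => ((hF t ht).isSymmSndFDerivAt (by simp)).eq u v
    have h5 : HasDerivAt (fun t => (η (c t)).smulRight (ξ (c t)))
        ((η (c t)).smulRight (fderiv ℝ ξ (c t) (ξ (c t))) +
          (fderiv ℝ η (c t) (ξ (c t))).smulRight (ξ (c t))) t := by
      have := (ContinuousLinearMap.smulRightL ℝ E E).hasFDerivAt_of_bilinear
        h2.hasFDerivAt h3.hasFDerivAt
      refine this.hasDerivAt.congr_deriv ?_
      ext v
      simp
    refine ((h1.add_const (ContinuousLinearMap.id ℝ E)).sub (h5.const_smul (2 : ℝ))).congr_deriv ?_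
    ext v
    have e1 := h4 v
    have e2 := hL t ht v
    have e3 : fderiv ℝ η (c t) (ξ (c t)) v = -η (c t) (fderiv ℝ ξ (c t) v) := by linarith
    simp only [B, Z, sub_apply, add_apply, smul_apply,
      ContinuousLinearMap.smulRight_apply, ContinuousLinearMap.compL_apply,
      ContinuousLinearMap.flip_apply, ContinuousLinearMap.comp_apply, ContinuousLinearMap.id_apply,
      map_sub, map_add, map_smul, e1, e3, hs (ξ (c t)) v]
    module
  have hzero := eqOn_zero_of_linear_ode hB hZ ht₁ (by
    ext v
    simp [Z, h₁ v, mul_smul])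
  intro t ht v
  have := DFunLike.congr_fun (hzero t ht) v
  simp [Z] at this
  rw [mul_smul, ← sub_eq_zero, ← this]
  abel

/-- The variational equation: if `H(·, z)` are integral curves of `ξ`, then the derivative of `H`
in `z` solves the linearized equation. -/
theorem hasDerivAt_fderiv_flow {ξ : E → E} {H : ℝ × E → E} {t : ℝ} {z : E}
    (hH : ContDiffAt ℝ 2 H (t, z)) (hξ : DifferentiableAt ℝ ξ (H (t, z)))
    (hflow : ∀ᶠ q in 𝓝 (t, z), fderiv ℝ H q (1, 0) = ξ (H q)) (v : E) :
    HasDerivAt (fun r => fderiv ℝ H (r, z) (0, v))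
      (fderiv ℝ ξ (H (t, z)) (fderiv ℝ H (t, z) (0, v))) t := by
  have hH1 := (hH.differentiableAt (by simp)).hasFDerivAt
  have hH2 := ((hH.fderiv_right (m := 1) (by norm_num)).differentiableAt (by simp)).hasFDerivAt
  have h1 : HasDerivAt (fun r : ℝ => fderiv ℝ H (r, z))
      (fderiv ℝ (fderiv ℝ H) (t, z) (1, 0)) t :=
    HasFDerivAt.comp_hasDerivAt (f := fun r : ℝ => (r, z)) t hH2
      ((hasDerivAt_id t).prodMk (hasDerivAt_const t z))
  have h2 := h1.clm_apply (hasDerivAt_const t ((0 : ℝ), v))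
  refine h2.congr_deriv ?_
  have h3 : HasFDerivAt (fun q => ξ (H q))
      ((fderiv ℝ ξ (H (t, z))).comp (fderiv ℝ H (t, z))) (t, z) :=
    HasFDerivAt.comp (t, z) hξ.hasFDerivAt hH1
  have h4 := (h3.congr_of_eventuallyEq hflow).unique
    (hH2.clm_apply (hasFDerivAt_const ((1 : ℝ), (0 : E)) (t, z)))
  have h5 := DFunLike.congr_fun h4 (0, v)
  simp at h5
  rw [h5, (hH.isSymmSndFDerivAt (by simp)).eq (0, v) (1, 0)]
  simp

end Variation

/-! ### Coordinate expressions -/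

section Coordinates

variable {E : Type*} [NormedAddCommGroup E] [NormedSpace ℝ E]
  {M : Type*} [TopologicalSpace M] [ChartedSpace E M]

local notation "χ" => extChartAt 𝓘(ℝ, E)

variable (E) in
/-- The linear isomorphism from coordinate vectors to tangent vectors at the point with
coordinates `y` in the chart at `p`. -/
def frame (p : M) (y : E) : E →L[ℝ] E := mfderiv 𝓘(ℝ, E) 𝓘(ℝ, E) (extChartAt 𝓘(ℝ, E) p).symm y

variable (E) in
/-- The linear isomorphism from tangent vectors at `x` to coordinate vectors in the chart at `p`. -/
def coframe (p x : M) : E →L[ℝ] E := mfderiv 𝓘(ℝ, E) 𝓘(ℝ, E) (extChartAt 𝓘(ℝ, E) p) x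

variable (E) in
/-- The differential of a map. As for the other tensors below, its values are typed in the model
space, to which every tangent space is definitionally equal, so that vectors at different points can
be compared in one type. -/
def differential (σ : M → M) (x : M) : E →L[ℝ] E := mfderiv 𝓘(ℝ, E) 𝓘(ℝ, E) σ x

/-- The coordinate expression of a vector field in the chart at `p`. -/
def coordField (X : (x : M) → TangentSpace 𝓘(ℝ, E) x) (p : M) (y : E) : E :=
  coframe E p ((χ p).symm y) (X ((χ p).symm y))

/-- The coordinate expression of a map in the charts at `q` and `p`. -/
def localRep (p q : M) (σ : M → M) (y : E) : E := χ p (σ ((χ q).symm y))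

theorem isOpen_target (p : M) : IsOpen (χ p).target := isOpen_extChartAt_target p

theorem isOpen_chartSource (p : M) : IsOpen (χ p).source := isOpen_extChartAt_source p

variable [IsManifold 𝓘(ℝ, E) ∞ M]

theorem contMDiffAt_symm {p : M} {y : E} (hy : y ∈ (χ p).target) :
    ContMDiffAt 𝓘(ℝ, E) 𝓘(ℝ, E) ∞ (χ p).symm y :=
  (contMDiffOn_extChartAt_symm p).contMDiffAt ((isOpen_target p).mem_nhds hy)

theorem contMDiffAt_chart {p x : M} (hx : x ∈ (χ p).source) :
    ContMDiffAt 𝓘(ℝ, E) 𝓘(ℝ, E) ∞ (χ p) x :=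
  contMDiffAt_extChartAt' (by simpa using hx)

theorem hasMFDerivAt_symm {p : M} {y : E} (hy : y ∈ (χ p).target) :
    HasMFDerivAt 𝓘(ℝ, E) 𝓘(ℝ, E) (χ p).symm y (frame E p y) :=
  ((contMDiffAt_symm hy).mdifferentiableAt (by simp)).hasMFDerivAt

theorem hasMFDerivAt_chart {p x : M} (hx : x ∈ (χ p).source) :
    HasMFDerivAt 𝓘(ℝ, E) 𝓘(ℝ, E) (χ p) x (coframe E p x) :=
  ((contMDiffAt_chart hx).mdifferentiableAt (by simp)).hasMFDerivAt

theorem isManifold_one : IsManifold 𝓘(ℝ, E) 1 M := IsManifold.of_le (n := ∞) (by simp)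

theorem coframe_comp_frame {p : M} {y : E} (hy : y ∈ (χ p).target) :
    (coframe E p ((χ p).symm y)).comp (frame E p y) = ContinuousLinearMap.id ℝ E := by
  have := isManifold_one (E := E) (M := M)
  have h := mfderiv_extChartAt_comp_mfderivWithin_extChartAt_symm (I := 𝓘(ℝ, E)) hy
  rw [ModelWithCorners.range_eq_univ, mfderivWithin_univ] at h
  exact h

theorem frame_comp_coframe {p : M} {y : E} (hy : y ∈ (χ p).target) :
    (frame E p y).comp (coframe E p ((χ p).symm y)) = ContinuousLinearMap.id ℝ E := by
  have := isManifold_one (E := E) (M := M)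
  have h := mfderivWithin_extChartAt_symm_comp_mfderiv_extChartAt (I := 𝓘(ℝ, E)) hy
  rw [ModelWithCorners.range_eq_univ, mfderivWithin_univ] at h
  exact h

theorem coframe_frame {p : M} {y : E} (hy : y ∈ (χ p).target) (u : E) :
    coframe E p ((χ p).symm y) (frame E p y u) = u :=
  DFunLike.congr_fun (coframe_comp_frame hy) u

theorem frame_coframe {p : M} {y : E} (hy : y ∈ (χ p).target) (u : E) :
    frame E p y (coframe E p ((χ p).symm y) u) = u :=
  DFunLike.congr_fun (frame_comp_coframe hy) u

theorem frame_chart_coframe {p x : M} (hx : x ∈ (χ p).source) (u : E) :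
    frame E p (χ p x) (coframe E p x u) = u := by
  have := frame_coframe ((χ p).map_source hx) u
  rwa [(χ p).left_inv hx] at this

theorem coframe_frame_chart {p x : M} (hx : x ∈ (χ p).source) (u : E) :
    coframe E p x (frame E p (χ p x) u) = u := by
  have := coframe_frame ((χ p).map_source hx) u
  rwa [(χ p).left_inv hx] at this

theorem frame_inverse {p : M} {y : E} (hy : y ∈ (χ p).target) :
    (frame E p y).inverse = coframe E p ((χ p).symm y) :=
  ContinuousLinearMap.inverse_eq (frame_comp_coframe hy) (coframe_comp_frame hy)

theorem frame_isInvertible {p : M} {y : E} (hy : y ∈ (χ p).target) :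
    (frame E p y).IsInvertible :=
  ContinuousLinearMap.IsInvertible.of_inverse (frame_comp_coframe hy) (coframe_comp_frame hy)

theorem frame_injective {p : M} {y : E} (hy : y ∈ (χ p).target) :
    Function.Injective (frame E p y) := fun u v h => by
  rw [← coframe_frame hy u, h, coframe_frame hy]

theorem frame_surjective {p : M} {y : E} (hy : y ∈ (χ p).target) :
    Function.Surjective (frame E p y) := fun u => ⟨_, frame_coframe hy u⟩

theorem frame_coordField {X : (x : M) → TangentSpace 𝓘(ℝ, E) x} {p : M} {y : E}
    (hy : y ∈ (χ p).target) : frame E p y (coordField X p y) = X ((χ p).symm y) :=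
  frame_coframe hy _

/-- The coordinate expression of the differential of a map. -/
theorem frame_fderiv_localRep {p q : M} {σ : M → M} {y : E} (hy : y ∈ (χ q).target)
    (hσ : MDifferentiableAt 𝓘(ℝ, E) 𝓘(ℝ, E) σ ((χ q).symm y))
    (hp : σ ((χ q).symm y) ∈ (χ p).source) (u : E) :
    frame E p (localRep p q σ y) (fderiv ℝ (localRep p q σ) y u) =
      differential E σ ((χ q).symm y) (frame E q y u) := by
  have h2 : HasFDerivAt (localRep p q σ) ((coframe E p (σ ((χ q).symm y))).comp
      ((differential E σ ((χ q).symm y)).comp (frame E q y))) y :=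
    ((hasMFDerivAt_chart hp).comp y (hσ.hasMFDerivAt.comp y (hasMFDerivAt_symm hy))).hasFDerivAt
  rw [h2.fderiv]
  exact frame_chart_coframe hp _

theorem contDiffAt_localRep {p q : M} {σ : M → M} {y : E} (hy : y ∈ (χ q).target)
    (hσ : ContMDiffAt 𝓘(ℝ, E) 𝓘(ℝ, E) ∞ σ ((χ q).symm y))
    (hp : σ ((χ q).symm y) ∈ (χ p).source) : ContDiffAt ℝ ∞ (localRep p q σ) y :=
  ((contMDiffAt_chart hp).comp y (hσ.comp y (contMDiffAt_symm hy))).contDiffAt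

/-- The coordinate expression of the velocity of a curve. -/
theorem hasDerivAt_chart_of_hasMFDerivAt {c : ℝ → M} {t : ℝ} {v : TangentSpace 𝓘(ℝ, E) (c t)}
    {p : M} (hp : c t ∈ (χ p).source)
    (h : HasMFDerivAt 𝓘(ℝ, ℝ) 𝓘(ℝ, E) c t ((1 : ℝ →L[ℝ] ℝ).smulRight v)) :
    HasDerivAt (fun r => χ p (c r)) (coframe E p (c t) v) t := by
  have h2 : HasFDerivAt (fun r => χ p (c r)) ((coframe E p (c t)).comp
      ((1 : ℝ →L[ℝ] ℝ).smulRight (v : E))) t :=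
    ((hasMFDerivAt_chart hp).comp t h).hasFDerivAt
  refine h2.hasDerivAt.congr_deriv ?_
  change coframe E p (c t) ((1 : ℝ) • (v : E)) = coframe E p (c t) v
  rw [one_smul]

theorem hasMFDerivAt_of_hasDerivAt_chart {z : ℝ → E} {t : ℝ} {v : E} {p : M}
    (hz : z t ∈ (χ p).target) (h : HasDerivAt z v t) :
    HasMFDerivAt 𝓘(ℝ, ℝ) 𝓘(ℝ, E) (fun r => (χ p).symm (z r)) t
      ((1 : ℝ →L[ℝ] ℝ).smulRight (M₂ := TangentSpace 𝓘(ℝ, E) ((χ p).symm (z t)))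
        (frame E p (z t) v)) := by
  have h1 := (hasMFDerivAt_symm hz).comp t h.hasFDerivAt.hasMFDerivAt
  refine h1.congr_mfderiv ?_
  ext
  change frame E p (z t) ((1 : ℝ) • v) = (1 : ℝ) • frame E p (z t) v
  simp

theorem contDiffOn_coordField [CompleteSpace E] {X : (x : M) → TangentSpace 𝓘(ℝ, E) x} {U : Set M}
    (hX : SmoothVectorFieldOn X U) (p : M) :
    ContDiffOn ℝ ∞ (coordField X p) ((χ p).target ∩ (χ p).symm ⁻¹' U) := by
  have := isManifold_one (E := E) (M := M)
  have h : ContMDiffOn 𝓘(ℝ, E) 𝓘(ℝ, E).tangent ∞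
      (fun y => (⟨y, VectorField.mpullback 𝓘(ℝ, E) 𝓘(ℝ, E) (χ p).symm X y⟩ :
        TangentBundle 𝓘(ℝ, E) E))
      ((χ p).target ∩ (χ p).symm ⁻¹' U) := by
    intro y hy
    exact (ContMDiffWithinAt.mpullback_vectorField_preimage (n := ∞) (hX _ hy.2)
      (contMDiffAt_symm hy.1) (frame_isInvertible (E := E) hy.1) (by simp)).mono inter_subset_right
  have h' : ContDiffOn ℝ ∞ (VectorField.mpullback 𝓘(ℝ, E) 𝓘(ℝ, E) (χ p).symm X : E → E)
      ((χ p).target ∩ (χ p).symm ⁻¹' U) := contMDiffOn_vectorSpace_iff_contDiffOn.1 h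
  refine h'.congr fun y hy => ?_
  exact (DFunLike.congr_fun (frame_inverse hy.1) _).symm

theorem smoothVectorFieldOn_of_coordField [CompleteSpace E]
    {X : (x : M) → TangentSpace 𝓘(ℝ, E) x} {p : M} {W : Set E}
    (hX : ContDiffOn ℝ ∞ (coordField X p) W) :
    SmoothVectorFieldOn X ((χ p).source ∩ χ p ⁻¹' W) := by
  have := isManifold_one (E := E) (M := M)
  have h : ContMDiffOn 𝓘(ℝ, E) 𝓘(ℝ, E).tangent ∞
      (fun x => (⟨x, VectorField.mpullback 𝓘(ℝ, E) 𝓘(ℝ, E) (χ p) (coordField X p) x⟩ :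
        TangentBundle 𝓘(ℝ, E) M)) ((χ p).source ∩ χ p ⁻¹' W) := by
    intro x hx
    refine (ContMDiffWithinAt.mpullback_vectorField_preimage (n := ∞) (t := W)
      (contMDiffOn_vectorSpace_iff_contDiffOn.2 hX _ hx.2)
      (contMDiffAt_chart hx.1) ?_ (by simp)).mono inter_subset_right
    exact isInvertible_mfderiv_extChartAt hx.1
  refine h.congr fun x hx => ?_
  have h1 : (coframe E p x).inverse = frame E p (χ p x) :=
    ContinuousLinearMap.inverse_eq
      (ContinuousLinearMap.ext fun u => coframe_frame_chart hx.1 u)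
      (ContinuousLinearMap.ext fun u => frame_chart_coframe hx.1 u)
  have h2 : VectorField.mpullback 𝓘(ℝ, E) 𝓘(ℝ, E) (χ p) (coordField X p) x = X x := by
    refine (DFunLike.congr_fun h1 (coordField X p (χ p x))).trans ?_
    rw [coordField, (χ p).left_inv hx.1]
    exact frame_chart_coframe hx.1 (X x)
  rw [h2]

/-- The coordinate expression of a Lie bracket. -/
theorem coframe_mlieBracket [CompleteSpace E] {X Y : (x : M) → TangentSpace 𝓘(ℝ, E) x} {U : Set M}
    (hU : IsOpen U) (hX : SmoothVectorFieldOn X U) (hY : SmoothVectorFieldOn Y U) {p : M} {y : E}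
    (hy : y ∈ (χ p).target) (hyU : (χ p).symm y ∈ U) :
    coframe E p ((χ p).symm y) (VectorField.mlieBracket 𝓘(ℝ, E) X Y ((χ p).symm y)) =
      fderiv ℝ (coordField Y p) y (coordField X p y) -
        fderiv ℝ (coordField X p) y (coordField Y p y) := by
  have := isManifold_one (E := E) (M := M)
  have : IsManifold 𝓘(ℝ, E) (minSmoothness ℝ 3) M :=
    IsManifold.of_le (n := ∞) (by simp; exact ENat.LEInfty.out)
  have h := VectorField.mpullback_mlieBracket (n := ∞) (I := 𝓘(ℝ, E)) (I' := 𝓘(ℝ, E))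
    (f := (χ p).symm) (V := X) (W := Y) (x₀ := y)
    (((hX _ hyU).contMDiffAt (hU.mem_nhds hyU)).mdifferentiableAt (by simp))
    (((hY _ hyU).contMDiffAt (hU.mem_nhds hyU)).mdifferentiableAt (by simp))
    (contMDiffAt_symm hy) (by simp; exact ENat.LEInfty.out)
  have hev : ∀ Z : (x : M) → TangentSpace 𝓘(ℝ, E) x,
      VectorField.mpullback 𝓘(ℝ, E) 𝓘(ℝ, E) (χ p).symm Z =ᶠ[𝓝 y] coordField Z p := by
    intro Z
    filter_upwards [(isOpen_target p).mem_nhds hy] with z hz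
    rw [VectorField.mpullback_apply]
    exact DFunLike.congr_fun (frame_inverse hz) _
  rw [Filter.EventuallyEq.mlieBracket_vectorField_eq (hev X) (hev Y)] at h
  refine ((hev _).self_of_nhds.symm.trans h).trans ?_
  refine (congrFun (VectorField.mlieBracketWithin_eq_lieBracketWithin (s := univ)) y).trans ?_
  rw [VectorField.lieBracketWithin_univ]
  rfl

end Coordinates

/-! ### The structure tensors in coordinates -/

namespace PseudohermitianStructure

variable {E : Type*} [NormedAddCommGroup E] [NormedSpace ℝ E] [FiniteDimensional ℝ E]
  {M : Type*} [TopologicalSpace M] [ChartedSpace E M] [IsManifold 𝓘(ℝ, E) ∞ M]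
  (P : PseudohermitianStructure E M)

local notation "χ" => extChartAt 𝓘(ℝ, E)

/-- The contact form at `x`, as a form on the model space. -/
def form (x : M) : E →L[ℝ] ℝ := P.η x

/-- The endomorphism `φ_x`, on the model space. -/
def endo (x : M) : E →L[ℝ] E := LinearMap.toContinuousLinearMap (P.φ x : E →ₗ[ℝ] E)

/-- The Reeb vector at `x`, in the model space. -/
def reeb (x : M) : E := P.ξ x

/-- The contact form in the chart at `p`. -/
def coordEta (p : M) (y : E) : E →L[ℝ] ℝ := coordForm P.η p y

/-- The Reeb field in the chart at `p`. -/
def coordReeb (p : M) (y : E) : E := coordField P.ξ p y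

/-- The tensor field `φ` in the chart at `p`. -/
def coordPhi (p : M) (y : E) : E →L[ℝ] E :=
  (coframe E p ((χ p).symm y)).comp ((P.endo ((χ p).symm y)).comp (frame E p y))

/-- The exterior derivative `dη` in the chart at `p`. -/
def coordDeta (p : M) (y : E) : E →L[ℝ] E →L[ℝ] ℝ :=
  (1 / 2 : ℝ) • (fderiv ℝ (P.coordEta p) y - (fderiv ℝ (P.coordEta p) y).flip)

/-- The Webster metric in the chart at `p`. -/
def coordG (p : M) (y : E) : E →L[ℝ] E →L[ℝ] ℝ :=
  (P.coordEta p y).smulRight (P.coordEta p y) - ((P.coordDeta p y).flip.comp (P.coordPhi p y)).flip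

theorem coordEta_apply (p : M) (y u : E) :
    P.coordEta p y u = P.form ((χ p).symm y) (frame E p y u) := rfl

theorem coordDeta_apply (p : M) (y u v : E) :
    P.coordDeta p y u v = flatExtDer (P.coordEta p) y u v := by
  simp [coordDeta, flatExtDer]

theorem coordG_apply (p : M) (y u v : E) : P.coordG p y u v =
    P.coordEta p y u * P.coordEta p y v - P.coordDeta p y u (P.coordPhi p y v) := by
  simp [coordG]

theorem coordDeta_swap (p : M) (y u v : E) : P.coordDeta p y u v = -P.coordDeta p y v u := by
  simp only [coordDeta_apply, flatExtDer]; ring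

theorem coordDeta_self (p : M) (y u : E) : P.coordDeta p y u u = 0 := by
  simp [coordDeta_apply, flatExtDer]

variable {P}

theorem contDiffOn_coordEta (p : M) : ContDiffOn ℝ ∞ (P.coordEta p) (χ p).target := P.smooth_η p

theorem contDiffAt_coordEta {p : M} {y : E} (hy : y ∈ (χ p).target) :
    ContDiffAt ℝ ∞ (P.coordEta p) y :=
  (contDiffOn_coordEta p).contDiffAt ((isOpen_target p).mem_nhds hy)

theorem localRep_id_mem {p q : M} {y : E} (hp : (χ q).symm y ∈ (χ p).source) :
    localRep p q id y ∈ (χ p).target ∧ (χ p).symm (localRep p q id y) = (χ q).symm y :=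
  ⟨(χ p).map_source hp, (χ p).left_inv hp⟩

theorem frame_fderiv_transition {p q : M} {y : E} (hy : y ∈ (χ q).target)
    (hp : (χ q).symm y ∈ (χ p).source) (u : E) :
    frame E p (localRep p q id y) (fderiv ℝ (localRep p q id) y u) = frame E q y u := by
  rw [frame_fderiv_localRep hy mdifferentiableAt_id hp]
  exact DFunLike.congr_fun (mfderiv_id (I := 𝓘(ℝ, E)) (x := (χ q).symm y)) _

theorem eventually_symm_mem {q : M} {y : E} (hy : y ∈ (χ q).target) {U : Set M} (hU : IsOpen U)
    (h : (χ q).symm y ∈ U) : ∀ᶠ z in 𝓝 y, z ∈ (χ q).target ∧ (χ q).symm z ∈ U :=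
  ((isOpen_target q).eventually_mem hy).and
    ((contMDiffAt_symm hy).continuousAt.eventually_mem (hU.mem_nhds h))

/-- The exterior derivative may be computed in any chart. -/
theorem extDer_frame {p : M} {y : E} (hy : y ∈ (χ p).target) (u v : E) :
    extDer P.η ((χ p).symm y) (frame E p y u) (frame E p y v) = P.coordDeta p y u v := by
  set x := (χ p).symm y with hx
  have hxs : x ∈ (χ x).source := mem_extChartAt_source x
  have h1 : flatExtDer (P.coordEta p) y u v =
      flatExtDer (P.coordEta x) (localRep x p id y) (fderiv ℝ (localRep x p id) y u)
        (fderiv ℝ (localRep x p id) y v) := by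
    refine flatExtDer_pullback
      ((contDiffAt_localRep hy contMDiffAt_id hxs).of_le ENat.LEInfty.out)
      ((contDiffAt_coordEta (localRep_id_mem hxs).1).differentiableAt (by simp)) ?_ u v
    filter_upwards [eventually_symm_mem hy (isOpen_chartSource x) hxs] with z hz w
    rw [coordEta_apply, coordEta_apply, frame_fderiv_transition hz.1 hz.2,
      (localRep_id_mem hz.2).2]
  have h2 : ∀ w, coframe E x x (frame E p y w) = fderiv ℝ (localRep x p id) y w := by
    intro w
    rw [← frame_fderiv_transition hy hxs w]
    exact coframe_frame_chart hxs _
  rw [coordDeta_apply, h1, ← h2, ← h2]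
  exact extDer_apply _ _ _ _

theorem frame_coordReeb {p : M} {y : E} (hy : y ∈ (χ p).target) :
    frame E p y (P.coordReeb p y) = P.reeb ((χ p).symm y) := frame_coordField hy

theorem coordEta_coordReeb {p : M} {y : E} (hy : y ∈ (χ p).target) :
    P.coordEta p y (P.coordReeb p y) = 1 := by
  rw [coordEta_apply, frame_coordReeb hy]
  exact P.η_ξ _

theorem coordDeta_coordReeb {p : M} {y : E} (hy : y ∈ (χ p).target) (v : E) :
    P.coordDeta p y (P.coordReeb p y) v = 0 := by
  rw [← extDer_frame hy, frame_coordReeb hy]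
  exact P.extDer_ξ _ _

theorem coordDeta_coordReeb_right {p : M} {y : E} (hy : y ∈ (χ p).target) (v : E) :
    P.coordDeta p y v (P.coordReeb p y) = 0 := by
  rw [coordDeta_swap, coordDeta_coordReeb hy, neg_zero]

theorem frame_coordPhi {p : M} {y : E} (hy : y ∈ (χ p).target) (u : E) :
    frame E p y (P.coordPhi p y u) = P.endo ((χ p).symm y) (frame E p y u) :=
  frame_coframe hy _

theorem endo_reeb (x : M) : P.endo x (P.reeb x) = 0 := P.φ_ξ x

theorem form_endo (x : M) (u : E) : P.form x (P.endo x u) = 0 := (P.J x (P.proj x u)).2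

theorem endo_endo (x : M) (u : E) : P.endo x (P.endo x u) = -u + P.form x u • P.reeb x := by
  have h1 : P.endo x (P.endo x u) = (P.J x (P.J x (P.proj x u))).1 := P.φ_of_mem x _
  rw [h1, P.J_J]
  change -(u - P.form x u • P.reeb x) = _
  abel

theorem endo_of_mem {x : M} (X : P.H x) : P.endo x X.1 = (P.J x X).1 := P.φ_of_mem x X

theorem coordPhi_coordReeb {p : M} {y : E} (hy : y ∈ (χ p).target) :
    P.coordPhi p y (P.coordReeb p y) = 0 := by
  apply frame_injective hy
  rw [frame_coordPhi hy, frame_coordReeb hy, map_zero]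
  exact endo_reeb _

theorem coordEta_coordPhi {p : M} {y : E} (hy : y ∈ (χ p).target) (u : E) :
    P.coordEta p y (P.coordPhi p y u) = 0 := by
  rw [coordEta_apply, frame_coordPhi hy, form_endo]

theorem coordPhi_coordPhi {p : M} {y : E} (hy : y ∈ (χ p).target) (u : E) :
    P.coordPhi p y (P.coordPhi p y u) = -u + P.coordEta p y u • P.coordReeb p y := by
  apply frame_injective hy
  rw [frame_coordPhi hy, frame_coordPhi hy, endo_endo, map_add, map_neg, map_smul,
    frame_coordReeb hy, coordEta_apply]

/-- Strict pseudoconvexity in coordinates. -/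
theorem coordDeta_coordPhi_neg {p : M} {y : E} (hy : y ∈ (χ p).target) {u : E}
    (hu : P.coordEta p y u = 0) (hu0 : u ≠ 0) : P.coordDeta p y u (P.coordPhi p y u) < 0 := by
  have hmem : frame E p y u ∈ P.H ((χ p).symm y) := hu
  have hne : (⟨_, hmem⟩ : P.H ((χ p).symm y)) ≠ 0 := fun h => hu0 (by
    apply frame_injective hy
    rw [map_zero]
    exact congrArg Subtype.val h)
  have h := P.levi_pos _ _ hne
  rw [← extDer_frame hy, frame_coordPhi hy]
  have h2 := endo_of_mem (P := P) ⟨_, hmem⟩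
  change P.endo ((χ p).symm y) (frame E p y u) = _ at h2
  rw [h2]
  linarith

/-- The form `dη + η ⊗ η` is nondegenerate. -/
theorem coordDeta_add_isInvertible {p : M} {y : E} (hy : y ∈ (χ p).target) :
    (P.coordDeta p y + (P.coordEta p y).smulRight (P.coordEta p y)).IsInvertible := by
  obtain ⟨e, he⟩ := exists_equiv_of_injective
    (A := P.coordDeta p y + (P.coordEta p y).smulRight (P.coordEta p y)) (fun u hu => by
      have h0 : ∀ v, P.coordDeta p y u v + P.coordEta p y u * P.coordEta p y v = 0 :=
        fun v => DFunLike.congr_fun hu v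
      have h1 : P.coordEta p y u = 0 := by
        have := h0 u
        rw [coordDeta_self, zero_add] at this
        exact mul_self_eq_zero.1 this
      by_contra hne
      have h2 := coordDeta_coordPhi_neg hy h1 hne
      have h3 := h0 (P.coordPhi p y u)
      rw [h1] at h3
      linarith)
  exact ⟨e, he⟩

theorem contDiffOn_fderiv_coordEta (p : M) :
    ContDiffOn ℝ ∞ (fderiv ℝ (P.coordEta p)) (χ p).target :=
  (contDiffOn_coordEta p).fderiv_of_isOpen (isOpen_target p) (by simp)

theorem contDiffOn_coordDeta (p : M) : ContDiffOn ℝ ∞ (P.coordDeta p) (χ p).target := by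
  have h := contDiffOn_fderiv_coordEta (P := P) p
  refine ContDiffOn.const_smul _ (h.sub ?_)
  exact (ContinuousLinearMap.flipₗᵢ ℝ E E ℝ).contDiff.comp_contDiffOn h

theorem contDiffOn_coordReeb (p : M) : ContDiffOn ℝ ∞ (P.coordReeb p) (χ p).target := by
  have : CompleteSpace E := FiniteDimensional.complete ℝ E
  have hη := contDiffOn_coordEta (P := P) p
  have h1 : ContDiffOn ℝ ∞
      (fun y => P.coordDeta p y + (P.coordEta p y).smulRight (P.coordEta p y)) (χ p).target :=
    (contDiffOn_coordDeta p).add (hη.smulRight hη)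
  have h2 : ContDiffOn ℝ ∞ (fun y => (P.coordDeta p y +
      (P.coordEta p y).smulRight (P.coordEta p y)).inverse (P.coordEta p y)) (χ p).target := by
    refine ContDiffOn.clm_apply (fun y hy => ?_) hη
    exact ContDiffAt.comp_contDiffWithinAt y (coordDeta_add_isInvertible hy).contDiffAt_map_inverse
      (h1 y hy)
  refine h2.congr fun y hy => ?_
  obtain ⟨e, he⟩ := coordDeta_add_isInvertible (P := P) hy
  have h3 : e (P.coordReeb p y) = P.coordEta p y := by
    have : e (P.coordReeb p y) = (P.coordDeta p y +
      (P.coordEta p y).smulRight (P.coordEta p y)) (P.coordReeb p y) := by rw [← he]; rfl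
    rw [this]
    ext v
    simp [coordDeta_coordReeb hy, coordEta_coordReeb hy]
  rw [← he, ContinuousLinearMap.inverse_equiv, ← h3]
  simp

theorem contDiffAt_coordReeb {p : M} {y : E} (hy : y ∈ (χ p).target) :
    ContDiffAt ℝ ∞ (P.coordReeb p) y :=
  (contDiffOn_coordReeb p).contDiffAt ((isOpen_target p).mem_nhds hy)

variable (P) in
/-- The section of `HM` near `p` which is the projection of a constant coordinate field. -/
def horizontalSection (p : M) (u : E) (x : M) : P.H x := P.proj x (frame E p (χ p x) u)

theorem coordField_horizontalSection {p : M} {y : E} (hy : y ∈ (χ p).target) (u : E) :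
    coordField (fun x => (P.horizontalSection p u x).1) p y =
      u - P.coordEta p y u • P.coordReeb p y := by
  apply frame_injective hy
  rw [frame_coordField hy, map_sub, map_smul, frame_coordReeb hy]
  change frame E p (χ p ((χ p).symm y)) u - P.form ((χ p).symm y)
    (frame E p (χ p ((χ p).symm y)) u) • P.reeb ((χ p).symm y) = _
  rw [(χ p).right_inv hy]
  rfl

theorem coordField_J_horizontalSection {p : M} {y : E} (hy : y ∈ (χ p).target) (u : E) :
    coordField (fun x => (P.J x (P.horizontalSection p u x)).1) p y = P.coordPhi p y u := by
  apply frame_injective hy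
  rw [frame_coordField hy, frame_coordPhi hy]
  change P.endo ((χ p).symm y) (frame E p (χ p ((χ p).symm y)) u) = _
  rw [(χ p).right_inv hy]

theorem smoothOn_source_of_coordField {X : (x : M) → TangentSpace 𝓘(ℝ, E) x} {p : M}
    (hX : ContDiffOn ℝ ∞ (coordField X p) (χ p).target) :
    SmoothVectorFieldOn X (χ p).source := by
  have : CompleteSpace E := FiniteDimensional.complete ℝ E
  exact (smoothVectorFieldOn_of_coordField hX).mono fun x hx => ⟨hx, (χ p).map_source hx⟩

theorem contDiffOn_coordField_of_source {X : (x : M) → TangentSpace 𝓘(ℝ, E) x} {p : M}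
    (hX : SmoothVectorFieldOn X (χ p).source) :
    ContDiffOn ℝ ∞ (coordField X p) (χ p).target := by
  have : CompleteSpace E := FiniteDimensional.complete ℝ E
  exact (contDiffOn_coordField hX p).mono fun y hy => ⟨hy, (χ p).map_target hy⟩

theorem smooth_horizontalSection (p : M) (u : E) :
    SmoothVectorFieldOn (fun x => (P.horizontalSection p u x).1) (χ p).source := by
  refine smoothOn_source_of_coordField (ContDiffOn.congr ?_
    fun y hy => coordField_horizontalSection hy u)
  exact contDiffOn_const.sub
    (((contDiffOn_coordEta p).clm_apply contDiffOn_const).smul (contDiffOn_coordReeb p))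

theorem smooth_J_horizontalSection (p : M) (u : E) :
    SmoothVectorFieldOn (fun x => (P.J x (P.horizontalSection p u x)).1) (χ p).source :=
  P.smooth_J _ _ (isOpen_chartSource p) (smooth_horizontalSection p u)

theorem contDiffOn_coordPhi (p : M) : ContDiffOn ℝ ∞ (P.coordPhi p) (χ p).target := by
  refine contDiffOn_clm_apply.2 fun u => ?_
  exact (contDiffOn_coordField_of_source (smooth_J_horizontalSection p u)).congr
    fun y hy => (coordField_J_horizontalSection hy u).symm

theorem smooth_reeb : SmoothVectorFieldOn P.ξ univ := fun x _ =>
  ((smoothOn_source_of_coordField (contDiffOn_coordReeb (P := P) x)).contMDiffAt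
    ((isOpen_chartSource x).mem_nhds (mem_extChartAt_source x))).contMDiffWithinAt

theorem contDiffOn_coordG (p : M) : ContDiffOn ℝ ∞ (P.coordG p) (χ p).target := by
  have hη := contDiffOn_coordEta (P := P) p
  refine (hη.smulRight hη).sub ?_
  refine (ContinuousLinearMap.flipₗᵢ ℝ E E ℝ).contDiff.comp_contDiffOn ?_
  exact ((ContinuousLinearMap.flipₗᵢ ℝ E E ℝ).contDiff.comp_contDiffOn
    (contDiffOn_coordDeta p)).clm_comp (contDiffOn_coordPhi p)

theorem contDiffAt_coordG {p : M} {y : E} (hy : y ∈ (χ p).target) :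
    ContDiffAt ℝ ∞ (P.coordG p) y :=
  (contDiffOn_coordG p).contDiffAt ((isOpen_target p).mem_nhds hy)

/-- For sections of the kernel of a one-form, the form of the bracket is minus twice the exterior
derivative. -/
theorem form_bracket_of_ker {η : E → E →L[ℝ] ℝ} {X Y : E → E} {y : E}
    (hη : DifferentiableAt ℝ η y) (hX : DifferentiableAt ℝ X y) (hY : DifferentiableAt ℝ Y y)
    (hX0 : ∀ᶠ z in 𝓝 y, η z (X z) = 0) (hY0 : ∀ᶠ z in 𝓝 y, η z (Y z) = 0) :
    η y (fderiv ℝ Y y (X y) - fderiv ℝ X y (Y y)) = -2 * flatExtDer η y (X y) (Y y) := by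
  have h1 := DFunLike.congr_fun (hasFDerivAt_eq_zero_of_eventually_const
    (hη.hasFDerivAt.clm_apply hX.hasFDerivAt) hX0) (Y y)
  have h2 := DFunLike.congr_fun (hasFDerivAt_eq_zero_of_eventually_const
    (hη.hasFDerivAt.clm_apply hY.hasFDerivAt) hY0) (X y)
  simp at h1 h2
  rw [map_sub, flatExtDer]
  linarith

/-- The partial integrability of the `CR` structure: `dη(φ u, φ v) = dη(u, v)`. -/
theorem coordDeta_coordPhi_coordPhi {p : M} {y : E} (hy : y ∈ (χ p).target) (u v : E) :
    P.coordDeta p y (P.coordPhi p y u) (P.coordPhi p y v) = P.coordDeta p y u v := by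
  have : CompleteSpace E := FiniteDimensional.complete ℝ E
  have hys : (χ p).symm y ∈ (χ p).source := (χ p).map_target hy
  have hb := P.bracket_mem (χ p).source (P.horizontalSection p u) (P.horizontalSection p v)
    (isOpen_chartSource p) (smooth_horizontalSection p u) (smooth_horizontalSection p v)
    ((χ p).symm y) hys
  -- `η [X, Y] = -2 dη(X, Y)` for sections of `HM`
  have key : ∀ X Y : (x : M) → P.H x, SmoothVectorFieldOn (fun x => (X x).1) (χ p).source →
      SmoothVectorFieldOn (fun x => (Y x).1) (χ p).source →
      P.form ((χ p).symm y) (VectorField.mlieBracket 𝓘(ℝ, E) (fun x => (X x).1)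
        (fun x => (Y x).1) ((χ p).symm y)) =
      -2 * P.coordDeta p y (coordField (fun x => (X x).1) p y)
        (coordField (fun x => (Y x).1) p y) := by
    intro X Y hX hY
    have hker : ∀ Z : (x : M) → P.H x, ∀ᶠ z in 𝓝 y,
        P.coordEta p z (coordField (fun x => (Z x).1) p z) = 0 := by
      intro Z
      filter_upwards [(isOpen_target p).eventually_mem hy] with z hz
      rw [coordEta_apply, frame_coordField hz]
      exact (Z _).2
    have hd : ∀ Z : (x : M) → P.H x, SmoothVectorFieldOn (fun x => (Z x).1) (χ p).source →
        DifferentiableAt ℝ (coordField (fun x => (Z x).1) p) y := fun Z hZ =>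
      ((contDiffOn_coordField_of_source hZ).contDiffAt
        ((isOpen_target p).mem_nhds hy)).differentiableAt (by simp)
    have h1 := form_bracket_of_ker ((contDiffAt_coordEta (P := P) hy).differentiableAt (by simp))
      (hd X hX) (hd Y hY) (hker X) (hker Y)
    rw [← coframe_mlieBracket (isOpen_chartSource p) hX hY hy hys, coordEta_apply] at h1
    refine (congrArg (P.form ((χ p).symm y)) (frame_coframe hy _).symm).trans ?_
    rw [coordDeta_apply]
    exact h1
  have h1 := key _ _ (smooth_horizontalSection p u) (smooth_horizontalSection p v)
  have h2 := key _ _ (smooth_J_horizontalSection p u) (smooth_J_horizontalSection p v)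
  rw [coordField_J_horizontalSection hy, coordField_J_horizontalSection hy] at h2
  rw [coordField_horizontalSection hy, coordField_horizontalSection hy] at h1
  simp only [map_sub, map_smul, sub_apply, smul_apply, coordDeta_coordReeb hy,
    coordDeta_coordReeb_right hy, smul_zero, sub_zero] at h1
  have h3 := (map_sub (P.form ((χ p).symm y)) _ _).symm.trans hb
  linarith [h1.symm.trans (sub_eq_zero.1 h3 |>.trans h2)]

/-- The metric is symmetric because `dη` is `φ`-invariant. -/
theorem coordG_symm {p : M} {y : E} (hy : y ∈ (χ p).target) (u v : E) :
    P.coordG p y u v = P.coordG p y v u := by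
  have h := coordDeta_coordPhi_coordPhi (P := P) hy u (P.coordPhi p y v)
  rw [coordPhi_coordPhi hy, map_add, map_neg, map_smul, coordDeta_coordReeb_right hy, smul_zero,
    add_zero, ← coordDeta_swap] at h
  rw [coordG_apply, coordG_apply, ← h]
  ring

theorem coordG_coordReeb {p : M} {y : E} (hy : y ∈ (χ p).target) (u : E) :
    P.coordG p y (P.coordReeb p y) u = P.coordEta p y u := by
  rw [coordG_apply, coordEta_coordReeb hy, coordDeta_coordReeb hy]; ring

theorem coordG_coordReeb_right {p : M} {y : E} (hy : y ∈ (χ p).target) (u : E) :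
    P.coordG p y u (P.coordReeb p y) = P.coordEta p y u := by
  rw [coordG_symm hy, coordG_coordReeb hy]

theorem coordG_pos {p : M} {y : E} (hy : y ∈ (χ p).target) {u : E} (hu : u ≠ 0) :
    0 < P.coordG p y u u := by
  set w := u - P.coordEta p y u • P.coordReeb p y with hw
  have hηw : P.coordEta p y w = 0 := by
    rw [hw, map_sub, map_smul, coordEta_coordReeb hy]; simp
  have h1 : P.coordDeta p y u (P.coordPhi p y u) = P.coordDeta p y w (P.coordPhi p y w) := by
    rw [hw]
    simp only [map_sub, map_smul, sub_apply, smul_apply, coordDeta_coordReeb hy,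
      coordPhi_coordReeb hy, smul_zero, sub_zero]
  rw [coordG_apply, h1]
  by_cases hw0 : w = 0
  · have hne : P.coordEta p y u ≠ 0 := fun h0 => hu (by
      rw [h0, zero_smul, sub_zero] at hw
      exact hw ▸ hw0)
    rw [hw0]
    simp
    exact hne
  · have := coordDeta_coordPhi_neg hy hηw hw0
    nlinarith [mul_self_nonneg (P.coordEta p y u)]

theorem coordG_nondegenerate {p : M} {y : E} (hy : y ∈ (χ p).target) (u : E)
    (hu : P.coordG p y u = 0) : u = 0 := by
  by_contra hne
  have := coordG_pos (P := P) hy hne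
  rw [hu] at this
  simp at this

theorem coordG_isInvertible {p : M} {y : E} (hy : y ∈ (χ p).target) :
    (P.coordG p y).IsInvertible := by
  obtain ⟨e, he⟩ := exists_equiv_of_injective (coordG_nondegenerate (P := P) hy)
  exact ⟨e, he⟩

theorem webster_frame {p : M} {y : E} (hy : y ∈ (χ p).target) (u v : E) :
    P.webster ((χ p).symm y) (frame E p y u) (frame E p y v) = P.coordG p y u v := by
  rw [coordG_apply, ← extDer_frame hy, frame_coordPhi hy, coordEta_apply, coordEta_apply]
  refine (P.webster_apply _ _ _).trans ?_
  change -extDer P.η _ _ (P.endo _ _) + P.form _ _ * P.form _ _ = _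
  ring

/-- The Reeb field preserves the contact form. -/
theorem lieDeriv_coordEta {p : M} {y : E} (hy : y ∈ (χ p).target) (v : E) :
    fderiv ℝ (P.coordEta p) y (P.coordReeb p y) v +
      P.coordEta p y (fderiv ℝ (P.coordReeb p) y v) = 0 := by
  refine lieDeriv_form_eq_zero ((contDiffAt_coordEta hy).differentiableAt (by simp))
    ((contDiffAt_coordReeb hy).differentiableAt (by simp)) ?_ (fun w => ?_) v
  · filter_upwards [(isOpen_target p).eventually_mem hy] with z hz using coordEta_coordReeb hz
  · have := coordDeta_coordReeb (P := P) hy w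
    rw [coordDeta_apply, flatExtDer] at this
    linarith

/-- The Sasakian condition in coordinates: the Reeb field preserves `φ`. -/
theorem IsSasakian.lieDeriv_coordPhi (hP : P.IsSasakian) {p : M} {y : E} (hy : y ∈ (χ p).target)
    (u : E) : fderiv ℝ (P.coordPhi p) y (P.coordReeb p y) u =
      fderiv ℝ (P.coordReeb p) y (P.coordPhi p y u) -
        P.coordPhi p y (fderiv ℝ (P.coordReeb p) y u) := by
  have : CompleteSpace E := FiniteDimensional.complete ℝ E
  have hys : (χ p).symm y ∈ (χ p).source := (χ p).map_target hy
  let X : (x : M) → TangentSpace 𝓘(ℝ, E) x := fun x => frame E p (χ p x) u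
  have hX : ∀ z ∈ (χ p).target, coordField X p z = u := fun z hz => by
    apply frame_injective hz
    rw [frame_coordField hz]
    change frame E p (χ p ((χ p).symm z)) u = _
    rw [(χ p).right_inv hz]
  have hφX : ∀ z ∈ (χ p).target, coordField (fun x => P.φ x (X x)) p z = P.coordPhi p z u := by
    intro z hz
    apply frame_injective hz
    rw [frame_coordField hz, frame_coordPhi hz]
    change P.endo ((χ p).symm z) (frame E p (χ p ((χ p).symm z)) u) = _
    rw [(χ p).right_inv hz]
  have hXs : SmoothVectorFieldOn X (χ p).source :=
    smoothOn_source_of_coordField (contDiffOn_const.congr hX)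
  have hφXs : SmoothVectorFieldOn (fun x => P.φ x (X x)) (χ p).source :=
    smoothOn_source_of_coordField
      (((contDiffOn_coordPhi p).clm_apply contDiffOn_const).congr hφX)
  have hξs : SmoothVectorFieldOn P.ξ (χ p).source := smooth_reeb.mono (subset_univ _)
  have h0 := hP _ X (isOpen_chartSource p) hXs _ hys
  have ho := (isOpen_target p).eventually_mem hy
  have h1 := coframe_mlieBracket (isOpen_chartSource p) hξs hXs hy hys
  have h2 := coframe_mlieBracket (isOpen_chartSource p) hξs hφXs hy hys
  rw [Filter.EventuallyEq.fderiv_eq (ho.mono hX), hX y hy] at h1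
  rw [Filter.EventuallyEq.fderiv_eq (ho.mono hφX), hφX y hy] at h2
  have h3 := ((((contDiffOn_coordPhi (P := P) p).contDiffAt
    ((isOpen_target p).mem_nhds hy)).differentiableAt (by simp)).hasFDerivAt.clm_apply
      (hasFDerivAt_const u y)).fderiv
  rw [h3] at h2
  simp at h1 h2
  -- `[ξ, φ X] = φ [ξ, X]` for the field `X` with constant coordinates `u`
  have h4 := (smul_eq_zero.1 h0).resolve_left (by norm_num)
  have h5 : coframe E p ((χ p).symm y) (VectorField.mlieBracket 𝓘(ℝ, E) P.ξ
      (fun x => P.φ x (X x)) ((χ p).symm y)) = P.coordPhi p y (coframe E p ((χ p).symm y)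
        (VectorField.mlieBracket 𝓘(ℝ, E) P.ξ X ((χ p).symm y))) := by
    apply frame_injective hy
    refine (frame_coframe hy _).trans ((sub_eq_zero.1 h4).trans ?_)
    rw [frame_coordPhi hy]
    exact (congrArg (P.endo ((χ p).symm y)) (frame_coframe hy _)).symm
  have h6 := h2.symm.trans (h5.trans (congrArg _ h1))
  rw [map_neg] at h6
  change fderiv ℝ (P.coordPhi p) y (P.coordReeb p y) u -
    fderiv ℝ (P.coordReeb p) y (P.coordPhi p y u) =
      -P.coordPhi p y (fderiv ℝ (P.coordReeb p) y u) at h6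
  rw [sub_eq_iff_eq_add.1 h6]
  abel

/-- On a Sasakian manifold the Reeb field is a Killing field, since it preserves `η`, hence `dη`,
and `φ`. -/
theorem IsSasakian.killingAt_coordReeb (hP : P.IsSasakian) {p : M} {y : E}
    (hy : y ∈ (χ p).target) : KillingAt (P.coordG p) (P.coordReeb p) y := by
  intro u v
  have two : (2 : WithTop ℕ∞) ≤ ∞ := ENat.LEInfty.out
  have hη := contDiffAt_coordEta (P := P) hy
  have hη1 := (hη.differentiableAt (by simp)).hasFDerivAt
  have hη2 := ((hη.of_le two).fderiv_right (m := 1) (by norm_num)).differentiableAt (by simp)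
  have hφ1 := (((contDiffOn_coordPhi (P := P) p).contDiffAt
    ((isOpen_target p).mem_nhds hy)).differentiableAt (by simp)).hasFDerivAt
  have hd1 := (((contDiffOn_coordDeta (P := P) p).contDiffAt
    ((isOpen_target p).mem_nhds hy)).differentiableAt (by simp)).hasFDerivAt
  have hg1 := ((contDiffAt_coordG (P := P) hy).differentiableAt (by simp)).hasFDerivAt
  -- the derivative of `g = η ⊗ η - dη(·, φ ·)` along `ξ`
  have a1 : fderiv ℝ (P.coordG p) y (P.coordReeb p y) u v =
      P.coordEta p y u * fderiv ℝ (P.coordEta p) y (P.coordReeb p y) v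
      + P.coordEta p y v * fderiv ℝ (P.coordEta p) y (P.coordReeb p y) u
      - (P.coordDeta p y u (fderiv ℝ (P.coordPhi p) y (P.coordReeb p y) v)
        + fderiv ℝ (P.coordDeta p) y (P.coordReeb p y) u (P.coordPhi p y v)) := by
    have e1 := (hg1.clm_apply (hasFDerivAt_const u y)).clm_apply (hasFDerivAt_const v y)
    have e2 := ((hη1.clm_apply (hasFDerivAt_const u y)).mul
      (hη1.clm_apply (hasFDerivAt_const v y))).sub
      ((hd1.clm_apply (hasFDerivAt_const u y)).clm_apply
        (hφ1.clm_apply (hasFDerivAt_const v y)))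
    have e3 := DFunLike.congr_fun (e1.unique (e2.congr_of_eventuallyEq
      (Eventually.of_forall fun z => P.coordG_apply p z u v))) (P.coordReeb p y)
    simp at e3
    rw [e3]
  have a2 : ∀ v, fderiv ℝ (P.coordDeta p) y (P.coordReeb p y) u v =
      (1 / 2 : ℝ) * (fderiv ℝ (fderiv ℝ (P.coordEta p)) y (P.coordReeb p y) u v
        - fderiv ℝ (fderiv ℝ (P.coordEta p)) y (P.coordReeb p y) v u) := by
    intro v
    have e1 := (hd1.clm_apply (hasFDerivAt_const u y)).clm_apply (hasFDerivAt_const v y)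
    have e2 := (((hη2.hasFDerivAt.clm_apply (hasFDerivAt_const u y)).clm_apply
      (hasFDerivAt_const v y)).sub ((hη2.hasFDerivAt.clm_apply (hasFDerivAt_const v y)).clm_apply
      (hasFDerivAt_const u y))).const_mul (1 / 2 : ℝ)
    have e3 := DFunLike.congr_fun (e1.unique (e2.congr_of_eventuallyEq
      (Eventually.of_forall fun z => P.coordDeta_apply p z u v))) (P.coordReeb p y)
    simp at e3
    rw [e3]
    ring
  have a3 := lieDeriv_flatExtDer_eq_zero (hη.of_le two)
    ((contDiffAt_coordReeb (P := P) hy).of_le two) (by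
      filter_upwards [(isOpen_target p).eventually_mem hy] with z hz v using lieDeriv_coordEta hz v)
    u (P.coordPhi p y v)
  rw [← a2, ← coordDeta_apply, ← coordDeta_apply] at a3
  have a4 := lieDeriv_coordEta (P := P) hy u
  have a5 := lieDeriv_coordEta (P := P) hy v
  rw [a1, hP.lieDeriv_coordPhi hy, map_sub, coordG_apply, coordG_apply]
  rw [add_eq_zero_iff_eq_neg] at a4 a5
  rw [a4, a5]
  linarith

end PseudohermitianStructure

/-! ### Geodesics of the Webster metric -/

namespace PseudohermitianStructure

variable {E : Type*} [NormedAddCommGroup E] [NormedSpace ℝ E] [FiniteDimensional ℝ E]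
  {M : Type*} [TopologicalSpace M] [ChartedSpace E M] [IsManifold 𝓘(ℝ, E) ∞ M]
  {P : PseudohermitianStructure E M}

local notation "χ" => extChartAt 𝓘(ℝ, E)

variable (E) in
/-- The velocity of a curve, on the model space. -/
def velocity (γ : ℝ → M) (t : ℝ) : E := mfderiv 𝓘(ℝ, ℝ) 𝓘(ℝ, E) γ t (1 : ℝ)

theorem velocity_eq_of_hasMFDerivAt {γ : ℝ → M} {t : ℝ} {v : TangentSpace 𝓘(ℝ, E) (γ t)}
    (h : HasMFDerivAt 𝓘(ℝ, ℝ) 𝓘(ℝ, E) γ t ((1 : ℝ →L[ℝ] ℝ).smulRight v)) :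
    velocity E γ t = v := by
  have h1 : velocity E γ t = ((1 : ℝ →L[ℝ] ℝ).smulRight (v : E)) 1 :=
    DFunLike.congr_fun h.mfderiv (1 : ℝ)
  exact h1.trans (one_smul ℝ (v : E))

theorem hasMFDerivAt_velocity {γ : ℝ → M} {t : ℝ}
    (h : MDifferentiableAt 𝓘(ℝ, ℝ) 𝓘(ℝ, E) γ t) :
    HasMFDerivAt 𝓘(ℝ, ℝ) 𝓘(ℝ, E) γ t ((1 : ℝ →L[ℝ] ℝ).smulRight
      (M₂ := TangentSpace 𝓘(ℝ, E) (γ t)) (velocity E γ t)) := by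
  refine h.hasMFDerivAt.congr_mfderiv ?_
  refine ContinuousLinearMap.ext_ring ?_
  exact (one_smul ℝ (velocity E γ t)).symm

theorem hasDerivAt_chart {γ : ℝ → M} {t : ℝ} (h : MDifferentiableAt 𝓘(ℝ, ℝ) 𝓘(ℝ, E) γ t) {p : M}
    (hp : γ t ∈ (χ p).source) :
    HasDerivAt (fun r => χ p (γ r)) (coframe E p (γ t) (velocity E γ t)) t :=
  hasDerivAt_chart_of_hasMFDerivAt hp (hasMFDerivAt_velocity h)

theorem frame_deriv_chart {γ : ℝ → M} {t : ℝ} (h : MDifferentiableAt 𝓘(ℝ, ℝ) 𝓘(ℝ, E) γ t) {p : M}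
    (hp : γ t ∈ (χ p).source) :
    frame E p (χ p (γ t)) (deriv (fun r => χ p (γ r)) t) = velocity E γ t := by
  rw [(hasDerivAt_chart h hp).deriv, frame_chart_coframe hp]

theorem velocity_comp {σ : M → M} {γ : ℝ → M} {t : ℝ}
    (h : MDifferentiableAt 𝓘(ℝ, ℝ) 𝓘(ℝ, E) γ t)
    (hσ : MDifferentiableAt 𝓘(ℝ, E) 𝓘(ℝ, E) σ (γ t)) :
    velocity E (fun r => σ (γ r)) t = differential E σ (γ t) (velocity E γ t) :=
  DFunLike.congr_fun (mfderiv_comp t hσ h) (1 : ℝ)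

theorem contDiffAt_chart_curve {γ : ℝ → M} {t : ℝ} (h : ContMDiffAt 𝓘(ℝ, ℝ) 𝓘(ℝ, E) ∞ γ t) {p : M}
    (hp : γ t ∈ (χ p).source) : ContDiffAt ℝ ∞ (fun r => χ p (γ r)) t :=
  ((contMDiffAt_chart hp).comp t h).contDiffAt

variable (P) in
/-- The metric at `x`, evaluated on vectors of the model space. -/
def metric (x : M) (u v : E) : ℝ := P.webster x u v

theorem metric_frame {p : M} {y : E} (hy : y ∈ (χ p).target) (u v : E) :
    P.metric ((χ p).symm y) (frame E p y u) (frame E p y v) = P.coordG p y u v :=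
  webster_frame hy u v

theorem metric_reeb (x : M) (v : E) : P.metric x v (P.reeb x) = P.form x v := by
  refine (P.webster_apply x _ _).trans ?_
  change -extDer P.η x v (P.φ x (P.ξ x)) + P.form x v * P.η x (P.ξ x) = _
  rw [P.φ_ξ, P.η_ξ, map_zero]
  simp

/-- An isometry is an isometry in coordinates. -/
theorem coordG_localRep {σ : M → M} {U : Set M} (hU : IsOpen U)
    (hσ : ContMDiffOn 𝓘(ℝ, E) 𝓘(ℝ, E) ∞ σ U) (hg : P.PreservesMetricOn σ U) {p q : M} {y : E}
    (hy : y ∈ (χ q).target) (hyU : (χ q).symm y ∈ U) (hp : σ ((χ q).symm y) ∈ (χ p).source)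
    (u v : E) : P.coordG q y u v = P.coordG p (localRep p q σ y)
      (fderiv ℝ (localRep p q σ) y u) (fderiv ℝ (localRep p q σ) y v) := by
  have hd : MDifferentiableAt 𝓘(ℝ, E) 𝓘(ℝ, E) σ ((χ q).symm y) :=
    (hσ.contMDiffAt (hU.mem_nhds hyU)).mdifferentiableAt (by simp)
  have hF : localRep p q σ y ∈ (χ p).target := (χ p).map_source hp
  have hF' : (χ p).symm (localRep p q σ y) = σ ((χ q).symm y) := (χ p).left_inv hp
  rw [← metric_frame hy, ← metric_frame hF, frame_fderiv_localRep hy hd hp,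
    frame_fderiv_localRep hy hd hp, hF']
  exact (hg _ hyU _ _).symm

theorem fderiv_localRep_surjective {σ : M → M} {U : Set M} (hU : IsOpen U)
    (hσ : ContMDiffOn 𝓘(ℝ, E) 𝓘(ℝ, E) ∞ σ U) (hg : P.PreservesMetricOn σ U) {p q : M} {y : E}
    (hy : y ∈ (χ q).target) (hyU : (χ q).symm y ∈ U) (hp : σ ((χ q).symm y) ∈ (χ p).source) :
    Function.Surjective (fderiv ℝ (localRep p q σ) y) := by
  have hinj : Function.Injective (fderiv ℝ (localRep p q σ) y) := by
    refine (injective_iff_map_eq_zero _).2 fun u hu => ?_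
    by_contra hne
    have h1 := coordG_pos (P := P) hy hne
    rw [coordG_localRep hU hσ hg hy hyU hp, hu] at h1
    simp at h1
  exact LinearMap.surjective_of_injective
    (f := (fderiv ℝ (localRep p q σ) y).toLinearMap) hinj

theorem eventually_localRep {σ : M → M} {U : Set M} (hU : IsOpen U)
    (hσ : ContMDiffOn 𝓘(ℝ, E) 𝓘(ℝ, E) ∞ σ U) {p q : M} {y : E}
    (hy : y ∈ (χ q).target) (hyU : (χ q).symm y ∈ U) (hp : σ ((χ q).symm y) ∈ (χ p).source) :
    ∀ᶠ z in 𝓝 y, z ∈ (χ q).target ∧ (χ q).symm z ∈ U ∧ σ ((χ q).symm z) ∈ (χ p).source := by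
  have h1 : ContinuousAt (fun z => σ ((χ q).symm z)) y :=
    ContinuousAt.comp (g := σ) (hσ.contMDiffAt (hU.mem_nhds hyU)).continuousAt
      (contMDiffAt_symm hy).continuousAt
  filter_upwards [eventually_symm_mem hy hU hyU,
    h1.eventually_mem ((isOpen_chartSource p).mem_nhds hp)] with z hz hz'
  exact ⟨hz.1, hz.2, hz'⟩

variable (P) in
/-- The geodesic equation for `γ` at the time `t`, in the chart at `p`. -/
def GeodesicInChart (p : M) (γ : ℝ → M) (t : ℝ) : Prop :=
  GeodesicEq (P.coordG p) (χ p (γ t)) (deriv (fun r => χ p (γ r)) t)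
    (deriv (deriv fun r => χ p (γ r)) t)

theorem geodesicInChart_iff {p : M} {γ : ℝ → M} {t : ℝ} (hp : γ t ∈ (χ p).source) :
    P.GeodesicInChart p γ t ↔ ∀ w : E,
      P.coordMetric p (deriv (deriv fun r => χ p (γ r)) t) w (χ p (γ t))
        + P.christoffel p (deriv (fun r => χ p (γ r)) t) (deriv (fun r => χ p (γ r)) t) w
          (χ p (γ t)) = 0 := by
  have hy : χ p (γ t) ∈ (χ p).target := (χ p).map_source hp
  set y := χ p (γ t)
  have h1 : ∀ u v : E, P.coordMetric p u v =ᶠ[𝓝 y] fun z => P.coordG p z u v := fun u v => by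
    filter_upwards [(isOpen_target p).eventually_mem hy] with z hz using webster_frame hz u v
  have hg := ((contDiffAt_coordG (P := P) hy).differentiableAt (by simp)).hasFDerivAt
  have h2 : ∀ u v w : E, fderiv ℝ (P.coordMetric p u v) y w = fderiv ℝ (P.coordG p) y w u v := by
    intro u v w
    rw [(h1 u v).fderiv_eq,
      ((hg.clm_apply (hasFDerivAt_const u y)).clm_apply (hasFDerivAt_const v y)).fderiv]
    simp
  refine forall_congr' fun w => ?_
  rw [christoffel, h2, h2, (h1 _ w).self_of_nhds]
  constructor <;> intro h <;> linarith

theorem isGeodesicOn_iff {γ : ℝ → M} {s : Set ℝ} :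
    P.IsGeodesicOn γ s ↔ ContMDiffOn 𝓘(ℝ, ℝ) 𝓘(ℝ, E) ∞ γ s ∧
      ∀ t ∈ s, ∀ p : M, γ t ∈ (χ p).source → P.GeodesicInChart p γ t := by
  refine and_congr Iff.rfl (forall_congr' fun t => forall_congr' fun _ => forall_congr' fun p =>
    forall_congr' fun hp => ?_)
  exact (geodesicInChart_iff (E := E) hp).symm

/-- Isometries map solutions of the geodesic equation to solutions. -/
theorem GeodesicInChart.map {σ : M → M} {U : Set M} (hU : IsOpen U)
    (hσ : ContMDiffOn 𝓘(ℝ, E) 𝓘(ℝ, E) ∞ σ U) (hg : P.PreservesMetricOn σ U) {p q : M}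
    {γ : ℝ → M} {t : ℝ} (hγ : ContMDiffAt 𝓘(ℝ, ℝ) 𝓘(ℝ, E) ∞ γ t) (hq : γ t ∈ (χ q).source)
    (hγU : γ t ∈ U) (hp : σ (γ t) ∈ (χ p).source) (h : P.GeodesicInChart q γ t) :
    P.GeodesicInChart p (fun r => σ (γ r)) t := by
  set c : ℝ → E := fun r => χ q (γ r) with hc
  set F : E → E := localRep p q σ with hF
  have two : (2 : WithTop ℕ∞) ≤ ∞ := ENat.LEInfty.out
  have hct : c t ∈ (χ q).target := (χ q).map_source hq
  have hsymm : (χ q).symm (c t) = γ t := (χ q).left_inv hq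
  have hcU : (χ q).symm (c t) ∈ U := hsymm ▸ hγU
  have hcp : σ ((χ q).symm (c t)) ∈ (χ p).source := by rw [hsymm]; exact hp
  have hcd : ContDiffAt ℝ ∞ c t := contDiffAt_chart_curve hγ hq
  have hFd : ContDiffAt ℝ ∞ F (c t) :=
    contDiffAt_localRep hct (hσ.contMDiffAt (hU.mem_nhds hcU)) hcp
  have hF2 : ContDiffAt ℝ 2 F (c t) := hFd.of_le two
  have hev := eventually_localRep hU hσ hct hcU hcp
  have hmap := GeodesicEq.map hF2 ((contDiffAt_coordG (P := P) hct).differentiableAt (by simp))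
    ((contDiffAt_coordG (P := P) ((χ p).map_source hcp)).differentiableAt (by simp))
    (hev.mono fun z hz => coordG_localRep hU hσ hg hz.1 hz.2.1 hz.2.2)
    (fun u v => coordG_symm ((χ p).map_source hcp) u v)
    (fderiv_localRep_surjective hU hσ hg hct hcU hcp) h
  -- the image curve in coordinates
  have hcomp : (fun r => χ p (σ (γ r))) =ᶠ[𝓝 t] fun r => F (c r) := by
    filter_upwards [hγ.continuousAt.eventually_mem ((isOpen_chartSource (E := E) q).mem_nhds hq)]
      with r hr
    change _ = χ p (σ ((χ q).symm (χ q (γ r))))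
    rw [(χ q).left_inv hr]
  have hc2 : ContDiffAt ℝ 2 c t := hcd.of_le two
  have hd1 : ∀ᶠ r in 𝓝 t, HasDerivAt (fun r => F (c r)) (fderiv ℝ F (c r) (deriv c r)) r := by
    have h1 : ∀ᶠ r in 𝓝 t, DifferentiableAt ℝ c r :=
      (hc2.eventually (by simp)).mono fun r hr => hr.differentiableAt (by simp)
    have h2 : ∀ᶠ r in 𝓝 t, DifferentiableAt ℝ F (c r) :=
      hcd.continuousAt.eventually ((hF2.eventually (by simp)).mono fun z hz =>
        hz.differentiableAt (by simp))
    filter_upwards [h1, h2] with r hr1 hr2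
    exact HasFDerivAt.comp_hasDerivAt (f := c) r hr2.hasFDerivAt hr1.hasDerivAt
  have hd2 : HasDerivAt (fun r => fderiv ℝ F (c r) (deriv c r))
      (fderiv ℝ (fderiv ℝ F) (c t) (deriv c t) (deriv c t)
        + fderiv ℝ F (c t) (deriv (deriv c) t)) t := by
    have h1 := ((hF2.fderiv_right (m := 1) (by norm_num)).differentiableAt (by simp)).hasFDerivAt
    have h2 := (hc2.differentiableAt (by simp)).hasDerivAt
    have h3 : HasDerivAt (fun r => fderiv ℝ F (c r))
        (fderiv ℝ (fderiv ℝ F) (c t) (deriv c t)) t :=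
      HasFDerivAt.comp_hasDerivAt (f := c) t h1 h2
    have h4 : DifferentiableAt ℝ (deriv c) t := by
      have h5 : ContDiffAt ℝ 1 (fderiv ℝ c) t := hc2.fderiv_right (m := 1) (by norm_num)
      have h6 := (h5.differentiableAt (by simp)).clm_apply (differentiableAt_const (1 : ℝ))
      exact h6
    exact h3.clm_apply h4.hasDerivAt
  have e1 : deriv (fun r => χ p (σ (γ r))) =ᶠ[𝓝 t] fun r => fderiv ℝ F (c r) (deriv c r) := by
    filter_upwards [hcomp.eventuallyEq_nhds, hd1] with r hr1 hr2
    rw [hr1.deriv_eq, hr2.deriv]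
  rw [GeodesicInChart, e1.deriv_eq, hd2.deriv, e1.self_of_nhds,
    show χ p (σ (γ t)) = F (c t) from hcomp.self_of_nhds]
  exact hmap

theorem preservesMetricOn_id (U : Set M) : P.PreservesMetricOn id U := fun x _ u v => by
  rw [mfderiv_id]; rfl

/-- The geodesic equation does not depend on the chart. -/
theorem GeodesicInChart.change {p q : M} {γ : ℝ → M} {t : ℝ}
    (hγ : ContMDiffAt 𝓘(ℝ, ℝ) 𝓘(ℝ, E) ∞ γ t) (hq : γ t ∈ (χ q).source) (hp : γ t ∈ (χ p).source)
    (h : P.GeodesicInChart q γ t) : P.GeodesicInChart p γ t :=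
  GeodesicInChart.map isOpen_univ contMDiff_id.contMDiffOn (preservesMetricOn_id univ) hγ hq
    (mem_univ _) hp h

theorem isGeodesicOn_of_exists {γ : ℝ → M} {s : Set ℝ} (hs : IsOpen s)
    (hγ : ContMDiffOn 𝓘(ℝ, ℝ) 𝓘(ℝ, E) ∞ γ s)
    (h : ∀ t ∈ s, ∃ p : M, γ t ∈ (χ p).source ∧ P.GeodesicInChart p γ t) : P.IsGeodesicOn γ s := by
  refine isGeodesicOn_iff.2 ⟨hγ, fun t ht p hp => ?_⟩
  obtain ⟨q, hq, hgeo⟩ := h t ht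
  exact hgeo.change (hγ.contMDiffAt (hs.mem_nhds ht)) hq hp

theorem IsGeodesicOn.contMDiffAt {γ : ℝ → M} {s : Set ℝ} (h : P.IsGeodesicOn γ s) (hs : IsOpen s)
    {t : ℝ} (ht : t ∈ s) : ContMDiffAt 𝓘(ℝ, ℝ) 𝓘(ℝ, E) ∞ γ t :=
  h.1.contMDiffAt (hs.mem_nhds ht)

theorem IsGeodesicOn.mdifferentiableAt {γ : ℝ → M} {s : Set ℝ} (h : P.IsGeodesicOn γ s)
    (hs : IsOpen s) {t : ℝ} (ht : t ∈ s) : MDifferentiableAt 𝓘(ℝ, ℝ) 𝓘(ℝ, E) γ t :=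
  (h.contMDiffAt hs ht).mdifferentiableAt (by simp)

/-- Isometries map geodesics to geodesics. -/
theorem IsGeodesicOn.map {σ : M → M} {U : Set M} (hU : IsOpen U)
    (hσ : ContMDiffOn 𝓘(ℝ, E) 𝓘(ℝ, E) ∞ σ U) (hg : P.PreservesMetricOn σ U) {γ : ℝ → M}
    {s : Set ℝ} (hs : IsOpen s) (h : P.IsGeodesicOn γ s) (hγU : ∀ t ∈ s, γ t ∈ U) :
    P.IsGeodesicOn (fun r => σ (γ r)) s := by
  refine isGeodesicOn_iff.2 ⟨hσ.comp h.1 hγU, fun t ht p hp => ?_⟩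
  exact GeodesicInChart.map hU hσ hg (h.contMDiffAt hs ht)
    (mem_extChartAt_source (I := 𝓘(ℝ, E)) (γ t))
    (hγU t ht) hp ((isGeodesicOn_iff.1 h).2 t ht _ (mem_extChartAt_source (I := 𝓘(ℝ, E)) (γ t)))

/-- Affine reparametrizations of geodesics are geodesics. -/
theorem IsGeodesicOn.comp_affine {γ : ℝ → M} {s s' : Set ℝ} (h : P.IsGeodesicOn γ s)
    (a b : ℝ) (hmaps : ∀ t ∈ s', a * t + b ∈ s) :
    P.IsGeodesicOn (fun t => γ (a * t + b)) s' := by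
  have haff : ContMDiff 𝓘(ℝ, ℝ) 𝓘(ℝ, ℝ) ∞ (fun t : ℝ => a * t + b) :=
    ((contDiff_const.mul contDiff_id).add contDiff_const).contMDiff
  refine isGeodesicOn_iff.2 ⟨h.1.comp haff.contMDiffOn hmaps, fun t ht p hp => ?_⟩
  have h0 := (isGeodesicOn_iff.1 h).2 (a * t + b) (hmaps t ht) p hp
  set c : ℝ → E := fun r => χ p (γ r) with hc
  have e1 : deriv (fun r => χ p (γ (a * r + b))) = fun r => a • deriv c (a * r + b) := by
    funext r
    have := deriv_comp_mul_left a (fun x => c (x + b)) r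
    rw [deriv_comp_add_const] at this
    exact this
  have e2 : deriv (deriv (fun r => χ p (γ (a * r + b)))) t =
      (a * a) • deriv (deriv c) (a * t + b) := by
    rw [e1, deriv_fun_const_smul_field]
    have := deriv_comp_mul_left a (fun x => deriv c (x + b)) t
    rw [deriv_comp_add_const] at this
    rw [this, smul_smul]
  intro w
  have h1 := h0 w
  rw [e2, e1]
  simp only [map_smul, smul_apply, smul_eq_mul]
  linear_combination (a * a) * h1

theorem isGeodesicOn_const (x : M) (s : Set ℝ) : P.IsGeodesicOn (fun _ => x) s := by
  refine isGeodesicOn_iff.2 ⟨contMDiffOn_const, fun t _ p _ w => ?_⟩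
  simp

theorem velocity_const (x : M) (t : ℝ) : velocity E (fun _ : ℝ => x) t = 0 :=
  DFunLike.congr_fun (mfderiv_const (I := 𝓘(ℝ, ℝ)) (I' := 𝓘(ℝ, E)) (c := x) (x := t)) (1 : ℝ)

/-- A solution of the geodesic equation in a chart is a geodesic. -/
theorem isGeodesicOn_of_chart {p : M} {c v : ℝ → E} {a b : ℝ}
    (hc : ContDiffOn ℝ ∞ c (Ioo a b))
    (h : ∀ t ∈ Ioo a b, c t ∈ (χ p).target ∧ HasDerivAt c (v t) t ∧
      HasDerivAt v (spray (P.coordG p) (c t) (v t)) t) :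
    P.IsGeodesicOn (fun t => (χ p).symm (c t)) (Ioo a b) ∧
      ∀ t ∈ Ioo a b, velocity E (fun t => (χ p).symm (c t)) t = frame E p (c t) (v t) := by
  have hsm : ContMDiffOn 𝓘(ℝ, ℝ) 𝓘(ℝ, E) ∞ (fun t => (χ p).symm (c t)) (Ioo a b) :=
    (contMDiffOn_extChartAt_symm p).comp hc.contMDiffOn fun t ht => (h t ht).1
  refine ⟨isGeodesicOn_of_exists isOpen_Ioo hsm fun t ht =>
    ⟨p, (χ p).map_target (h t ht).1, ?_⟩, fun t ht =>
      velocity_eq_of_hasMFDerivAt (hasMFDerivAt_of_hasDerivAt_chart (h t ht).1 (h t ht).2.1)⟩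
  have e0 : (fun r => χ p ((χ p).symm (c r))) =ᶠ[𝓝 t] c := by
    filter_upwards [isOpen_Ioo.eventually_mem ht] with r hr using (χ p).right_inv (h r hr).1
  have e1 : deriv (fun r => χ p ((χ p).symm (c r))) =ᶠ[𝓝 t] v := by
    filter_upwards [e0.eventuallyEq_nhds, isOpen_Ioo.eventually_mem ht] with r hr1 hr2
    rw [hr1.deriv_eq, (h r hr2).2.1.deriv]
  rw [GeodesicInChart, e1.deriv_eq, e1.self_of_nhds, (χ p).right_inv (h t ht).1,
    (h t ht).2.2.deriv]
  exact (geodesicEq_iff (coordG_isInvertible (h t ht).1)).2 rfl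

/-- A geodesic solves the spray equation in a chart. -/
theorem IsGeodesicOn.hasDerivAt_chart {γ : ℝ → M} {s : Set ℝ} (hs : IsOpen s)
    (h : P.IsGeodesicOn γ s) {t : ℝ} (ht : t ∈ s) {p : M} (hp : γ t ∈ (χ p).source) :
    HasDerivAt (fun r => χ p (γ r)) (deriv (fun r => χ p (γ r)) t) t ∧
      HasDerivAt (deriv fun r => χ p (γ r)) (spray (P.coordG p) (χ p (γ t))
        (deriv (fun r => χ p (γ r)) t)) t := by
  have hc : ContDiffAt ℝ 2 (fun r => χ p (γ r)) t :=
    (contDiffAt_chart_curve (h.contMDiffAt hs ht) hp).of_le ENat.LEInfty.out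
  refine ⟨(hc.differentiableAt (by simp)).hasDerivAt, ?_⟩
  have h5 : ContDiffAt ℝ 1 (fderiv ℝ (fun r => χ p (γ r))) t :=
    hc.fderiv_right (m := 1) (by norm_num)
  have h6 : DifferentiableAt ℝ (deriv fun r => χ p (γ r)) t :=
    (h5.differentiableAt (by simp)).clm_apply (differentiableAt_const (1 : ℝ))
  refine h6.hasDerivAt.congr_deriv ?_
  exact (geodesicEq_iff (coordG_isInvertible ((χ p).map_source hp))).1
    ((isGeodesicOn_iff.1 h).2 t ht p hp)

theorem geodesic_eqOn_of_chart {γ δ : ℝ → M} {s : Set ℝ} (hs : IsOpen s)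
    (hγ : P.IsGeodesicOn γ s) (hδ : P.IsGeodesicOn δ s) {p : M} {a b : ℝ} (hab : Ioo a b ⊆ s)
    (hγp : ∀ t ∈ Ioo a b, γ t ∈ (χ p).source) (hδp : ∀ t ∈ Ioo a b, δ t ∈ (χ p).source)
    {t₀ : ℝ} (ht₀ : t₀ ∈ Ioo a b) (h0 : γ t₀ = δ t₀)
    (h1 : deriv (fun r => χ p (γ r)) t₀ = deriv (fun r => χ p (δ r)) t₀) :
    ∀ t ∈ Ioo a b, γ t = δ t := by
  have key : ∀ {γ : ℝ → M}, P.IsGeodesicOn γ s → (∀ t ∈ Ioo a b, γ t ∈ (χ p).source) →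
      ∀ t ∈ Ioo a b, (χ p (γ t), deriv (fun r => χ p (γ r)) t) ∈ (χ p).target ×ˢ (univ : Set E) ∧
        HasDerivAt (fun t => (χ p (γ t), deriv (fun r => χ p (γ r)) t))
          ((deriv (fun r => χ p (γ r)) t), spray (P.coordG p) (χ p (γ t))
            (deriv (fun r => χ p (γ r)) t)) t := by
    intro γ hγ hγp t ht
    obtain ⟨a1, a2⟩ := hγ.hasDerivAt_chart hs (hab ht) (hγp t ht)
    exact ⟨⟨(χ p).map_source (hγp t ht), mem_univ _⟩, a1.prodMk a2⟩
  have hf : ContDiffOn ℝ 1 (fun q : E × E => (q.2, spray (P.coordG p) q.1 q.2))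
      ((χ p).target ×ˢ (univ : Set E)) :=
    (contDiff_snd.contDiffOn.prodMk (contDiffOn_spray (isOpen_target p) (contDiffOn_coordG p)
      fun y hy => coordG_isInvertible hy)).of_le (by simp)
  have := eqOn_Ioo_of_hasDerivAt ((isOpen_target p).prod isOpen_univ) hf (key hγ hγp)
    (key hδ hδp) ht₀ (by rw [h0, h1])
  intro t ht
  exact (χ p).injOn (hγp t ht) (hδp t ht) (congrArg Prod.fst (this t ht))

/-- A geodesic is determined by its position and velocity at one time. -/
theorem geodesic_eqOn [T2Space M] {γ δ : ℝ → M} {a b : ℝ} (hγ : P.IsGeodesicOn γ (Ioo a b))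
    (hδ : P.IsGeodesicOn δ (Ioo a b)) {t₀ : ℝ} (ht₀ : t₀ ∈ Ioo a b) (h0 : γ t₀ = δ t₀)
    (h1 : velocity E γ t₀ = velocity E δ t₀) : ∀ t ∈ Ioo a b, γ t = δ t := by
  have hcγ : ∀ t ∈ Ioo a b, ContinuousAt γ t := fun t ht =>
    (hγ.contMDiffAt isOpen_Ioo ht).continuousAt
  have hcδ : ∀ t ∈ Ioo a b, ContinuousAt δ t := fun t ht =>
    (hδ.contMDiffAt isOpen_Ioo ht).continuousAt
  -- a common coordinate interval near a time at which the curves meet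
  have hint : ∀ t ∈ Ioo a b, γ t = δ t → ∃ ε > 0, Ioo (t - ε) (t + ε) ⊆ Ioo a b ∧
      (∀ r ∈ Ioo (t - ε) (t + ε), γ r ∈ (χ (γ t)).source) ∧
      ∀ r ∈ Ioo (t - ε) (t + ε), δ r ∈ (χ (γ t)).source := by
    intro t ht heq
    have hm : δ t ∈ (χ (γ t)).source := by rw [← heq]; exact mem_extChartAt_source (γ t)
    have h1 := (isOpen_Ioo.eventually_mem ht).and (((hcγ t ht).eventually_mem
      ((isOpen_chartSource (E := E) (γ t)).mem_nhds
        (mem_extChartAt_source (I := 𝓘(ℝ, E)) (γ t)))).and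
      ((hcδ t ht).eventually_mem ((isOpen_chartSource (E := E) (γ t)).mem_nhds hm)))
    obtain ⟨ε, hε, h2⟩ := Metric.eventually_nhds_iff_ball.1 h1
    rw [Real.ball_eq_Ioo] at h2
    exact ⟨ε, hε, fun r hr => (h2 r hr).1, fun r hr => (h2 r hr).2.1, fun r hr => (h2 r hr).2.2⟩
  have hmem : ∀ {t ε : ℝ}, 0 < ε → t ∈ Ioo (t - ε) (t + ε) := fun hε => ⟨by linarith, by linarith⟩
  have hstart : γ =ᶠ[𝓝 t₀] δ := by
    obtain ⟨ε, hε, hsub, hs1, hs2⟩ := hint t₀ ht₀ h0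
    have hd : deriv (fun r => χ (γ t₀) (γ r)) t₀ = deriv (fun r => χ (γ t₀) (δ r)) t₀ := by
      rw [(PseudohermitianStructure.hasDerivAt_chart (hγ.mdifferentiableAt isOpen_Ioo ht₀)
          (hs1 _ (hmem hε))).deriv,
        (PseudohermitianStructure.hasDerivAt_chart (hδ.mdifferentiableAt isOpen_Ioo ht₀)
          (hs2 _ (hmem hε))).deriv, h1, h0]
    have := geodesic_eqOn_of_chart isOpen_Ioo hγ hδ hsub hs1 hs2 (hmem hε) h0 hd
    filter_upwards [isOpen_Ioo.eventually_mem (hmem hε)] with r hr using this r hr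
  refine fun t ht => (forall_mem_Ioo_of_locally (Q := fun t => γ =ᶠ[𝓝 t] δ) (fun t ht => ?_) ht₀
    hstart t ht).self_of_nhds
  by_cases heq : γ t = δ t
  · obtain ⟨ε, hε, hsub, hs1, hs2⟩ := hint t ht heq
    refine ⟨ε, hε, fun t₁ h₁ t₂ h₂ _ _ hQ => ?_⟩
    have hd : (fun r => χ (γ t) (γ r)) =ᶠ[𝓝 t₁] (fun r => χ (γ t) (δ r)) :=
      hQ.mono fun r hr => congrArg _ hr
    have := geodesic_eqOn_of_chart isOpen_Ioo hγ hδ hsub hs1 hs2 h₁ hQ.self_of_nhds hd.deriv_eq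
    filter_upwards [isOpen_Ioo.eventually_mem h₂] with r hr using this r hr
  · have hne : ∀ᶠ r in 𝓝 t, γ r ≠ δ r :=
      ((hcγ t ht).prodMk (hcδ t ht)).eventually_mem
        (isClosed_diagonal.isOpen_compl.mem_nhds heq)
    obtain ⟨ε, hε, h2⟩ := Metric.eventually_nhds_iff_ball.1 hne
    rw [Real.ball_eq_Ioo] at h2
    exact ⟨ε, hε, fun t₁ h₁ t₂ h₂ _ _ hQ => absurd hQ.self_of_nhds (h2 t₁ h₁)⟩

theorem form_velocity_eq {γ : ℝ → M} {t : ℝ} (h : MDifferentiableAt 𝓘(ℝ, ℝ) 𝓘(ℝ, E) γ t) {p : M}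
    (hp : γ t ∈ (χ p).source) : P.form (γ t) (velocity E γ t) =
      P.coordEta p (χ p (γ t)) (deriv (fun r => χ p (γ r)) t) := by
  rw [coordEta_apply, frame_deriv_chart h hp, (χ p).left_inv hp]

/-- The angle of a geodesic with the Reeb field is constant, as the Reeb field is Killing. -/
theorem IsSasakian.form_velocity_const (hP : P.IsSasakian) {γ : ℝ → M} {a b : ℝ}
    (hγ : P.IsGeodesicOn γ (Ioo a b)) {t₀ : ℝ} (ht₀ : t₀ ∈ Ioo a b) :
    ∀ t ∈ Ioo a b, P.form (γ t) (velocity E γ t) = P.form (γ t₀) (velocity E γ t₀) := by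
  have hd : ∀ t ∈ Ioo a b, HasDerivAt (fun t => P.form (γ t) (velocity E γ t)) 0 t := by
    intro t ht
    have hp : γ t ∈ (χ (γ t)).source := mem_extChartAt_source (γ t)
    set p := γ t
    have hy := (χ p).map_source hp
    obtain ⟨a1, a2⟩ := hγ.hasDerivAt_chart isOpen_Ioo ht hp
    have h1 := hasDerivAt_inner_killing (c := fun r => χ p (γ r))
      (c' := deriv fun r => χ p (γ r))
      ((contDiffAt_coordG (P := P) hy).differentiableAt (by simp))
      ((contDiffAt_coordReeb (P := P) hy).differentiableAt (by simp))
      (fun u v => coordG_symm hy u v) a1 a2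
      ((geodesicEq_iff (coordG_isInvertible hy)).2 rfl) (hP.killingAt_coordReeb hy)
    refine h1.congr_of_eventuallyEq ?_
    filter_upwards [isOpen_Ioo.eventually_mem ht,
      (hγ.contMDiffAt isOpen_Ioo ht).continuousAt.eventually_mem
        ((isOpen_chartSource p).mem_nhds hp)] with r hr hrp
    rw [form_velocity_eq (hγ.mdifferentiableAt isOpen_Ioo hr) hrp,
      coordG_coordReeb_right ((χ p).map_source hrp)]
  intro t ht
  exact isOpen_Ioo.is_const_of_deriv_eq_zero isPreconnected_Ioo
    (fun t ht => (hd t ht).differentiableAt.differentiableWithinAt)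
    (fun t ht => (hd t ht).deriv) ht ht₀

end PseudohermitianStructure

/-! ### Maps preserving the contact form -/

namespace PseudohermitianStructure

variable {E : Type*} [NormedAddCommGroup E] [NormedSpace ℝ E] [FiniteDimensional ℝ E]
  {M : Type*} [TopologicalSpace M] [ChartedSpace E M] [IsManifold 𝓘(ℝ, E) ∞ M]
  {P : PseudohermitianStructure E M}

local notation "χ" => extChartAt 𝓘(ℝ, E)

variable (P) in
/-- `σ` preserves the contact form at all points of `U`. -/
def PreservesFormOn (σ : M → M) (U : Set M) : Prop :=
  ∀ x ∈ U, ∀ v : E, P.form (σ x) (differential E σ x v) = P.form x v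

variable (P) in
/-- `σ` preserves the Reeb field at all points of `U`. -/
def PreservesReebOn (σ : M → M) (U : Set M) : Prop :=
  ∀ x ∈ U, differential E σ x (P.reeb x) = P.reeb (σ x)

theorem mdifferentiableAt_of_contMDiffOn {σ : M → M} {U : Set M} (hU : IsOpen U)
    (hσ : ContMDiffOn 𝓘(ℝ, E) 𝓘(ℝ, E) ∞ σ U) {x : M} (hx : x ∈ U) :
    MDifferentiableAt 𝓘(ℝ, E) 𝓘(ℝ, E) σ x :=
  (hσ.contMDiffAt (hU.mem_nhds hx)).mdifferentiableAt (by simp)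

theorem localRep_mem_target {σ : M → M} {p q : M} {y : E}
    (hp : σ ((χ q).symm y) ∈ (χ p).source) : localRep p q σ y ∈ (χ p).target :=
  (χ p).map_source hp

theorem symm_localRep {σ : M → M} {p q : M} {y : E}
    (hp : σ ((χ q).symm y) ∈ (χ p).source) :
    (χ p).symm (localRep p q σ y) = σ ((χ q).symm y) := (χ p).left_inv hp

theorem form_reeb (x : M) : P.form x (P.reeb x) = 1 := P.η_ξ x

theorem PreservesFormOn.coordEta {σ : M → M} {U : Set M} (hU : IsOpen U)
    (hσ : ContMDiffOn 𝓘(ℝ, E) 𝓘(ℝ, E) ∞ σ U) (h : P.PreservesFormOn σ U) {p q : M} {y : E}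
    (hy : y ∈ (χ q).target) (hyU : (χ q).symm y ∈ U) (hp : σ ((χ q).symm y) ∈ (χ p).source)
    (u : E) : P.coordEta q y u = P.coordEta p (localRep p q σ y)
      (fderiv ℝ (localRep p q σ) y u) := by
  rw [coordEta_apply, coordEta_apply,
    frame_fderiv_localRep hy (mdifferentiableAt_of_contMDiffOn hU hσ hyU) hp,
    symm_localRep hp, h _ hyU]

theorem PreservesFormOn.coordDeta {σ : M → M} {U : Set M} (hU : IsOpen U)
    (hσ : ContMDiffOn 𝓘(ℝ, E) 𝓘(ℝ, E) ∞ σ U) (h : P.PreservesFormOn σ U) {p q : M} {y : E}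
    (hy : y ∈ (χ q).target) (hyU : (χ q).symm y ∈ U) (hp : σ ((χ q).symm y) ∈ (χ p).source)
    (u v : E) : P.coordDeta q y u v = P.coordDeta p (localRep p q σ y)
      (fderiv ℝ (localRep p q σ) y u) (fderiv ℝ (localRep p q σ) y v) := by
  rw [coordDeta_apply, coordDeta_apply]
  refine flatExtDer_pullback
    ((contDiffAt_localRep hy (hσ.contMDiffAt (hU.mem_nhds hyU)) hp).of_le ENat.LEInfty.out)
    ((contDiffAt_coordEta ((χ p).map_source hp)).differentiableAt (by simp)) ?_ u v
  filter_upwards [eventually_localRep hU hσ hy hyU hp] with z hz w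
  exact h.coordEta hU hσ hz.1 hz.2.1 hz.2.2 w

/-- The Reeb vector is determined by its defining properties, in coordinates. -/
theorem eq_coordReeb {p : M} {y : E} (hy : y ∈ (χ p).target) {u : E}
    (h1 : P.coordEta p y u = 1) (h2 : ∀ v, P.coordDeta p y u v = 0) : u = P.coordReeb p y := by
  obtain ⟨e, he⟩ := coordDeta_add_isInvertible (P := P) hy
  apply e.injective
  have h3 : ∀ w, e w = P.coordDeta p y w + P.coordEta p y w • P.coordEta p y := fun w => by
    have : e w = (e : E →L[ℝ] E →L[ℝ] ℝ) w := rfl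
    rw [this, he]; rfl
  rw [h3, h3, h1, coordEta_coordReeb hy]
  congr 1
  ext v
  rw [h2, coordDeta_coordReeb hy]

/-- A local diffeomorphism which preserves the contact form preserves the Reeb field. -/
theorem PreservesFormOn.coordReeb {σ : M → M} {U : Set M} (hU : IsOpen U)
    (hσ : ContMDiffOn 𝓘(ℝ, E) 𝓘(ℝ, E) ∞ σ U) (h : P.PreservesFormOn σ U) {p q : M} {y : E}
    (hy : y ∈ (χ q).target) (hyU : (χ q).symm y ∈ U) (hp : σ ((χ q).symm y) ∈ (χ p).source)
    (hsurj : Function.Surjective (fderiv ℝ (localRep p q σ) y)) :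
    fderiv ℝ (localRep p q σ) y (P.coordReeb q y) = P.coordReeb p (localRep p q σ y) := by
  refine eq_coordReeb (localRep_mem_target hp) ?_ fun v => ?_
  · rw [← h.coordEta hU hσ hy hyU hp, coordEta_coordReeb hy]
  · obtain ⟨w, rfl⟩ := hsurj v
    rw [← h.coordDeta hU hσ hy hyU hp, coordDeta_coordReeb hy]

theorem PreservesFormOn.preservesReebOn {σ : M → M} {U : Set M} (hU : IsOpen U)
    (hσ : ContMDiffOn 𝓘(ℝ, E) 𝓘(ℝ, E) ∞ σ U) (hg : P.PreservesMetricOn σ U)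
    (h : P.PreservesFormOn σ U) : P.PreservesReebOn σ U := by
  intro x hx
  have hxs := mem_extChartAt_source (I := 𝓘(ℝ, E)) x
  have hσs := mem_extChartAt_source (I := 𝓘(ℝ, E)) (σ x)
  have hy : χ x x ∈ (χ x).target := (χ x).map_source hxs
  have hsymm : (χ x).symm (χ x x) = x := (χ x).left_inv hxs
  have hyU : (χ x).symm (χ x x) ∈ U := hsymm.symm ▸ hx
  have hp : σ ((χ x).symm (χ x x)) ∈ (χ (σ x)).source := hsymm.symm ▸ hσs
  have h1 := h.coordReeb hU hσ hy hyU hp (fderiv_localRep_surjective hU hσ hg hy hyU hp)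
  have h2 := frame_fderiv_localRep hy (mdifferentiableAt_of_contMDiffOn hU hσ hyU) hp
    (P.coordReeb x (χ x x))
  rw [h1, frame_coordReeb (localRep_mem_target hp), frame_coordReeb hy,
    symm_localRep hp, hsymm] at h2
  exact h2.symm

theorem PreservesReebOn.coordReeb {σ : M → M} {U : Set M} (hU : IsOpen U)
    (hσ : ContMDiffOn 𝓘(ℝ, E) 𝓘(ℝ, E) ∞ σ U) (h : P.PreservesReebOn σ U) {p q : M} {y : E}
    (hy : y ∈ (χ q).target) (hyU : (χ q).symm y ∈ U) (hp : σ ((χ q).symm y) ∈ (χ p).source) :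
    fderiv ℝ (localRep p q σ) y (P.coordReeb q y) = P.coordReeb p (localRep p q σ y) := by
  apply frame_injective (localRep_mem_target hp)
  rw [frame_fderiv_localRep hy (mdifferentiableAt_of_contMDiffOn hU hσ hyU) hp,
    frame_coordReeb hy, h _ hyU, frame_coordReeb (localRep_mem_target hp), symm_localRep hp]

/-- An isometric `CR` map preserves the contact form: the pullback of `η` is `f η` for a function
`f`, and comparing the Levi forms gives `f = 1` as soon as `HM ≠ 0`. -/
theorem preservesFormOn_of_isCRMapOn (hdim : 1 < Module.finrank ℝ E) {σ : M → M} {U : Set M}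
    (hU : IsOpen U) (hσ : ContMDiffOn 𝓘(ℝ, E) 𝓘(ℝ, E) ∞ σ U) (hg : P.PreservesMetricOn σ U)
    (hcr : P.IsCRMapOn σ U) : P.PreservesFormOn σ U := by
  intro x hx v
  have hxs := mem_extChartAt_source (I := 𝓘(ℝ, E)) x
  set p := σ x with hpdef
  set y : E := χ x x with hydef
  have hy : y ∈ (χ x).target := (χ x).map_source hxs
  have hsymm : (χ x).symm y = x := (χ x).left_inv hxs
  have hyU : (χ x).symm y ∈ U := hsymm.symm ▸ hx
  have hp : σ ((χ x).symm y) ∈ (χ p).source := by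
    rw [hsymm]; exact mem_extChartAt_source (I := 𝓘(ℝ, E)) (σ x)
  set F : E → E := localRep p x σ with hF
  have hFy : F y ∈ (χ p).target := (χ p).map_source hp
  have two : (2 : WithTop ℕ∞) ≤ ∞ := ENat.LEInfty.out
  have hF2 : ContDiffAt ℝ 2 F y :=
    (contDiffAt_localRep hy (hσ.contMDiffAt (hU.mem_nhds hyU)) hp).of_le two
  have hF1 := (hF2.differentiableAt (by simp)).hasFDerivAt
  have hDF := ((hF2.fderiv_right (m := 1) (by norm_num)).differentiableAt (by simp)).hasFDerivAt
  -- `DF` maps `ker η` to `ker η` and commutes with `φ` there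
  have hker : ∀ z, z ∈ (χ x).target → (χ x).symm z ∈ U → σ ((χ x).symm z) ∈ (χ p).source →
      ∀ u, P.coordEta x z u = 0 → P.coordEta p (F z) (fderiv ℝ F z u) = 0 ∧
        P.coordPhi p (F z) (fderiv ℝ F z u) = fderiv ℝ F z (P.coordPhi x z u) := by
    intro z hz hzU hzp u hu
    obtain ⟨hX, hJ⟩ := hcr _ hzU ⟨frame E x z u, hu⟩
    have hd := frame_fderiv_localRep hz (mdifferentiableAt_of_contMDiffOn hU hσ hzU) hzp
    have hFz : (χ p).symm (F z) = σ ((χ x).symm z) := (χ p).left_inv hzp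
    have hform : P.form (σ ((χ x).symm z))
        (differential E σ ((χ x).symm z) (frame E x z u)) = 0 := hX
    refine ⟨by rw [coordEta_apply, hd, hFz, hform], ?_⟩
    apply frame_injective ((χ p).map_source hzp)
    refine (frame_coordPhi (P := P) ((χ p).map_source hzp) _).trans ?_
    change P.endo ((χ p).symm (F z)) (frame E p (F z) (fderiv ℝ F z u)) =
      frame E p (F z) (fderiv ℝ F z (P.coordPhi x z u))
    rw [hd, hd, hFz, frame_coordPhi hz]
    refine (endo_of_mem (P := P) ⟨_, hX⟩).trans (hJ.trans ?_)
    exact congrArg (differential E σ ((χ x).symm z))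
      (endo_of_mem (P := P) ⟨frame E x z u, hu⟩).symm
  -- the pullback `θ` of `η` is `f η`
  let θ : E → E →L[ℝ] ℝ := fun z => (P.coordEta p (F z)).comp (fderiv ℝ F z)
  let f : E → ℝ := fun z => θ z (P.coordReeb x z)
  have hη := ((contDiffAt_coordEta (P := P) hy).differentiableAt (by simp)).hasFDerivAt
  have hη' := ((contDiffAt_coordEta (P := P) hFy).differentiableAt (by simp)).hasFDerivAt
  have hξ := ((contDiffAt_coordReeb (P := P) hy).differentiableAt (by simp)).hasFDerivAt
  have hθd : DifferentiableAt ℝ θ y :=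
    ((HasFDerivAt.comp (G := E →L[ℝ] ℝ) y hη' hF1).clm_comp hDF).differentiableAt
  have hfd : DifferentiableAt ℝ f y := (hθd.hasFDerivAt.clm_apply hξ).differentiableAt
  have hθf : θ =ᶠ[𝓝 y] fun z => f z • P.coordEta x z := by
    filter_upwards [eventually_localRep hU hσ hy hyU hp] with z hz
    ext u
    have h1 := (hker z hz.1 hz.2.1 hz.2.2 (u - P.coordEta x z u • P.coordReeb x z) (by
      rw [map_sub, map_smul, coordEta_coordReeb hz.1, smul_eq_mul, mul_one, sub_self])).1
    rw [map_sub, map_sub, map_smul, map_smul, sub_eq_zero] at h1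
    change P.coordEta p (F z) (fderiv ℝ F z u) = f z * P.coordEta x z u
    rw [h1, smul_eq_mul, mul_comm]
    rfl
  -- a nonzero vector of `HM`
  obtain ⟨u, hu0, hu⟩ : ∃ u : E, u ≠ 0 ∧ P.coordEta x y u = 0 := by
    have hne : (P.coordEta x y).toLinearMap.ker ≠ ⊥ := by
      intro hbot
      have h1 := LinearMap.finrank_le_finrank_of_injective (LinearMap.ker_eq_bot.1 hbot)
      rw [Module.finrank_self] at h1
      omega
    obtain ⟨u, hu, hu0⟩ := Submodule.exists_mem_ne_zero_of_ne_bot hne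
    exact ⟨u, hu0, hu⟩
  have hu' : P.coordEta x y (P.coordPhi x y u) = 0 := coordEta_coordPhi hy u
  -- on `HM` the exterior derivative of `f η` is `f dη`
  have hd1 : flatExtDer θ y u (P.coordPhi x y u) =
      f y * P.coordDeta x y u (P.coordPhi x y u) := by
    have h1 := (hfd.hasFDerivAt.smul hη).congr_of_eventuallyEq hθf
    rw [flatExtDer, h1.fderiv, coordDeta_apply, flatExtDer]
    simp [hu, hu']
    ring
  have hd2 : flatExtDer θ y u (P.coordPhi x y u) = P.coordDeta p (F y) (fderiv ℝ F y u)
      (fderiv ℝ F y (P.coordPhi x y u)) := by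
    rw [coordDeta_apply]
    exact flatExtDer_pullback hF2 hη'.differentiableAt (Eventually.of_forall fun z w => rfl) _ _
  obtain ⟨k1, k2⟩ := hker y hy hyU hp u hu
  have hiso := coordG_localRep hU hσ hg hy hyU hp u u
  change _ = P.coordG p (F y) (fderiv ℝ F y u) (fderiv ℝ F y u) at hiso
  rw [coordG_apply, coordG_apply, hu, k1, k2, ← hd2, hd1] at hiso
  have hneg := coordDeta_coordPhi_neg (P := P) hy hu hu0
  have hf1 : f y = 1 := by
    have : (f y - 1) * P.coordDeta x y u (P.coordPhi x y u) = 0 := by linarith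
    rcases mul_eq_zero.1 this with h | h
    · linarith
    · exact absurd h hneg.ne
  obtain ⟨w, rfl⟩ := frame_surjective hy v
  have h1 := DFunLike.congr_fun hθf.self_of_nhds w
  change P.coordEta p (F y) (fderiv ℝ F y w) = f y * P.coordEta x y w at h1
  rw [hf1, one_mul, coordEta_apply, coordEta_apply,
    frame_fderiv_localRep hy (mdifferentiableAt_of_contMDiffOn hU hσ hyU) hp,
    show (χ p).symm (F y) = σ ((χ x).symm y) from (χ p).left_inv hp] at h1
  rw [hsymm] at h1
  exact h1

/-! ### `CR`-symmetries are characteristic reflections -/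

theorem contMDiff_reeb : ContMDiff 𝓘(ℝ, E) 𝓘(ℝ, E).tangent ∞
    (fun x => (⟨x, P.ξ x⟩ : TangentBundle 𝓘(ℝ, E) M)) := fun x =>
  (smooth_reeb x (mem_univ x)).contMDiffAt univ_mem

theorem hasMFDerivAt_of_integralCurve {c : ℝ → M} {a b t : ℝ}
    (hc : IsMIntegralCurveOn (I := 𝓘(ℝ, E)) c P.ξ (Ioo a b)) (ht : t ∈ Ioo a b) :
    HasMFDerivAt 𝓘(ℝ, ℝ) 𝓘(ℝ, E) c t ((1 : ℝ →L[ℝ] ℝ).smulRight (P.ξ (c t))) :=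
  (hc t ht).hasMFDerivAt (isOpen_Ioo.mem_nhds ht)

theorem integralCurve_eqOn [T2Space M] {c c' : ℝ → M} {a b t₀ : ℝ}
    (hc : IsMIntegralCurveOn (I := 𝓘(ℝ, E)) c P.ξ (Ioo a b))
    (hc' : IsMIntegralCurveOn (I := 𝓘(ℝ, E)) c' P.ξ (Ioo a b)) (ht₀ : t₀ ∈ Ioo a b)
    (h : c t₀ = c' t₀) : EqOn c c' (Ioo a b) := by
  have := isManifold_one (E := E) (M := M)
  have : CompleteSpace E := FiniteDimensional.complete ℝ E
  exact isMIntegralCurveOn_Ioo_eqOn_of_contMDiff_boundaryless ht₀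
    (contMDiff_reeb.of_le (by simp)) hc hc' h

theorem PreservesReebOn.map_integralCurve {σ : M → M} {U : Set M} (hU : IsOpen U)
    (hσ : ContMDiffOn 𝓘(ℝ, E) 𝓘(ℝ, E) ∞ σ U) (h : P.PreservesReebOn σ U) {c : ℝ → M} {a b : ℝ}
    (hc : IsMIntegralCurveOn (I := 𝓘(ℝ, E)) c P.ξ (Ioo a b)) (hcU : ∀ t ∈ Ioo a b, c t ∈ U) :
    IsMIntegralCurveOn (I := 𝓘(ℝ, E)) (fun t => σ (c t)) P.ξ (Ioo a b) := by
  intro t ht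
  have h1 := (mdifferentiableAt_of_contMDiffOn hU hσ (hcU t ht)).hasMFDerivAt.comp t
    (hasMFDerivAt_of_integralCurve hc ht)
  refine HasMFDerivAt.hasMFDerivWithinAt (h1.congr_mfderiv ?_)
  refine ContinuousLinearMap.ext_ring ?_
  change differential E σ (c t) ((1 : ℝ) • P.reeb (c t)) = (1 : ℝ) • P.reeb (σ (c t))
  rw [one_smul, one_smul, h _ (hcU t ht)]

theorem hasDerivAt_chart_integralCurve {c : ℝ → M} {a b t : ℝ}
    (hc : IsMIntegralCurveOn (I := 𝓘(ℝ, E)) c P.ξ (Ioo a b)) (ht : t ∈ Ioo a b) {p : M}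
    (hp : c t ∈ (χ p).source) :
    HasDerivAt (fun r => χ p (c r)) (P.coordReeb p (χ p (c t))) t := by
  have h := hasDerivAt_chart_of_hasMFDerivAt hp (hasMFDerivAt_of_integralCurve hc ht)
  refine h.congr_deriv ?_
  rw [coordReeb, coordField, (χ p).left_inv hp]

/-- Near each time an integral curve stays in one chart. -/
theorem exists_chart_interval {c : ℝ → M} {a b t : ℝ} (hc : ContinuousAt c t) (ht : t ∈ Ioo a b) :
    ∃ δ > 0, Ioo (t - δ) (t + δ) ⊆ Ioo a b ∧
      ∀ r ∈ Ioo (t - δ) (t + δ), c r ∈ (χ (c t)).source := by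
  have h1 := (isOpen_Ioo.eventually_mem ht).and (hc.eventually_mem
    ((isOpen_chartSource (E := E) (c t)).mem_nhds (mem_extChartAt_source (I := 𝓘(ℝ, E)) (c t))))
  obtain ⟨ε, hε, h2⟩ := Metric.eventually_nhds_iff_ball.1 h1
  rw [Real.ball_eq_Ioo] at h2
  exact ⟨ε, hε, fun r hr => (h2 r hr).1, fun r hr => (h2 r hr).2⟩

theorem differential_eq_frame {σ : M → M} {U : Set M} (hU : IsOpen U)
    (hσ : ContMDiffOn 𝓘(ℝ, E) 𝓘(ℝ, E) ∞ σ U) {x : M} (hx : x ∈ U) (hfix : σ x = x) {p : M}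
    (hp : x ∈ (χ p).source) (u : E) :
    differential E σ x (frame E p (χ p x) u) =
      frame E p (χ p x) (fderiv ℝ (localRep p p σ) (χ p x) u) := by
  have hsymm : (χ p).symm (χ p x) = x := (χ p).left_inv hp
  have h := frame_fderiv_localRep (p := p) (σ := σ) ((χ p).map_source hp)
    (by rw [hsymm]; exact mdifferentiableAt_of_contMDiffOn hU hσ hx)
    (by rw [hsymm, hfix]; exact hp) u
  rw [hsymm, show localRep p p σ (χ p x) = χ p x by rw [localRep, hsymm, hfix]] at h
  exact h.symm

/-- If a map preserves `η` and `ξ`, fixes an integral curve `c` of `ξ` pointwise, and reflects the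
tangent space at one point of `c`, then it does so along `c`. -/
theorem differential_eq_reflection {σ : M → M} {U : Set M} (hU : IsOpen U)
    (hσ : ContMDiffOn 𝓘(ℝ, E) 𝓘(ℝ, E) ∞ σ U) (hξ : P.PreservesReebOn σ U) {c : ℝ → M} {a b : ℝ}
    (hc : IsMIntegralCurveOn (I := 𝓘(ℝ, E)) c P.ξ (Ioo a b)) (hcU : ∀ t ∈ Ioo a b, c t ∈ U)
    (hfix : ∀ t ∈ Ioo a b, σ (c t) = c t) {t₀ : ℝ} (ht₀ : t₀ ∈ Ioo a b)
    (h₀ : ∀ v, differential E σ (c t₀) v = -v + (2 * P.form (c t₀) v) • P.reeb (c t₀)) :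
    ∀ t ∈ Ioo a b, ∀ v,
      differential E σ (c t) v = -v + (2 * P.form (c t) v) • P.reeb (c t) := by
  refine forall_mem_Ioo_of_locally (fun t ht => ?_) ht₀ h₀
  have two : (2 : WithTop ℕ∞) ≤ ∞ := ENat.LEInfty.out
  have hcont : ∀ t ∈ Ioo a b, ContinuousAt c t := fun t ht =>
    (hasMFDerivAt_of_integralCurve hc ht).continuousAt
  obtain ⟨δ, hδ, hsub, hsrc⟩ := exists_chart_interval (E := E) (hcont t ht) ht
  refine ⟨δ, hδ, fun t₁ h₁ t₂ h₂ _ _ hQ => ?_⟩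
  set p := c t
  have htgt : ∀ r ∈ Ioo (t - δ) (t + δ), χ p (c r) ∈ (χ p).target := fun r hr =>
    (χ p).map_source (hsrc r hr)
  have hsymm : ∀ r ∈ Ioo (t - δ) (t + δ), (χ p).symm (χ p (c r)) = c r := fun r hr =>
    (χ p).left_inv (hsrc r hr)
  have hU' : ∀ r ∈ Ioo (t - δ) (t + δ), (χ p).symm (χ p (c r)) ∈ U := fun r hr => by
    rw [hsymm r hr]; exact hcU r (hsub hr)
  have hp' : ∀ r ∈ Ioo (t - δ) (t + δ), σ ((χ p).symm (χ p (c r))) ∈ (χ p).source := fun r hr => by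
    rw [hsymm r hr, hfix r (hsub hr)]; exact hsrc r hr
  -- the claim in coordinates
  have hiff : ∀ r ∈ Ioo (t - δ) (t + δ), (∀ v, differential E σ (c r) v =
      -v + (2 * P.form (c r) v) • P.reeb (c r)) ↔ ∀ v, fderiv ℝ (localRep p p σ) (χ p (c r)) v =
        -v + (2 * P.coordEta p (χ p (c r)) v) • P.coordReeb p (χ p (c r)) := by
    intro r hr
    have e1 : ∀ v, frame E p (χ p (c r)) (-v + (2 * P.coordEta p (χ p (c r)) v) •
        P.coordReeb p (χ p (c r))) = -frame E p (χ p (c r)) v +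
          (2 * P.form (c r) (frame E p (χ p (c r)) v)) • P.reeb (c r) := by
      intro v
      rw [map_add, map_neg, map_smul, frame_coordReeb (htgt r hr), coordEta_apply, hsymm r hr]
    have e2 := differential_eq_frame hU hσ (hcU r (hsub hr)) (hfix r (hsub hr)) (hsrc r hr)
    constructor
    · intro h v
      apply frame_injective (htgt r hr)
      rw [e1, ← e2, h]
    · intro h v
      obtain ⟨w, rfl⟩ := frame_surjective (htgt r hr) v
      rw [e2, h, e1]
  rw [hiff t₂ h₂]
  refine fderiv_eq_reflection_of_integralCurve (F := localRep p p σ) (ξ := P.coordReeb p)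
    (η := P.coordEta p) (c := fun r => χ p (c r)) (a := t - δ) (b := t + δ)
    (fun r hr => (contDiffAt_coordReeb (htgt r hr)).of_le (by simp))
    (fun r hr => (contDiffAt_coordEta (htgt r hr)).differentiableAt (by simp))
    (fun r hr => (contDiffAt_localRep (htgt r hr)
      (hσ.contMDiffAt (hU.mem_nhds (hU' r hr))) (hp' r hr)).of_le two)
    (fun r hr => ?_) (fun r hr => hasDerivAt_chart_integralCurve hc (hsub hr) (hsrc r hr))
    (fun r hr => ?_) (fun r hr v => lieDeriv_coordEta (htgt r hr) v) h₁ ((hiff t₁ h₁).1 hQ) t₂ h₂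
  · change χ p (σ ((χ p).symm (χ p (c r)))) = χ p (c r)
    rw [hsymm r hr, hfix r (hsub hr)]
  · filter_upwards [eventually_localRep hU hσ (htgt r hr) (hU' r hr) (hp' r hr)] with z hz
    exact (hξ.coordReeb hU hσ hz.1 hz.2.1 hz.2.2).symm

theorem ReflectsAt.fix {σ : M → M} {x : M} (h : P.ReflectsAt σ x) : σ x = x :=
  congrArg (fun z : TangentBundle 𝓘(ℝ, E) M => z.1) (h 0)

theorem ReflectsAt.differential {σ : M → M} {x : M} (h : P.ReflectsAt σ x) {v : E}
    (hv : P.form x v = 0) : differential E σ x v = -v :=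
  congrArg (fun z : TangentBundle 𝓘(ℝ, E) M => (z.2 : E)) (h ⟨v, hv⟩)

theorem reflectsAt_of_differential {σ : M → M} {x : M} (hfix : σ x = x)
    (h : ∀ v, P.form x v = 0 → CRGeometry.differential E σ x v = -v) : P.ReflectsAt σ x := by
  intro X
  refine Bundle.TotalSpace.ext hfix ?_
  exact heq_of_eq (h X.1 X.2)

theorem velocity_comp_affine {γ : ℝ → M} {t a b : ℝ}
    (h : MDifferentiableAt 𝓘(ℝ, ℝ) 𝓘(ℝ, E) γ (a * t + b)) :
    velocity E (fun r => γ (a * r + b)) t = a • velocity E γ (a * t + b) := by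
  have h1 : HasDerivAt (fun r : ℝ => a * r + b) a t := by
    simpa using ((hasDerivAt_id t).const_mul a).add_const b
  have h2 := (hasMFDerivAt_velocity h).comp t h1.hasFDerivAt.hasMFDerivAt
  have h3 : velocity E (fun r => γ (a * r + b)) t = ((1 : ℝ) • a) • velocity E γ (a * t + b) :=
    DFunLike.congr_fun h2.mfderiv (1 : ℝ)
  rw [h3, one_smul]

/-- A local `CR`-symmetry is a characteristic reflection. -/
theorem isCharacteristicReflectionOn_of_isCRMapOn [T2Space M] (hdim : 1 < Module.finrank ℝ E)
    {σ : M → M} {U : Set M} (hU : IsOpen U) (hσ : ContMDiffOn 𝓘(ℝ, E) 𝓘(ℝ, E) ∞ σ U)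
    (hg : P.PreservesMetricOn σ U) (hcr : P.IsCRMapOn σ U) {x : M}
    (hx : P.ReflectsAt σ x) : P.IsCharacteristicReflectionOn x σ U := by
  intro c a b ha hb hc0 hc hcU τ hτ γ ε hε hγ0 hγ hγU hperp t ht
  have h0 : (0 : ℝ) ∈ Ioo a b := ⟨ha, hb⟩
  have hη := preservesFormOn_of_isCRMapOn hdim hU hσ hg hcr
  have hξ := hη.preservesReebOn hU hσ hg
  have hxU : x ∈ U := hc0 ▸ hcU 0 h0
  have hfix : ∀ t ∈ Ioo a b, σ (c t) = c t := fun t ht =>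
    integralCurve_eqOn (hξ.map_integralCurve hU hσ hc hcU) hc h0
      (by rw [hc0, hx.fix]) ht
  have hrefl := differential_eq_reflection hU hσ hξ hc hcU hfix h0 (fun v => by
    rw [hc0]
    have h1 := hx.differential (v := v - P.form x v • P.reeb x) (by
      rw [map_sub, map_smul, form_reeb, smul_eq_mul, mul_one, sub_self])
    rw [map_sub, map_smul, hξ x hxU, hx.fix, sub_eq_iff_eq_add] at h1
    rw [h1]
    module) τ hτ
  have ht0 : (0 : ℝ) ∈ Ioo (-ε) ε := ⟨by linarith, hε⟩
  have hγd := hγ.mdifferentiableAt isOpen_Ioo ht0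
  have hhor : P.form (γ 0) (velocity E γ 0) = 0 := by
    rw [← metric_reeb]; exact hperp
  have hrev := hγ.comp_affine (s' := Ioo (-ε) ε) (-1) 0 (fun t ht =>
    ⟨by linarith [ht.2], by linarith [ht.1]⟩)
  have hv : velocity E (fun r => σ (γ r)) 0 = velocity E (fun t => γ (-1 * t + 0)) 0 := by
    rw [velocity_comp hγd (mdifferentiableAt_of_contMDiffOn hU hσ (hγU 0 ht0)),
      velocity_comp_affine (by simpa using hγd), hγ0, hrefl, ← hγ0, hhor]
    simp
  have := geodesic_eqOn (hγ.map hU hσ hg isOpen_Ioo hγU) hrev ht0 (by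
    simp [hγ0, hfix τ hτ]) hv t ht
  simpa using this

end PseudohermitianStructure

/-! ### Characteristic reflections are `CR`-symmetries -/

/-- A vector field which an isometry maps to a Killing field is a Killing field. -/
theorem KillingAt.of_map {E : Type*} [NormedAddCommGroup E] [NormedSpace ℝ E]
    {g g' : E → E →L[ℝ] E →L[ℝ] ℝ} {F : E → E} {y : E}
    (hF : ContDiffAt ℝ 2 F y) (hg : DifferentiableAt ℝ g y) (hg' : DifferentiableAt ℝ g' (F y))
    (h : ∀ᶠ z in 𝓝 y, ∀ u v, g z u v = g' (F z) (fderiv ℝ F z u) (fderiv ℝ F z v))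
    {X X' : E → E} (hX : DifferentiableAt ℝ X y) (hX' : DifferentiableAt ℝ X' (F y))
    (hXX' : ∀ᶠ z in 𝓝 y, X' (F z) = fderiv ℝ F z (X z))
    (hK : KillingAt g' X' (F y)) : KillingAt g X y := by
  have hF1 := (hF.differentiableAt (by simp)).hasFDerivAt
  have hF2 := ((hF.fderiv_right (m := 1) (by norm_num)).differentiableAt (by simp)).hasFDerivAt
  have hs : ∀ u v, fderiv ℝ (fderiv ℝ F) y u v = fderiv ℝ (fderiv ℝ F) y v u := fun u v =>
    (hF.isSymmSndFDerivAt (by simp)).eq u v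
  have h1 := ((hX'.hasFDerivAt.comp y hF1).congr_of_eventuallyEq
    (hXX'.mono fun z hz => hz.symm)).unique (hF2.clm_apply hX.hasFDerivAt)
  have h2 : ∀ u, fderiv ℝ X' (F y) (fderiv ℝ F y u) =
      fderiv ℝ (fderiv ℝ F) y (X y) u + fderiv ℝ F y (fderiv ℝ X y u) := by
    intro u
    have := DFunLike.congr_fun h1 u
    simp at this
    rw [this, hs u (X y)]; abel
  intro u v
  have h0 := hK (fderiv ℝ F y u) (fderiv ℝ F y v)
  rw [fderiv_metric_pullback hF hg hg' h, h.self_of_nhds, h.self_of_nhds]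
  rw [h2, h2, hXX'.self_of_nhds, map_add, map_add, add_apply] at h0
  linarith

/-- A Killing field `K` which vanishes at a point, and whose dual one-form is closed there, has
vanishing derivative there. -/
theorem KillingAt.fderiv_eq_zero {E : Type*} [NormedAddCommGroup E] [NormedSpace ℝ E]
    {g : E → E →L[ℝ] E →L[ℝ] ℝ} {K : E → E} {κ : E → E →L[ℝ] ℝ} {y : E}
    (hg : DifferentiableAt ℝ g y) (hKd : DifferentiableAt ℝ K y)
    (hsymm : ∀ u v, g y u v = g y v u) (hnd : ∀ u, g y u = 0 → u = 0)
    (hκ : ∀ᶠ z in 𝓝 y, κ z = g z (K z)) (hK : KillingAt g K y) (h0 : K y = 0)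
    (hd : ∀ u v, flatExtDer κ y u v = 0) : fderiv ℝ K y = 0 := by
  have h1 := (hg.hasFDerivAt.clm_apply hKd.hasFDerivAt).congr_of_eventuallyEq hκ
  have h2 : ∀ u v, fderiv ℝ κ y u v = g y (fderiv ℝ K y u) v := by
    intro u v
    rw [h1.fderiv]
    simp [h0]
  ext u
  refine hnd _ (ContinuousLinearMap.ext fun v => ?_)
  have e1 := hd u v
  have e2 := hK u v
  rw [flatExtDer, h2, h2] at e1
  rw [h0, map_zero, hsymm u] at e2
  simp at e2 ⊢
  linarith

namespace PseudohermitianStructure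

variable {E : Type*} [NormedAddCommGroup E] [NormedSpace ℝ E] [FiniteDimensional ℝ E]
  {M : Type*} [TopologicalSpace M] [ChartedSpace E M] [IsManifold 𝓘(ℝ, E) ∞ M]
  {P : PseudohermitianStructure E M}

local notation "χ" => extChartAt 𝓘(ℝ, E)

/-- An isometry which preserves the contact form commutes with `φ`. -/
theorem PreservesFormOn.endo {σ : M → M} {U : Set M} (hU : IsOpen U)
    (hσ : ContMDiffOn 𝓘(ℝ, E) 𝓘(ℝ, E) ∞ σ U) (hg : P.PreservesMetricOn σ U)
    (h : P.PreservesFormOn σ U) {x : M} (hx : x ∈ U) (v : E) :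
    P.endo (σ x) (differential E σ x v) = differential E σ x (P.endo x v) := by
  have hxs := mem_extChartAt_source (I := 𝓘(ℝ, E)) x
  have hy : χ x x ∈ (χ x).target := (χ x).map_source hxs
  have hsymm : (χ x).symm (χ x x) = x := (χ x).left_inv hxs
  set y : E := χ x x
  have hyU : (χ x).symm y ∈ U := hsymm.symm ▸ hx
  have hp : σ ((χ x).symm y) ∈ (χ (σ x)).source := by
    rw [hsymm]; exact mem_extChartAt_source (I := 𝓘(ℝ, E)) (σ x)
  have hFy := localRep_mem_target hp
  have hd := frame_fderiv_localRep hy (mdifferentiableAt_of_contMDiffOn hU hσ hyU) hp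
  set F : E → E := localRep (σ x) x σ
  obtain ⟨w, rfl⟩ : ∃ w, frame E x y w = v := frame_surjective hy v
  have key : P.coordPhi (σ x) (F y) (fderiv ℝ F y w) = fderiv ℝ F y (P.coordPhi x y w) := by
    have h1 : ∀ a b, P.coordEta x y a = P.coordEta (σ x) (F y) (fderiv ℝ F y a) ∧
        P.coordDeta x y a b = P.coordDeta (σ x) (F y) (fderiv ℝ F y a) (fderiv ℝ F y b) :=
      fun a b => ⟨h.coordEta hU hσ hy hyU hp a, h.coordDeta hU hσ hy hyU hp a b⟩
    obtain ⟨e, he⟩ := coordDeta_add_isInvertible (P := P) hFy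
    have he' : ∀ a b, e a b = P.coordDeta (σ x) (F y) a b +
        P.coordEta (σ x) (F y) a * P.coordEta (σ x) (F y) b := fun a b => by
      have : e a = (e : E →L[ℝ] E →L[ℝ] ℝ) a := rfl
      rw [this, he]; rfl
    apply e.injective
    ext b'
    obtain ⟨b, rfl⟩ := fderiv_localRep_surjective hU hσ hg hy hyU hp b'
    have hiso := coordG_localRep hU hσ hg hy hyU hp b w
    rw [coordG_apply, coordG_apply, (h1 b w).1, (h1 w w).1, (h1 b _).2] at hiso
    change _ = e (fderiv ℝ F y (P.coordPhi x y w)) (fderiv ℝ F y b)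
    rw [he', he', coordEta_coordPhi hFy, ← (h1 (P.coordPhi x y w) w).1, coordEta_coordPhi hy,
      coordDeta_swap, coordDeta_swap (u := fderiv ℝ F y (P.coordPhi x y w))]
    linarith
  have h2 := congrArg (frame E (σ x) (F y)) key
  rw [frame_coordPhi hFy, hd, hd, symm_localRep hp, frame_coordPhi hy] at h2
  rw [hsymm] at h2
  exact h2

theorem PreservesFormOn.isCRMapOn {σ : M → M} {U : Set M} (hU : IsOpen U)
    (hσ : ContMDiffOn 𝓘(ℝ, E) 𝓘(ℝ, E) ∞ σ U) (hg : P.PreservesMetricOn σ U)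
    (h : P.PreservesFormOn σ U) : P.IsCRMapOn σ U := by
  intro x hx X
  have hX : P.form (σ x) (CRGeometry.differential E σ x X.1) = 0 := (h x hx X.1).trans X.2
  refine ⟨hX, ?_⟩
  refine (endo_of_mem (P := P) (x := σ x) ⟨_, hX⟩).symm.trans ((h.endo hU hσ hg hx X.1).trans ?_)
  exact congrArg (CRGeometry.differential E σ x) (endo_of_mem X)

theorem fderiv_localRep_isInvertible {σ : M → M} {U : Set M} (hU : IsOpen U)
    (hσ : ContMDiffOn 𝓘(ℝ, E) 𝓘(ℝ, E) ∞ σ U) (hg : P.PreservesMetricOn σ U) {p q : M} {y : E}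
    (hy : y ∈ (χ q).target) (hyU : (χ q).symm y ∈ U) (hp : σ ((χ q).symm y) ∈ (χ p).source) :
    (fderiv ℝ (localRep p q σ) y).IsInvertible := by
  have h1 := fderiv_localRep_surjective hU hσ hg hy hyU hp
  have h2 : Function.Injective (fderiv ℝ (localRep p q σ) y).toLinearMap :=
    LinearMap.injective_iff_surjective.2 h1
  exact ⟨(LinearEquiv.ofBijective _ ⟨h2, h1⟩).toContinuousLinearEquiv, by ext; rfl⟩

variable (P) in
/-- The difference of the pullback of the Reeb field by `σ` and of the Reeb field, in coordinates;
it corresponds to `σ^* η - η` under the metric. -/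
def reebDefect (p q : M) (σ : M → M) (z : E) : E :=
  (fderiv ℝ (localRep p q σ) z).inverse (P.coordReeb p (localRep p q σ z)) - P.coordReeb q z

theorem fderiv_inverse_apply {σ : M → M} {U : Set M} (hU : IsOpen U)
    (hσ : ContMDiffOn 𝓘(ℝ, E) 𝓘(ℝ, E) ∞ σ U) (hg : P.PreservesMetricOn σ U) {p q : M} {y : E}
    (hy : y ∈ (χ q).target) (hyU : (χ q).symm y ∈ U) (hp : σ ((χ q).symm y) ∈ (χ p).source)
    (w : E) : fderiv ℝ (localRep p q σ) y ((fderiv ℝ (localRep p q σ) y).inverse w) = w := by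
  obtain ⟨e, he⟩ := fderiv_localRep_isInvertible hU hσ hg hy hyU hp
  rw [← he, ContinuousLinearMap.inverse_equiv]
  simp

/-- The dual one-form of the defect is `σ^* η - η`. -/
theorem coordG_reebDefect {σ : M → M} {U : Set M} (hU : IsOpen U)
    (hσ : ContMDiffOn 𝓘(ℝ, E) 𝓘(ℝ, E) ∞ σ U) (hg : P.PreservesMetricOn σ U) {p q : M} {y : E}
    (hy : y ∈ (χ q).target) (hyU : (χ q).symm y ∈ U) (hp : σ ((χ q).symm y) ∈ (χ p).source)
    (u : E) : P.coordG q y (P.reebDefect p q σ y) u =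
      P.coordEta p (localRep p q σ y) (fderiv ℝ (localRep p q σ) y u) - P.coordEta q y u := by
  rw [reebDefect, map_sub, sub_apply, coordG_coordReeb hy, coordG_localRep hU hσ hg hy hyU hp,
    fderiv_inverse_apply hU hσ hg hy hyU hp, coordG_coordReeb (localRep_mem_target hp)]

theorem reebDefect_eq_zero_iff {σ : M → M} {U : Set M} (hU : IsOpen U)
    (hσ : ContMDiffOn 𝓘(ℝ, E) 𝓘(ℝ, E) ∞ σ U) (hg : P.PreservesMetricOn σ U) {p q : M} {y : E}
    (hy : y ∈ (χ q).target) (hyU : (χ q).symm y ∈ U) (hp : σ ((χ q).symm y) ∈ (χ p).source) :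
    P.reebDefect p q σ y = 0 ↔ ∀ v, P.form (σ ((χ q).symm y))
      (differential E σ ((χ q).symm y) v) = P.form ((χ q).symm y) v := by
  have h1 : ∀ u, P.coordG q y (P.reebDefect p q σ y) u =
      P.form (σ ((χ q).symm y)) (differential E σ ((χ q).symm y) (frame E q y u)) -
        P.form ((χ q).symm y) (frame E q y u) := by
    intro u
    rw [coordG_reebDefect hU hσ hg hy hyU hp, coordEta_apply, coordEta_apply,
      frame_fderiv_localRep hy (mdifferentiableAt_of_contMDiffOn hU hσ hyU) hp, symm_localRep hp]
  constructor
  · intro h v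
    obtain ⟨u, rfl⟩ := frame_surjective hy v
    have := h1 u
    rw [h, map_zero] at this
    exact (sub_eq_zero.1 this.symm)
  · intro h
    refine coordG_nondegenerate (P := P) hy _ (ContinuousLinearMap.ext fun u => ?_)
    rw [h1, h, sub_self]
    rfl

theorem contDiffAt_reebDefect {σ : M → M} {U : Set M} (hU : IsOpen U)
    (hσ : ContMDiffOn 𝓘(ℝ, E) 𝓘(ℝ, E) ∞ σ U) (hg : P.PreservesMetricOn σ U) {p q : M} {y : E}
    (hy : y ∈ (χ q).target) (hyU : (χ q).symm y ∈ U) (hp : σ ((χ q).symm y) ∈ (χ p).source) :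
    ContDiffAt ℝ 2 (P.reebDefect p q σ) y := by
  have : CompleteSpace E := FiniteDimensional.complete ℝ E
  have hF := contDiffAt_localRep hy (hσ.contMDiffAt (hU.mem_nhds hyU)) hp
  have h1 : ContDiffAt ℝ 2 (fderiv ℝ (localRep p q σ)) y :=
    (hF.of_le (m := 3) ENat.LEInfty.out).fderiv_right (by norm_num)
  have h2 : ContDiffAt ℝ 2 (fun z => (fderiv ℝ (localRep p q σ) z).inverse) y :=
    ContDiffAt.comp y
      (fderiv_localRep_isInvertible hU hσ hg hy hyU hp).contDiffAt_map_inverse h1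
  have h3 : ContDiffAt ℝ 2 (fun z => P.coordReeb p (localRep p q σ z)) y :=
    ContDiffAt.comp (g := P.coordReeb p) y
      ((contDiffAt_coordReeb (localRep_mem_target hp)).of_le ENat.LEInfty.out)
      (hF.of_le ENat.LEInfty.out)
  exact (h2.clm_apply h3).sub ((contDiffAt_coordReeb hy).of_le ENat.LEInfty.out)

/-- Both the Reeb field and its pullback by an isometry are Killing fields. -/
theorem IsSasakian.killingAt_reebDefect (hP : P.IsSasakian) {σ : M → M} {U : Set M}
    (hU : IsOpen U) (hσ : ContMDiffOn 𝓘(ℝ, E) 𝓘(ℝ, E) ∞ σ U) (hg : P.PreservesMetricOn σ U)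
    {p q : M} {y : E} (hy : y ∈ (χ q).target) (hyU : (χ q).symm y ∈ U)
    (hp : σ ((χ q).symm y) ∈ (χ p).source) :
    KillingAt (P.coordG q) (P.reebDefect p q σ) y := by
  have hξ : DifferentiableAt ℝ (P.coordReeb q) y :=
    (contDiffAt_coordReeb hy).differentiableAt (by simp)
  have hK : DifferentiableAt ℝ (P.reebDefect p q σ) y :=
    (contDiffAt_reebDefect hU hσ hg hy hyU hp).differentiableAt (by simp)
  have hX : DifferentiableAt ℝ (fun z => (fderiv ℝ (localRep p q σ) z).inverse
      (P.coordReeb p (localRep p q σ z))) y := by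
    have := hK.add hξ
    refine this.congr_of_eventuallyEq (Eventually.of_forall fun z => ?_)
    simp [reebDefect]
  refine KillingAt.sub hX hξ ?_ (hP.killingAt_coordReeb hy)
  have hev := eventually_localRep hU hσ hy hyU hp
  refine KillingAt.of_map (g' := P.coordG p) (X' := P.coordReeb p) (F := localRep p q σ)
    ((contDiffAt_localRep hy (hσ.contMDiffAt (hU.mem_nhds hyU)) hp).of_le ENat.LEInfty.out)
    ((contDiffAt_coordG hy).differentiableAt (by simp))
    ((contDiffAt_coordG (localRep_mem_target hp)).differentiableAt (by simp))
    (hev.mono fun z hz => coordG_localRep hU hσ hg hz.1 hz.2.1 hz.2.2) hX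
    ((contDiffAt_coordReeb (localRep_mem_target hp)).differentiableAt (by simp))
    (hev.mono fun z hz => (fderiv_inverse_apply hU hσ hg hz.1 hz.2.1 hz.2.2 _).symm)
    (hP.killingAt_coordReeb (localRep_mem_target hp))

/-- Rigidity: if `σ^* ξ - ξ` vanishes to first order at a point, then `σ` preserves `η` near it. -/
theorem IsSasakian.eventually_preservesForm (hP : P.IsSasakian) {σ : M → M} {U : Set M}
    (hU : IsOpen U) (hσ : ContMDiffOn 𝓘(ℝ, E) 𝓘(ℝ, E) ∞ σ U) (hg : P.PreservesMetricOn σ U)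
    {p q : M} {y : E} (hy : y ∈ (χ q).target) (hyU : (χ q).symm y ∈ U)
    (hp : σ ((χ q).symm y) ∈ (χ p).source) (h0 : P.reebDefect p q σ y = 0)
    (h1 : fderiv ℝ (P.reebDefect p q σ) y = 0) :
    ∀ᶠ x in 𝓝 ((χ q).symm y), ∀ v, P.form (σ x) (differential E σ x v) = P.form x v := by
  have hev := eventually_localRep hU hσ hy hyU hp
  have h2 := eventually_eq_zero_of_killing (g := P.coordG q) (X := P.reebDefect p q σ) (y₀ := y)
    (hev.mono fun z hz => (contDiffAt_coordG hz.1).of_le ENat.LEInfty.out)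
    (hev.mono fun z hz => contDiffAt_reebDefect hU hσ hg hz.1 hz.2.1 hz.2.2)
    (hev.mono fun z hz => fun u v => coordG_symm hz.1 u v) (coordG_nondegenerate hy)
    (hev.mono fun z hz => hP.killingAt_reebDefect hU hσ hg hz.1 hz.2.1 hz.2.2) h0 h1
  have hxs : (χ q).symm y ∈ (χ q).source := (χ q).map_target hy
  have hc : Tendsto (χ q) (𝓝 ((χ q).symm y)) (𝓝 y) := by
    have := (contMDiffAt_chart hxs).continuousAt.tendsto
    rwa [(χ q).right_inv hy] at this
  filter_upwards [hc.eventually (h2.and hev), (isOpen_chartSource q).eventually_mem hxs]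
    with x hx hxq
  have := (reebDefect_eq_zero_iff hU hσ hg hx.2.1 hx.2.2.1 hx.2.2.2).1 hx.1
  rwa [(χ q).left_inv hxq] at this

/-- On a connected set, an isometry whose differential at one point is the reflection in `ξ`
preserves the contact form. -/
theorem IsSasakian.preservesFormOn_of_reflection (hP : P.IsSasakian) {σ : M → M} {U : Set M}
    (hU : IsOpen U) (hUc : IsPreconnected U) (hσ : ContMDiffOn 𝓘(ℝ, E) 𝓘(ℝ, E) ∞ σ U)
    (hg : P.PreservesMetricOn σ U) {x : M} (hx : x ∈ U) (hfix : σ x = x)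
    (hd : ∀ v, differential E σ x v = -v + (2 * P.form x v) • P.reeb x) :
    P.PreservesFormOn σ U := by
  have hchart : ∀ z ∈ U, χ z z ∈ (χ z).target ∧ (χ z).symm (χ z z) = z ∧
      (χ z).symm (χ z z) ∈ U ∧ σ ((χ z).symm (χ z z)) ∈ (χ (σ z)).source := by
    intro z hz
    have hzs := mem_extChartAt_source (I := 𝓘(ℝ, E)) z
    have hsymm := (χ z).left_inv hzs
    exact ⟨(χ z).map_source hzs, hsymm, hsymm.symm ▸ hz, by
      rw [hsymm]; exact mem_extChartAt_source (I := 𝓘(ℝ, E)) (σ z)⟩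
  let A : Set M := {z | ∀ᶠ w in 𝓝 z, ∀ v, P.form (σ w) (differential E σ w v) = P.form w v}
  -- the set where `σ` preserves `η` nearby is open, contains `x`, and is relatively closed
  have hAo : IsOpen A := isOpen_iff_mem_nhds.2 fun z hz => eventually_eventually_nhds.2 hz
  suffices hsub : U ⊆ A from fun z hz => (hsub hz).self_of_nhds
  refine hUc.subset_of_closure_inter_subset hAo ⟨x, hx, ?_⟩ ?_
  · obtain ⟨hy, hsymm, hyU, hp⟩ := hchart x hx
    rw [hfix] at hp
    have hform : ∀ v, P.form (σ x) (differential E σ x v) = P.form x v := by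
      intro v
      rw [hfix, hd, map_add, map_neg, map_smul, form_reeb, smul_eq_mul]
      ring
    have h0 : P.reebDefect x x σ (χ x x) = 0 := by
      rw [reebDefect_eq_zero_iff hU hσ hg hy hyU hp, hsymm]
      exact hform
    have hev := eventually_localRep hU hσ hy hyU hp
    have hF : ContDiffAt ℝ 2 (localRep x x σ) (χ x x) :=
      (contDiffAt_localRep hy (hσ.contMDiffAt (hU.mem_nhds hyU)) hp).of_le ENat.LEInfty.out
    have hF1 := (hF.differentiableAt (by simp)).hasFDerivAt
    have hF2 := ((hF.fderiv_right (m := 1) (by norm_num)).differentiableAt (by simp)).hasFDerivAt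
    have hFy : localRep x x σ (χ x x) = χ x x := by rw [localRep, hsymm, hfix]
    have hη := (contDiffAt_coordEta (P := P) hy).differentiableAt (by simp)
    have hDF : ∀ u, fderiv ℝ (localRep x x σ) (χ x x) u =
        -u + (2 * P.coordEta x (χ x x) u) • P.coordReeb x (χ x x) := by
      intro u
      apply frame_injective hy
      rw [← differential_eq_frame hU hσ hx hfix (mem_extChartAt_source (I := 𝓘(ℝ, E)) x), hd,
        map_add, map_neg, map_smul, frame_coordReeb hy, coordEta_apply, hsymm]
    -- the dual one-form of the defect is `σ^* η - η`, and `Dσ` at `x` preserves `dη`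
    let θ : E → E →L[ℝ] ℝ := fun z =>
      (P.coordEta x (localRep x x σ z)).comp (fderiv ℝ (localRep x x σ) z)
    have hθ : DifferentiableAt ℝ θ (χ x x) :=
      ((HasFDerivAt.comp (G := E →L[ℝ] ℝ) (g := P.coordEta x) (χ x x)
        (by rw [hFy]; exact hη.hasFDerivAt) hF1).clm_comp hF2).differentiableAt
    have h1 : fderiv ℝ (P.reebDefect x x σ) (χ x x) = 0 := by
      refine KillingAt.fderiv_eq_zero (g := P.coordG x)
        (κ := fun z => θ z - P.coordEta x z)
        ((contDiffAt_coordG hy).differentiableAt (by simp))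
        ((contDiffAt_reebDefect hU hσ hg hy hyU hp).differentiableAt (by simp))
        (fun u v => coordG_symm hy u v) (coordG_nondegenerate hy) ?_
        (hP.killingAt_reebDefect hU hσ hg hy hyU hp) h0 ?_
      · filter_upwards [hev] with z hz
        ext u
        exact (coordG_reebDefect hU hσ hg hz.1 hz.2.1 hz.2.2 u).symm
      · intro u v
        have e1 : flatExtDer (fun z => θ z - P.coordEta x z) (χ x x) u v =
            flatExtDer θ (χ x x) u v - flatExtDer (P.coordEta x) (χ x x) u v := by
          simp only [flatExtDer]
          rw [fderiv_fun_sub hθ hη]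
          simp only [sub_apply]
          ring
        have e2 := flatExtDer_pullback (η := θ) (η' := P.coordEta x) hF (by rw [hFy]; exact hη)
          (Eventually.of_forall fun z w => rfl) u v
        rw [e1, e2, hFy, ← coordDeta_apply, ← coordDeta_apply, hDF, hDF]
        simp only [map_add, map_neg, map_smul, add_apply, neg_apply, smul_apply,
          coordDeta_coordReeb hy, coordDeta_coordReeb_right hy]
        simp
    have := hP.eventually_preservesForm hU hσ hg hy hyU hp h0 h1
    rwa [hsymm] at this
  · rintro z ⟨hzA, hzU⟩
    obtain ⟨hy, hsymm, hyU, hp⟩ := hchart z hzU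
    have hev := eventually_localRep hU hσ hy hyU hp
    have hK := contDiffAt_reebDefect hU hσ hg hy hyU hp
    have hcont : ContinuousAt (fun y => (P.reebDefect (σ z) z σ y,
        fderiv ℝ (P.reebDefect (σ z) z σ) y)) (χ z z) :=
      hK.continuousAt.prodMk (hK.fderiv_right (m := 1) (by norm_num)).continuousAt
    -- the first-order jet of the defect vanishes near points of `A`, hence at limits of such points
    have hzero : (P.reebDefect (σ z) z σ (χ z z),
        fderiv ℝ (P.reebDefect (σ z) z σ) (χ z z)) = 0 := by
      by_contra hne
      have h1 := hcont.eventually_ne hne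
      have hzs := mem_extChartAt_source (I := 𝓘(ℝ, E)) z
      have h2 := (contMDiffAt_chart hzs).continuousAt.eventually
        (h1.and (hev.and hev.eventually_nhds))
      obtain ⟨w, hwA, ⟨hw1, hw2, hw3⟩, hw4⟩ :=
        ((mem_closure_iff_frequently.1 hzA).and_eventually
          (h2.and ((isOpen_chartSource z).eventually_mem hzs))).exists
      have hwsymm : (χ z).symm (χ z w) = w := (χ z).left_inv hw4
      have h3 : ∀ᶠ y in 𝓝 (χ z w), P.reebDefect (σ z) z σ y = 0 := by
        have h4 : Tendsto (χ z).symm (𝓝 (χ z w)) (𝓝 w) := by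
          have := (contMDiffAt_symm hw2.1).continuousAt.tendsto
          rwa [hwsymm] at this
        filter_upwards [h4.eventually hwA, hw3] with y hy1 hy2
        exact (reebDefect_eq_zero_iff hU hσ hg hy2.1 hy2.2.1 hy2.2.2).2 hy1
      refine hw1 (Prod.ext h3.self_of_nhds ?_)
      have h5 : P.reebDefect (σ z) z σ =ᶠ[𝓝 (χ z w)] fun _ => 0 := h3
      simpa using h5.fderiv_eq
    have := hP.eventually_preservesForm hU hσ hg hy hyU hp (congrArg Prod.fst hzero)
      (congrArg Prod.snd hzero)
    rwa [hsymm] at this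

/-- There is an integral curve of the Reeb field through every point of an open set. -/
theorem exists_integralCurve [T2Space M] {U : Set M} (hU : IsOpen U) {x : M} (hx : x ∈ U) :
    ∃ δ > 0, ∃ c : ℝ → M, c 0 = x ∧ IsMIntegralCurveOn (I := 𝓘(ℝ, E)) c P.ξ (Ioo (-δ) δ) ∧
      ∀ t ∈ Ioo (-δ) δ, c t ∈ U := by
  have := isManifold_one (E := E) (M := M)
  have : CompleteSpace E := FiniteDimensional.complete ℝ E
  obtain ⟨c, hc0, hc⟩ := exists_isMIntegralCurveAt_of_contMDiffAt_boundaryless (t₀ := 0)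
    ((contMDiff_reeb (P := P) x).of_le (by simp))
  have h1 := hc.continuousAt.eventually_mem (hU.mem_nhds (hc0 ▸ hx))
  obtain ⟨δ, hδ, h2⟩ := Metric.eventually_nhds_iff_ball.1 (hc.and h1)
  rw [Real.ball_eq_Ioo, zero_sub, zero_add] at h2
  exact ⟨δ, hδ, c, hc0, fun t ht => (h2 t ht).1.hasMFDerivWithinAt, fun t ht => (h2 t ht).2⟩

theorem velocity_integralCurve {c : ℝ → M} {a b t : ℝ}
    (hc : IsMIntegralCurveOn (I := 𝓘(ℝ, E)) c P.ξ (Ioo a b)) (ht : t ∈ Ioo a b) :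
    velocity E c t = P.reeb (c t) :=
  velocity_eq_of_hasMFDerivAt (hasMFDerivAt_of_integralCurve hc ht)

theorem velocity_congr {γ δ : ℝ → M} {t : ℝ} (h : γ =ᶠ[𝓝 t] δ) :
    velocity E γ t = velocity E δ t :=
  DFunLike.congr_fun (h.mfderiv_eq (I := 𝓘(ℝ, ℝ)) (I' := 𝓘(ℝ, E))) (1 : ℝ)

/-- A geodesic with a multiple of a prescribed initial velocity, inside an open set. -/
theorem exists_geodesic {U : Set M} (hU : IsOpen U) {x : M} (hx : x ∈ U) (u : E) :
    ∃ k : ℝ, k ≠ 0 ∧ ∃ ε > 0, ∃ γ : ℝ → M, γ 0 = x ∧ velocity E γ 0 = k • u ∧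
      P.IsGeodesicOn γ (Ioo (-ε) ε) ∧ ∀ t ∈ Ioo (-ε) ε, γ t ∈ U := by
  have hxs := mem_extChartAt_source (I := 𝓘(ℝ, E)) x
  have hy : χ x x ∈ (χ x).target := (χ x).map_source hxs
  have hsymm : (χ x).symm (χ x x) = x := (χ x).left_inv hxs
  obtain ⟨ε, hε, γ, γ', hγ, -, hsol⟩ := exists_exponential (isOpen_target x)
    (contDiffOn_coordG (P := P) x) (fun y hy => coordG_isInvertible hy) hy
  set w : E := coframe E x x u with hw
  obtain ⟨k, hk, hkw⟩ : ∃ k : ℝ, k ≠ 0 ∧ k • w ∈ ball (0 : E) ε := by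
    refine ⟨ε / (‖w‖ + 1), by positivity, ?_⟩
    rw [mem_ball_zero_iff, norm_smul, Real.norm_eq_abs, abs_of_pos (by positivity),
      div_mul_eq_mul_div, div_lt_iff₀ (by positivity)]
    nlinarith
  obtain ⟨h0, h0', h1⟩ := hsol _ hkw
  have hc : ContDiffOn ℝ ∞ (γ (k • w)) (Ioo (-ε) ε) :=
    hγ.comp (contDiffOn_const.prodMk contDiffOn_id) fun t ht => ⟨hkw, ht⟩
  obtain ⟨hgeo, hvel⟩ := isGeodesicOn_of_chart hc h1
  have ht0 : (0 : ℝ) ∈ Ioo (-ε) ε := ⟨by linarith, hε⟩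
  have hg0 : (χ x).symm (γ (k • w) 0) = x := by rw [h0, hsymm]
  have h2 := (hgeo.contMDiffAt isOpen_Ioo ht0).continuousAt.eventually_mem
    (hU.mem_nhds (by rw [hg0]; exact hx))
  obtain ⟨δ, hδ, h3⟩ := Metric.eventually_nhds_iff_ball.1
    (h2.and (isOpen_Ioo.eventually_mem ht0))
  rw [Real.ball_eq_Ioo, zero_sub, zero_add] at h3
  refine ⟨k, hk, δ, hδ, fun t => (χ x).symm (γ (k • w) t), hg0, ?_, ?_, fun t ht => (h3 t ht).1⟩
  · rw [hvel 0 ht0, h0, h0', map_smul, hw, frame_chart_coframe hxs]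
  · have := hgeo.comp_affine (s' := Ioo (-δ) δ) 1 0 (fun t ht => by simpa using (h3 t ht).2)
    simpa using this

/-- The characteristic reflection at `x` fixes `x` and its differential there is the reflection in
the Reeb vector. -/
theorem IsCharacteristicReflectionOn.differential [T2Space M] {σ : M → M} {U : Set M}
    (hU : IsOpen U) (hσ : ContMDiffOn 𝓘(ℝ, E) 𝓘(ℝ, E) ∞ σ U) {x : M} (hx : x ∈ U)
    (h : P.IsCharacteristicReflectionOn x σ U) :
    σ x = x ∧ ∀ v, CRGeometry.differential E σ x v = -v + (2 * P.form x v) • P.reeb x := by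
  obtain ⟨δ, hδ, c, hc0, hc, hcU⟩ := exists_integralCurve (P := P) hU hx
  have h0 : (0 : ℝ) ∈ Ioo (-δ) δ := ⟨by linarith, hδ⟩
  have hd := mdifferentiableAt_of_contMDiffOn hU hσ hx
  -- constant geodesics show that the integral curve is fixed
  have hfix : ∀ t ∈ Ioo (-δ) δ, σ (c t) = c t := by
    intro t ht
    refine h c (-δ) δ (by linarith) hδ hc0 hc hcU t ht (fun _ => c t) 1 one_pos rfl
      (isGeodesicOn_const _ _) (fun _ _ => hcU t ht) ?_ 0 ⟨by norm_num, by norm_num⟩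
    change P.metric (c t) (velocity E (fun _ => c t) 0) (P.reeb (c t)) = 0
    rw [velocity_const, metric_reeb, map_zero]
  have hfx : σ x = x := by have := hfix 0 h0; rwa [hc0] at this
  have hξ : CRGeometry.differential E σ x (P.reeb x) = P.reeb x := by
    have h1 := velocity_comp (σ := σ) (hasMFDerivAt_of_integralCurve hc h0).mdifferentiableAt
      (by rw [hc0]; exact hd)
    have h2 : (fun r => σ (c r)) =ᶠ[𝓝 0] c := by
      filter_upwards [isOpen_Ioo.eventually_mem h0] with r hr using hfix r hr
    rw [velocity_congr h2, velocity_integralCurve hc h0, hc0] at h1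
    exact h1.symm
  have hH : ∀ u, P.form x u = 0 → CRGeometry.differential E σ x u = -u := by
    intro u hu
    obtain ⟨k, hk, ε, hε, γ, hγ0, hγv, hγ, hγU⟩ := exists_geodesic (P := P) hU hx u
    have ht0 : (0 : ℝ) ∈ Ioo (-ε) ε := ⟨by linarith, hε⟩
    have hγd := hγ.mdifferentiableAt isOpen_Ioo ht0
    have h1 := h c (-δ) δ (by linarith) hδ hc0 hc hcU 0 h0 γ ε hε (hγ0.trans hc0.symm) hγ hγU (by
      change P.metric (γ 0) (velocity E γ 0) (P.reeb (γ 0)) = 0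
      rw [metric_reeb, hγ0, hγv, map_smul, hu, smul_zero])
    have h2 : (fun r => σ (γ r)) =ᶠ[𝓝 0] fun r => γ (-1 * r + 0) := by
      filter_upwards [isOpen_Ioo.eventually_mem ht0] with r hr
      rw [h1 r hr]; simp
    have h3 := velocity_congr (E := E) h2
    rw [velocity_comp hγd (by rw [hγ0]; exact hd), velocity_comp_affine (by simpa using hγd)] at h3
    simp only [mul_zero, add_zero, hγ0, hγv, map_smul] at h3
    have h4 : k • CRGeometry.differential E σ x u = k • (-u) := by rw [h3]; module
    exact smul_right_injective E hk h4
  refine ⟨hfx, fun v => ?_⟩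
  have h1 := hH (v - P.form x v • P.reeb x) (by
    rw [map_sub, map_smul, form_reeb, smul_eq_mul, mul_one, sub_self])
  rw [map_sub, map_smul, hξ, sub_eq_iff_eq_add] at h1
  rw [h1]
  module

/-- On a connected open set, an isometric characteristic reflection is a `CR`-symmetry. -/
theorem IsSasakian.isCRMapOn_of_isCharacteristicReflectionOn [T2Space M] (hP : P.IsSasakian)
    {σ : M → M} {U : Set M} (hU : IsOpen U) (hUc : IsPreconnected U)
    (hσ : ContMDiffOn 𝓘(ℝ, E) 𝓘(ℝ, E) ∞ σ U) (hg : P.PreservesMetricOn σ U) {x : M} (hx : x ∈ U)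
    (h : P.IsCharacteristicReflectionOn x σ U) : P.IsCRMapOn σ U ∧ P.ReflectsAt σ x := by
  obtain ⟨hfix, hd⟩ := h.differential hU hσ hx
  refine ⟨(hP.preservesFormOn_of_reflection hU hUc hσ hg hx hfix hd).isCRMapOn hU hσ hg,
    reflectsAt_of_differential hfix fun v hv => ?_⟩
  rw [hd, hv]
  simp

end PseudohermitianStructure

namespace PseudohermitianStructure

variable {E : Type*} [NormedAddCommGroup E] [NormedSpace ℝ E] [FiniteDimensional ℝ E]
  {M : Type*} [TopologicalSpace M] [ChartedSpace E M] [IsManifold 𝓘(ℝ, E) ∞ M]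
  {P : PseudohermitianStructure E M}

local notation "χ" => extChartAt 𝓘(ℝ, E)

/-! ### Local symmetries and characteristic reflections -/

theorem IsCharacteristicReflectionOn.mono {x : M} {s : M → M} {U V : Set M}
    (h : P.IsCharacteristicReflectionOn x s U) (hVU : V ⊆ U) :
    P.IsCharacteristicReflectionOn x s V :=
  fun c a b ha hb hc0 hc hcV τ hτ γ ε hε hγ0 hγ hγV =>
    h c a b ha hb hc0 hc (fun r hr => hVU (hcV r hr)) τ hτ γ ε hε hγ0 hγ
      fun r hr => hVU (hγV r hr)

theorem mapsTo_connectedComponentIn {X : Type*} [TopologicalSpace X] {f : X → X} {F : Set X}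
    {x : X} (hf : ContinuousOn f F) (hF : MapsTo f F F) (hx : x ∈ F) (hfx : f x = x) :
    MapsTo f (connectedComponentIn F x) (connectedComponentIn F x) := by
  have hsub := connectedComponentIn_subset F x
  have h1 : IsPreconnected (f '' connectedComponentIn F x) :=
    isPreconnected_connectedComponentIn.image f (hf.mono hsub)
  have h2 := h1.subset_connectedComponentIn (F := F)
    ⟨x, mem_connectedComponentIn hx, hfx⟩ ((image_mono hsub).trans hF.image_subset)
  exact fun y hy => h2 ⟨y, hy, rfl⟩

/-- A self-homeomorphism of an open set which fixes a point restricts to the connected component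
of that point. -/
theorem exists_restr_connectedComponentIn {X : Type*} [TopologicalSpace X]
    [LocallyConnectedSpace X] (s : OpenPartialHomeomorph X X) (hs : s.target = s.source) {x : X}
    (hx : x ∈ s.source) (hfix : s x = x) :
    ∃ s' : OpenPartialHomeomorph X X, (s' : X → X) = s ∧ (s'.symm : X → X) = s.symm ∧
      s'.source = connectedComponentIn s.source x ∧
      s'.target = connectedComponentIn s.source x := by
  set C := connectedComponentIn s.source x
  have hsub : C ⊆ s.source := connectedComponentIn_subset _ _
  have hC : IsOpen C := s.open_source.connectedComponentIn
  have h1 : MapsTo s C C := mapsTo_connectedComponentIn s.continuousOn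
    (fun y hy => hs ▸ s.map_source hy) hx hfix
  have h2 : MapsTo s.symm C C := mapsTo_connectedComponentIn (hs ▸ s.symm.continuousOn)
    (fun y hy => s.map_target (hs.symm ▸ hy)) hx
    (by conv_lhs => rw [← hfix]
        exact s.left_inv hx)
  refine ⟨s.restrOpen C hC, rfl, rfl, ?_, ?_⟩
  · rw [s.restrOpen_source, inter_eq_right.2 hsub]
  · change s.target ∩ s.symm ⁻¹' C = C
    ext y
    refine ⟨fun ⟨hy, hyC⟩ => ?_, fun hy => ⟨hs.symm ▸ hsub hy, h2 hy⟩⟩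
    rw [← s.right_inv hy]
    exact h1 hyC

/-- The local equivalence: a `CR`-symmetry is a characteristic reflection on the same domain, and
a characteristic reflection is a `CR`-symmetry on the connected component of its centre. -/
theorem IsSasakian.isLocallyCRSymmetric_iff [T2Space M] (hdim : 1 < Module.finrank ℝ E)
    (hP : P.IsSasakian) : P.IsLocallyCRSymmetric ↔ P.IsLocallyPhiSymmetric := by
  constructor
  · intro h x
    obtain ⟨σ, h1, hx, hσ, hσ', hg, hcr, hr⟩ := h x
    exact ⟨σ, h1, hx, hσ, hσ', hg,
      isCharacteristicReflectionOn_of_isCRMapOn hdim σ.open_source hσ hg hcr hr⟩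
  · intro h x
    obtain ⟨s, h1, hx, hs, hs', hg, hr⟩ := h x
    have : LocallyConnectedSpace M := ChartedSpace.locallyConnectedSpace E M
    obtain ⟨hfix, -⟩ := hr.differential s.open_source hs hx
    obtain ⟨σ, e1, e2, e3, e4⟩ := exists_restr_connectedComponentIn s h1 hx hfix
    have hsub : σ.source ⊆ s.source := e3 ▸ connectedComponentIn_subset _ _
    have hxσ : x ∈ σ.source := e3 ▸ mem_connectedComponentIn hx
    have hσ : ContMDiffOn 𝓘(ℝ, E) 𝓘(ℝ, E) ∞ σ σ.source := by rw [e1]; exact hs.mono hsub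
    have hgσ : P.PreservesMetricOn σ σ.source := by rw [e1]; exact fun y hy => hg y (hsub hy)
    have hrσ : P.IsCharacteristicReflectionOn x σ σ.source := by rw [e1]; exact hr.mono hsub
    obtain ⟨hcr, href⟩ := hP.isCRMapOn_of_isCharacteristicReflectionOn σ.open_source
      (e3 ▸ isPreconnected_connectedComponentIn) hσ hgσ hxσ hrσ
    refine ⟨σ, e4.trans e3.symm, hxσ, hσ, ?_, hgσ, hcr, href⟩
    rw [e2]
    exact hs'.mono (by rw [e4, ← e3, h1]; exact hsub)

theorem IsCRSymmetric.isLocallyCRSymmetric (h : P.IsCRSymmetric) : P.IsLocallyCRSymmetric := by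
  intro x
  obtain ⟨σ, hg, hcr, hr⟩ := h x
  exact ⟨σ.toHomeomorph.toOpenPartialHomeomorph, rfl, mem_univ x, σ.contMDiff.contMDiffOn,
    σ.symm.contMDiff.contMDiffOn, hg, hcr, hr⟩

theorem IsSasakian.isCRSymmetric_of_isPhiSymmetric [T2Space M] [ConnectedSpace M]
    (hP : P.IsSasakian) (h : P.IsPhiSymmetric) : P.IsCRSymmetric := by
  intro x
  obtain ⟨s, hg, hr⟩ := h.2.1 x
  exact ⟨s, hg, hP.isCRMapOn_of_isCharacteristicReflectionOn isOpen_univ isPreconnected_univ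
    s.contMDiff.contMDiffOn hg (mem_univ x) hr⟩

/-! ### Completeness of the Reeb field -/

variable (P) in
/-- The integral curve of the Reeb field through `x` is defined up to time `t`, where it is at
`y`. -/
def ReebFlows (t : ℝ) (x y : M) : Prop :=
  ∃ (c : ℝ → M) (a b : ℝ), 0 ∈ Ioo a b ∧ t ∈ Ioo a b ∧ c 0 = x ∧ c t = y ∧
    IsMIntegralCurveOn (I := 𝓘(ℝ, E)) c P.ξ (Ioo a b)

theorem isMIntegralCurveOn_shift {c : ℝ → M} {a b : ℝ}
    (hc : IsMIntegralCurveOn (I := 𝓘(ℝ, E)) c P.ξ (Ioo a b)) (s : ℝ) :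
    IsMIntegralCurveOn (I := 𝓘(ℝ, E)) (fun r => c (r + s)) P.ξ (Ioo (a - s) (b - s)) := by
  refine (hc.comp_add s).mono fun r hr => ?_
  change r + s ∈ Ioo a b
  exact ⟨by linarith [hr.1], by linarith [hr.2]⟩

theorem ReebFlows.symm {t : ℝ} {x y : M} (h : P.ReebFlows t x y) : P.ReebFlows (-t) y x := by
  obtain ⟨c, a, b, h0, ht, hx, hy, hc⟩ := h
  refine ⟨fun r => c (r + t), a - t, b - t, ⟨by linarith [ht.1], by linarith [ht.2]⟩,
    ⟨by linarith [h0.1], by linarith [h0.2]⟩, ?_, ?_, isMIntegralCurveOn_shift hc t⟩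
  · simpa using hy
  · simpa using hx

theorem ReebFlows.trans [T2Space M] {t s : ℝ} {x y z : M} (h : P.ReebFlows t x y)
    (h' : P.ReebFlows s y z) : P.ReebFlows (t + s) x z := by
  have := isManifold_one (E := E) (M := M)
  have : CompleteSpace E := FiniteDimensional.complete ℝ E
  obtain ⟨c, a, b, h0, ht, hx, hy, hc⟩ := h
  obtain ⟨c', a', b', h0', hs, hy', hz, hc'⟩ := h'
  have hc'' := isMIntegralCurveOn_shift hc' (-t)
  have hts : t ∈ Ioo a b ∩ Ioo (a' - -t) (b' - -t) :=
    ⟨ht, by linarith [h0'.1], by linarith [h0'.2]⟩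
  have hmeet : c t = c' (t + -t) := by rw [add_neg_cancel, hy, hy']
  have hsm := (contMDiff_reeb (P := P)).of_le (m := 1) (by simp)
  have hglue := isMIntegralCurveOn_piecewise hsm hc hc'' hts hmeet
  have hsub : Ioo (min a (a' - -t)) (max b (b' - -t)) ⊆ Ioo a b ∪ Ioo (a' - -t) (b' - -t) := by
    intro r hr
    rcases lt_or_ge r t with h1 | h1
    · rcases min_lt_iff.1 hr.1 with h2 | h2
      · exact Or.inl ⟨h2, h1.trans ht.2⟩
      · exact Or.inr ⟨h2, h1.trans hts.2.2⟩
    · rcases lt_max_iff.1 hr.2 with h2 | h2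
      · exact Or.inl ⟨ht.1.trans_le h1, h2⟩
      · exact Or.inr ⟨hts.2.1.trans_le h1, h2⟩
  have heq := eqOn_piecewise_of_isMIntegralCurveOn_Ioo hsm hc hc'' hts hmeet
  have hts' : t + s ∈ Ioo (a' - -t) (b' - -t) := ⟨by linarith [hs.1], by linarith [hs.2]⟩
  refine ⟨_, _, _, ⟨min_lt_iff.2 (Or.inl h0.1), lt_max_iff.2 (Or.inl h0.2)⟩,
    ⟨min_lt_iff.2 (Or.inr hts'.1), lt_max_iff.2 (Or.inr hts'.2)⟩, ?_, ?_, hglue.mono hsub⟩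
  · rw [piecewise_eq_of_mem _ _ _ h0, hx]
  · rw [heq hts']
    simpa using hz

theorem reebFlows_of_isMIntegralCurveOn {c : ℝ → M} {a b s t : ℝ}
    (hc : IsMIntegralCurveOn (I := 𝓘(ℝ, E)) c P.ξ (Ioo a b)) (hs : s ∈ Ioo a b)
    (ht : t ∈ Ioo a b) : P.ReebFlows (t - s) (c s) (c t) :=
  ⟨fun r => c (r + s), a - s, b - s, ⟨by linarith [hs.1], by linarith [hs.2]⟩,
    ⟨by linarith [ht.1], by linarith [ht.2]⟩, by simp, by simp, isMIntegralCurveOn_shift hc s⟩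

theorem PreservesReebOn.reebFlows {σ : M → M} (hσ : ContMDiff 𝓘(ℝ, E) 𝓘(ℝ, E) ∞ σ)
    (h : P.PreservesReebOn σ univ) {t : ℝ} {x y : M} (hxy : P.ReebFlows t x y) :
    P.ReebFlows t (σ x) (σ y) := by
  obtain ⟨c, a, b, h0, ht, hx, hy, hc⟩ := hxy
  exact ⟨fun r => σ (c r), a, b, h0, ht, congrArg σ hx, congrArg σ hy,
    h.map_integralCurve isOpen_univ hσ.contMDiffOn hc fun _ _ => mem_univ _⟩

variable (P) in
/-- The maximal interval on which the integral curve of the Reeb field through `x` is defined. -/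
def reebDomain (x : M) : Set ℝ := {t | ∃ y, P.ReebFlows t x y}

theorem ReebFlows.mem_reebDomain_iff [T2Space M] {s t : ℝ} {x y : M} (h : P.ReebFlows s x y) :
    t ∈ P.reebDomain y ↔ s + t ∈ P.reebDomain x :=
  ⟨fun ⟨z, hz⟩ => ⟨z, h.trans hz⟩, fun ⟨z, hz⟩ => ⟨z, by simpa using h.symm.trans hz⟩⟩

theorem ordConnected_reebDomain (x : M) : (P.reebDomain x).OrdConnected := by
  refine ordConnected_of_uIcc_subset_left (x := 0) ?_
  rintro t ⟨y, c, a, b, h0, ht, hx, hy, hc⟩ r hr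
  exact ⟨c r, c, a, b, h0, (ordConnected_Ioo.uIcc_subset h0 ht) hr, hx, rfl, hc⟩

theorem zero_mem_reebDomain [T2Space M] (x : M) : 0 ∈ P.reebDomain x := by
  obtain ⟨δ, hδ, c, hc0, hc, -⟩ := exists_integralCurve (P := P) isOpen_univ (mem_univ x)
  exact ⟨x, c, -δ, δ, ⟨by linarith, hδ⟩, ⟨by linarith, hδ⟩, hc0, hc0, hc⟩

/-- A nonempty interval that is invariant under a nonzero translation is the whole line. -/
theorem eq_univ_of_translate {D : Set ℝ} (hD : D.OrdConnected) (h0 : 0 ∈ D) {a : ℝ} (ha : a ≠ 0)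
    (h : ∀ t, t ∈ D ↔ t + a ∈ D) : D = univ := by
  have h1 : ∀ n : ℤ, (n : ℝ) * a ∈ D := by
    intro n
    induction n using Int.induction_on with
    | zero => simpa using h0
    | succ n ih =>
      have := (h _).1 ih
      push_cast at this ⊢
      rwa [add_mul, one_mul]
    | pred n ih =>
      refine (h _).2 ?_
      push_cast at ih ⊢
      rwa [sub_mul, one_mul, sub_add_cancel]
  refine eq_univ_of_forall fun t => ?_
  obtain ⟨q, rfl⟩ : ∃ q, t = q * a := ⟨t / a, by field_simp⟩
  have h2 : ((⌊q⌋ : ℤ) : ℝ) ≤ q := Int.floor_le q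
  have h3 : q ≤ ((⌊q⌋ + 1 : ℤ) : ℝ) := by push_cast; exact (Int.lt_floor_add_one q).le
  rcases lt_or_gt_of_ne ha with hneg | hpos
  · exact hD.out (h1 (⌊q⌋ + 1)) (h1 ⌊q⌋)
      ⟨mul_le_mul_of_nonpos_right h3 hneg.le, mul_le_mul_of_nonpos_right h2 hneg.le⟩
  · exact hD.out (h1 ⌊q⌋) (h1 (⌊q⌋ + 1))
      ⟨mul_le_mul_of_nonneg_right h2 hpos.le, mul_le_mul_of_nonneg_right h3 hpos.le⟩

/-- Points of a horizontal geodesic have the same Reeb domain, because the symmetry at the midpoint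
interchanges them. -/
theorem IsCRSymmetric.reebDomain_eq [T2Space M] (hdim : 1 < Module.finrank ℝ E)
    (hP : P.IsSasakian) (h : P.IsCRSymmetric) {γ : ℝ → M} {ε : ℝ} (hε : 0 < ε)
    (hγ : P.IsGeodesicOn γ (Ioo (-ε) ε)) (h0 : P.form (γ 0) (velocity E γ 0) = 0) :
    P.reebDomain (γ (ε / 2)) = P.reebDomain (γ 0) := by
  obtain ⟨σ, hg, hcr, hr⟩ := h (γ (ε / 4))
  have hσ : ContMDiffOn 𝓘(ℝ, E) 𝓘(ℝ, E) ∞ σ univ := σ.contMDiff.contMDiffOn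
  have hξ : P.PreservesReebOn σ univ :=
    (preservesFormOn_of_isCRMapOn hdim isOpen_univ hσ hg hcr).preservesReebOn isOpen_univ hσ hg
  have hrefl := isCharacteristicReflectionOn_of_isCRMapOn hdim isOpen_univ hσ hg hcr hr
  obtain ⟨δ, hδ, c, hc0, hc, -⟩ := exists_integralCurve (P := P) isOpen_univ
    (mem_univ (γ (ε / 4)))
  have hγ' := hγ.comp_affine (s' := Ioo (-(ε / 2)) (ε / 2)) 1 (ε / 4)
    fun t ht => ⟨by linarith [ht.1], by linarith [ht.2]⟩
  have hmem : ε / 4 ∈ Ioo (-ε) ε := ⟨by linarith, by linarith⟩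
  have hperp : P.form (γ (ε / 4)) (velocity E γ (ε / 4)) = 0 := by
    rw [hP.form_velocity_const hγ ⟨by linarith, hε⟩ _ hmem, h0]
  have hswap := hrefl c (-δ) δ (by linarith) hδ hc0 hc (fun _ _ => mem_univ _) 0
    ⟨by linarith, hδ⟩ (fun t => γ (1 * t + ε / 4)) (ε / 2) (by linarith) (by simp [hc0]) hγ'
    (fun _ _ => mem_univ _) (by
      change P.metric (γ (1 * 0 + ε / 4)) (velocity E (fun t => γ (1 * t + ε / 4)) 0)
        (P.reeb (γ (1 * 0 + ε / 4))) = 0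
      rw [metric_reeb, velocity_comp_affine
        (by simpa using hγ.mdifferentiableAt isOpen_Ioo hmem), map_smul]
      simp only [mul_zero, zero_add, hperp, smul_zero])
  have e1 : σ (γ (ε / 2)) = γ 0 := by
    have := hswap (ε / 4) ⟨by linarith, by linarith⟩
    ring_nf at this
    simpa [div_eq_mul_inv] using this
  have e2 : σ (γ 0) = γ (ε / 2) := by
    have := hswap (-(ε / 4)) ⟨by linarith, by linarith⟩
    ring_nf at this
    simpa [div_eq_mul_inv] using this
  ext t
  constructor
  · rintro ⟨y, hy⟩
    exact ⟨σ y, e1 ▸ hξ.reebFlows σ.contMDiff hy⟩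
  · rintro ⟨y, hy⟩
    exact ⟨σ y, e2 ▸ hξ.reebFlows σ.contMDiff hy⟩

/-- Near a point, the end points of the Reeb domain are translated by a function whose differential
at the point is `η`. -/
theorem IsCRSymmetric.exists_reebDomain_translation [T2Space M] (hdim : 1 < Module.finrank ℝ E)
    (hP : P.IsSasakian) (h : P.IsCRSymmetric) {p : M} {y : E} (hy : y ∈ (χ p).target) :
    ∃ τ : E → ℝ, HasFDerivAt τ (P.coordEta p y) y ∧ ∀ᶠ z in 𝓝 y, ∀ t,
      t ∈ P.reebDomain ((χ p).symm z) ↔ τ z + t ∈ P.reebDomain ((χ p).symm y) := by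
  obtain ⟨ε, hε, τ, hτ, hev⟩ := exists_transverse_coordinates (isOpen_target p)
    (contDiffOn_coordG (P := P) p) (fun y hy => coordG_isInvertible hy) (contDiffOn_coordReeb p)
    hy (coordEta_coordReeb hy)
  refine ⟨τ, hτ, hev.mono fun z ⟨c, v, ρ, hc0, hv0, hc, hgeo, hρ0, hτz, hρz, hρ⟩ t => ?_⟩
  obtain ⟨hγ, hvel⟩ := isGeodesicOn_of_chart hc hgeo
  have h0 : (0 : ℝ) ∈ Ioo (-ε) ε := ⟨by linarith, hε⟩
  have h1 := h.reebDomain_eq hdim hP hε hγ (by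
    rw [hvel 0 h0, ← coordEta_apply, hc0, hv0])
  rw [hc0] at h1
  have h2 : IsMIntegralCurveOn (I := 𝓘(ℝ, E)) (fun r => (χ p).symm (ρ r)) P.ξ (Ioo (-ε) ε) := by
    intro r hr
    obtain ⟨hr1, hr2⟩ := hρ r hr
    refine HasMFDerivAt.hasMFDerivWithinAt ((hasMFDerivAt_of_hasDerivAt_chart hr1 hr2).congr_mfderiv
      ?_)
    rw [frame_coordReeb hr1]
    rfl
  have h3 := reebFlows_of_isMIntegralCurveOn h2 h0 hτz
  simp only [sub_zero, hρ0, hρz] at h3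
  rw [← h1]
  exact h3.mem_reebDomain_iff

/-- The Reeb field of a `CR`-symmetric Sasakian manifold is complete. Otherwise `η` would be
locally the differential of a function, so that `dη` would vanish. -/
theorem IsCRSymmetric.reebDomain_eq_univ [T2Space M] (hdim : 1 < Module.finrank ℝ E)
    (hP : P.IsSasakian) (h : P.IsCRSymmetric) (x : M) : P.reebDomain x = univ := by
  by_contra hne
  have hxs := mem_extChartAt_source (I := 𝓘(ℝ, E)) x
  have hy : χ x x ∈ (χ x).target := (χ x).map_source hxs
  have hsymm : (χ x).symm (χ x x) = x := (χ x).left_inv hxs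
  obtain ⟨τ, hτ, hev⟩ := h.exists_reebDomain_translation hdim hP hy
  rw [hsymm] at hev
  have hd : ∀ᶠ z in 𝓝 (χ x x), HasFDerivAt τ (P.coordEta x z) z := by
    filter_upwards [hev.eventually_nhds, (isOpen_target x).eventually_mem hy] with z hz hzt
    obtain ⟨τ', hτ', hev'⟩ := h.exists_reebDomain_translation hdim hP hzt
    have heq : τ =ᶠ[𝓝 z] fun w => τ z + τ' w := by
      filter_upwards [hz, hev'] with w hw hw'
      by_contra hcon
      refine hne (eq_univ_of_translate (ordConnected_reebDomain x) (zero_mem_reebDomain x)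
        (sub_ne_zero.2 hcon) fun t => ?_)
      -- both sides say that `t - (τ z + τ' w)` lies in the domain of the point with coordinate `w`
      rw [show t + (τ w - (τ z + τ' w)) = τ w + (t - (τ z + τ' w)) by ring, ← hw, hw',
        hz.self_of_nhds]
      ring_nf
    exact (hτ'.const_add (τ z)).congr_of_eventuallyEq heq
  have hη : DifferentiableAt ℝ (P.coordEta x) (χ x x) :=
    (contDiffAt_coordEta hy).differentiableAt (by simp)
  have hclosed : ∀ u v, P.coordDeta x (χ x x) u v = 0 := by
    intro u v
    rw [coordDeta_apply, flatExtDer,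
      second_derivative_symmetric_of_eventually hd hη.hasFDerivAt u v, sub_self, mul_zero]
  obtain ⟨u, hu, hu0⟩ : ∃ u : E, P.coordEta x (χ x x) u = 0 ∧ u ≠ 0 := by
    by_contra hcon
    push Not at hcon
    have hinj : Function.Injective (P.coordEta x (χ x x)).toLinearMap :=
      (injective_iff_map_eq_zero _).2 hcon
    have := LinearMap.finrank_le_finrank_of_injective hinj
    rw [Module.finrank_self] at this
    omega
  have := coordDeta_coordPhi_neg (P := P) hy hu hu0
  rw [hclosed] at this
  exact lt_irrefl _ this

theorem exists_isMIntegralCurve_of_reebDomain [T2Space M] (h : ∀ x, P.reebDomain x = univ)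
    (x : M) : ∃ c : ℝ → M, c 0 = x ∧ IsMIntegralCurve (I := 𝓘(ℝ, E)) c P.ξ := by
  have := isManifold_one (E := E) (M := M)
  have : CompleteSpace E := FiniteDimensional.complete ℝ E
  rw [exists_isMIntegralCurve_iff_exists_isMIntegralCurveOn_Ioo
    ((contMDiff_reeb (P := P)).of_le (by simp))]
  intro r
  have h1 : -|r| ∈ P.reebDomain x := h x ▸ mem_univ _
  obtain ⟨y, hy⟩ := h1
  have h2 : |r| + |r| ∈ P.reebDomain y := h y ▸ mem_univ _
  obtain ⟨z, c, a, b, h0, ht, hc0, -, hc⟩ := h2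
  have h3 : P.ReebFlows |r| y (c |r|) := by
    have := reebFlows_of_isMIntegralCurveOn hc h0 (t := |r|)
      ⟨h0.1.trans_le (abs_nonneg r), by linarith [ht.2, abs_nonneg r]⟩
    simpa [hc0] using this
  have h4 : c |r| = x := by
    have := hy.trans h3
    rw [neg_add_cancel] at this
    obtain ⟨c', a', b', h0', -, hx, hz, -⟩ := this
    exact hz.symm.trans hx
  refine ⟨fun s => c (s + |r|), by simpa using h4, (isMIntegralCurveOn_shift hc |r|).mono ?_⟩
  intro s hs
  have := le_abs_self r
  exact ⟨by linarith [hs.1, h0.1], by linarith [hs.2, ht.2]⟩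

end PseudohermitianStructure

namespace PseudohermitianStructure

variable {E : Type*} [NormedAddCommGroup E] [NormedSpace ℝ E] [FiniteDimensional ℝ E]
  {M : Type*} [TopologicalSpace M] [ChartedSpace E M] [IsManifold 𝓘(ℝ, E) ∞ M]
  {P : PseudohermitianStructure E M}

local notation "χ" => extChartAt 𝓘(ℝ, E)

/-! ### The flow of the Reeb field -/

variable (P) in
/-- `Φ` is a global flow of the Reeb field. -/
structure IsReebFlow (Φ : ℝ → M → M) : Prop where
  zero : ∀ x, Φ 0 x = x
  isMIntegralCurve : ∀ x, IsMIntegralCurve (I := 𝓘(ℝ, E)) (fun t => Φ t x) P.ξ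

variable {Φ : ℝ → M → M}

theorem IsReebFlow.add [T2Space M] (h : P.IsReebFlow Φ) (r t : ℝ) (x : M) :
    Φ (r + t) x = Φ r (Φ t x) := by
  have := isManifold_one (E := E) (M := M)
  have : CompleteSpace E := FiniteDimensional.complete ℝ E
  exact congrFun (isMIntegralCurve_Ioo_eq_of_contMDiff_boundaryless (t₀ := 0)
    ((contMDiff_reeb (P := P)).of_le (by simp)) ((h.isMIntegralCurve x).comp_add t)
    (h.isMIntegralCurve (Φ t x)) (by simp [h.zero])) r

/-- The flow of the Reeb field is smooth for small times. -/
theorem IsReebFlow.eventually_contMDiffAt [T2Space M] (h : P.IsReebFlow Φ) (x : M) :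
    ∃ ε > 0, ∃ V : Set M, IsOpen V ∧ x ∈ V ∧ ∀ t ∈ Ioo (-ε) ε, ∀ w ∈ V,
      ContMDiffAt (𝓘(ℝ, ℝ).prod 𝓘(ℝ, E)) 𝓘(ℝ, E) ∞ (fun q : ℝ × M => Φ q.1 q.2) (t, w) := by
  have hxs := mem_extChartAt_source (I := 𝓘(ℝ, E)) x
  have hy : χ x x ∈ (χ x).target := (χ x).map_source hxs
  obtain ⟨ε, hε, ψ, hψ, hsol⟩ := exists_smooth_local_flow (isOpen_target x)
    (contDiffOn_coordReeb (P := P) x) hy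
  have hV : IsOpen ((χ x).source ∩ χ x ⁻¹' ball (χ x x) ε) :=
    (continuousOn_extChartAt x).isOpen_inter_preimage (isOpen_chartSource x) isOpen_ball
  have hflow : ∀ t ∈ Ioo (-ε) ε, ∀ w ∈ (χ x).source ∩ χ x ⁻¹' ball (χ x x) ε,
      Φ t w = (χ x).symm (ψ (χ x w, t)) := by
    rintro t ht w ⟨hws, hwb⟩
    obtain ⟨h0, h1⟩ := hsol _ hwb
    refine integralCurve_eqOn (P := P) (c := fun t => Φ t w)
      (c' := fun t => (χ x).symm (ψ (χ x w, t))) (t₀ := 0)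
      ((h.isMIntegralCurve w).isMIntegralCurveOn _) ?_ ⟨by linarith, hε⟩ ?_ ht
    · intro r hr
      obtain ⟨hr1, hr2⟩ := h1 r hr
      refine HasMFDerivAt.hasMFDerivWithinAt
        ((hasMFDerivAt_of_hasDerivAt_chart hr1 hr2).congr_mfderiv ?_)
      rw [frame_coordReeb hr1]
      rfl
    · simp only [h.zero, h0]
      exact ((χ x).left_inv hws).symm
  refine ⟨ε, hε, _, hV, ⟨hxs, mem_ball_self hε⟩, fun t ht w hw => ?_⟩
  have h1 : ContMDiffAt (𝓘(ℝ, ℝ).prod 𝓘(ℝ, E)) 𝓘(ℝ, E × ℝ) ∞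
      (fun q : ℝ × M => (χ x q.2, q.1)) (t, w) :=
    ((contMDiffAt_chart hw.1).comp (t, w) contMDiffAt_snd).prodMk_space contMDiffAt_fst
  have hwb : χ x w ∈ ball (χ x x) ε := hw.2
  have h2 : ContMDiffAt 𝓘(ℝ, E × ℝ) 𝓘(ℝ, E) ∞ ψ (χ x w, t) :=
    (hψ.contDiffAt ((isOpen_ball.prod isOpen_Ioo).mem_nhds ⟨hwb, ht⟩)).contMDiffAt
  have h3 := (contMDiffAt_symm ((hsol _ hwb).2 t ht).1).comp (t, w) (h2.comp (t, w) h1)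
  refine h3.congr_of_eventuallyEq ?_
  filter_upwards [(isOpen_Ioo.prod hV).eventually_mem (show (t, w) ∈ _ from ⟨ht, hw⟩)] with q hq
  exact hflow _ hq.1 _ hq.2

/-- The set of times at which the flow is smooth near a given point is open and closed. -/
theorem IsReebFlow.contMDiffAt_time [T2Space M] (h : P.IsReebFlow Φ) (x : M) (t : ℝ) :
    ContMDiffAt 𝓘(ℝ, E) 𝓘(ℝ, E) ∞ (Φ t) x := by
  have hloc : IsLocallyConstant fun t => ContMDiffAt 𝓘(ℝ, E) 𝓘(ℝ, E) ∞ (Φ t) x := by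
    refine (IsLocallyConstant.iff_eventually_eq _).2 fun t => ?_
    obtain ⟨ε, hε, V, hV, htV, hsm⟩ := h.eventually_contMDiffAt (Φ t x)
    have hcont : ContinuousAt (fun r => Φ r x) t := (h.isMIntegralCurve x t).continuousAt
    filter_upwards [hcont.eventually_mem (hV.mem_nhds htV), ball_mem_nhds t hε] with r hr hrt
    rw [Real.ball_eq_Ioo] at hrt
    have key : ∀ a b : ℝ, Φ a x ∈ V → b - a ∈ Ioo (-ε) ε →
        ContMDiffAt 𝓘(ℝ, E) 𝓘(ℝ, E) ∞ (Φ a) x → ContMDiffAt 𝓘(ℝ, E) 𝓘(ℝ, E) ∞ (Φ b) x := by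
      intro a b ha hab hsa
      have h1 := (hsm _ hab _ ha).comp x
        ((contMDiffAt_const (c := b - a)).prodMk hsa)
      refine h1.congr_of_eventuallyEq (Eventually.of_forall fun w => ?_)
      change Φ b w = Φ (b - a) (Φ a w)
      rw [← h.add, sub_add_cancel]
    exact propext ⟨key r t hr ⟨by linarith [hrt.2], by linarith [hrt.1]⟩,
      key t r htV ⟨by linarith [hrt.1], by linarith [hrt.2]⟩⟩
  refine (hloc.apply_eq_of_isPreconnected isPreconnected_univ (mem_univ t) (mem_univ 0)).mpr ?_
  exact contMDiffAt_id.congr_of_eventuallyEq (Eventually.of_forall h.zero)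

theorem IsReebFlow.contMDiff [T2Space M] (h : P.IsReebFlow Φ) :
    ContMDiff (𝓘(ℝ, ℝ).prod 𝓘(ℝ, E)) 𝓘(ℝ, E) ∞ (fun q : ℝ × M => Φ q.1 q.2) := by
  rintro ⟨t, x⟩
  obtain ⟨ε, hε, V, hV, htV, hsm⟩ := h.eventually_contMDiffAt (Φ t x)
  have h1 : ContMDiffAt (𝓘(ℝ, ℝ).prod 𝓘(ℝ, E)) (𝓘(ℝ, ℝ).prod 𝓘(ℝ, E)) ∞
      (fun q : ℝ × M => (q.1 - t, Φ t q.2)) (t, x) :=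
    (contMDiffAt_fst.sub contMDiffAt_const).prodMk
      ((h.contMDiffAt_time x t).comp (t, x) contMDiffAt_snd)
  have h2 := (hsm (t - t) ⟨by linarith, by linarith⟩ _ htV).comp (t, x) h1
  refine h2.congr_of_eventuallyEq (Eventually.of_forall fun q => ?_)
  change Φ q.1 q.2 = Φ (q.1 - t) (Φ t q.2)
  rw [← h.add, sub_add_cancel]

/-- In a chart the differential of the flow solves the linearized equation of the Reeb field. -/
theorem IsReebFlow.hasDerivAt_fderiv_localRep [T2Space M] (h : P.IsReebFlow Φ) (x : M) {t : ℝ}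
    {p : M} (hp : Φ t x ∈ (χ p).source) (v : E) :
    HasDerivAt (fun r => fderiv ℝ (localRep p x (Φ r)) (χ x x) v)
      (fderiv ℝ (P.coordReeb p) (χ p (Φ t x)) (fderiv ℝ (localRep p x (Φ t)) (χ x x) v)) t := by
  have hxs := mem_extChartAt_source (I := 𝓘(ℝ, E)) x
  have hy : χ x x ∈ (χ x).target := (χ x).map_source hxs
  have hsymm : (χ x).symm (χ x x) = x := (χ x).left_inv hxs
  set H : ℝ × E → E := fun q => χ p (Φ q.1 ((χ x).symm q.2)) with hH
  have hev : ∀ᶠ q : ℝ × E in 𝓝 (t, χ x x),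
      q.2 ∈ (χ x).target ∧ Φ q.1 ((χ x).symm q.2) ∈ (χ p).source := by
    have h1 : ContinuousAt (fun q : ℝ × E => Φ q.1 ((χ x).symm q.2)) (t, χ x x) :=
      ContinuousAt.comp (g := fun q : ℝ × M => Φ q.1 q.2)
        (f := fun q : ℝ × E => (q.1, (χ x).symm q.2)) h.contMDiff.continuous.continuousAt
        (continuousAt_fst.prodMk
          (ContinuousAt.comp (contMDiffAt_symm hy).continuousAt continuousAt_snd))
    exact (continuousAt_snd.eventually_mem ((isOpen_target x).mem_nhds hy)).and
      (h1.eventually_mem ((isOpen_chartSource p).mem_nhds (by simpa [hsymm] using hp)))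
  have hsm : ∀ q : ℝ × E, q.2 ∈ (χ x).target → Φ q.1 ((χ x).symm q.2) ∈ (χ p).source →
      ContDiffAt ℝ ∞ H q := by
    intro q hq1 hq2
    have h1 : ContMDiffAt 𝓘(ℝ, ℝ × E) (𝓘(ℝ, ℝ).prod 𝓘(ℝ, E)) ∞
        (fun q : ℝ × E => (q.1, (χ x).symm q.2)) q :=
      contDiffAt_fst.contMDiffAt.prodMk
        ((contMDiffAt_symm hq1).comp q contDiffAt_snd.contMDiffAt)
    exact ((contMDiffAt_chart hq2).comp q ((h.contMDiff _).comp q h1)).contDiffAt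
  have hflow : ∀ᶠ q in 𝓝 (t, χ x x), fderiv ℝ H q (1, 0) = P.coordReeb p (H q) := by
    filter_upwards [hev] with q hq
    have h1 := ((hsm q hq.1 hq.2).differentiableAt (by simp)).hasFDerivAt
    have h2 : HasDerivAt (fun r => H (r, q.2)) (fderiv ℝ H q (1, 0)) q.1 :=
      HasFDerivAt.comp_hasDerivAt (f := fun r : ℝ => (r, q.2)) q.1 h1
        ((hasDerivAt_id q.1).prodMk (hasDerivAt_const q.1 q.2))
    exact h2.unique (hasDerivAt_chart_integralCurve (a := q.1 - 1) (b := q.1 + 1)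
      ((h.isMIntegralCurve _).isMIntegralCurveOn _) ⟨by linarith, by linarith⟩ hq.2)
  have hpart : ∀ᶠ r in 𝓝 t, fderiv ℝ H (r, χ x x) (0, v) =
      fderiv ℝ (localRep p x (Φ r)) (χ x x) v := by
    have hc : ContinuousAt (fun r : ℝ => (r, χ x x)) t := by fun_prop
    filter_upwards [hc.eventually hev] with r hr
    have h1 := ((hsm (r, χ x x) hr.1 hr.2).differentiableAt (by simp)).hasFDerivAt
    have h2 : HasFDerivAt (localRep p x (Φ r)) _ (χ x x) :=
      HasFDerivAt.comp (f := fun y : E => (r, y)) (χ x x) h1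
        ((hasFDerivAt_const r (χ x x)).prodMk (hasFDerivAt_id (χ x x)))
    rw [h2.fderiv]
    rfl
  have hHt : H (t, χ x x) = χ p (Φ t x) := by simp only [hH, hsymm]
  have h1 := hasDerivAt_fderiv_flow (ξ := P.coordReeb p)
    ((hsm _ hev.self_of_nhds.1 hev.self_of_nhds.2).of_le ENat.LEInfty.out)
    (by
      rw [hHt]
      exact (contDiffAt_coordReeb ((χ p).map_source hp)).differentiableAt (by simp)) hflow v
  rw [hpart.self_of_nhds, hHt] at h1
  exact h1.congr_of_eventuallyEq (hpart.mono fun r hr => hr.symm)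

/-- The functions `η(DΦ_t v)` and `g(DΦ_t u, DΦ_t v)` of `t` are constant: their derivatives are the
Lie derivatives of `η` and of the metric along `ξ`. -/
theorem IsReebFlow.preservesForm_and_metric [T2Space M] (hP : P.IsSasakian) (h : P.IsReebFlow Φ)
    (x : M) (t : ℝ) (u v : E) :
    P.form (Φ t x) (differential E (Φ t) x v) = P.form x v ∧
      P.metric (Φ t x) (differential E (Φ t) x u) (differential E (Φ t) x v) = P.metric x u v := by
  have hxs := mem_extChartAt_source (I := 𝓘(ℝ, E)) x
  have hy : χ x x ∈ (χ x).target := (χ x).map_source hxs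
  have hsymm : (χ x).symm (χ x x) = x := (χ x).left_inv hxs
  have key : ∀ t, HasDerivAt (fun r => P.form (Φ r x) (differential E (Φ r) x v)) 0 t ∧
      HasDerivAt (fun r => P.metric (Φ r x) (differential E (Φ r) x u)
        (differential E (Φ r) x v)) 0 t := by
    intro t
    set p := Φ t x with hp
    have hps := mem_extChartAt_source (I := 𝓘(ℝ, E)) p
    have hpt : χ p p ∈ (χ p).target := (χ p).map_source hps
    set c : ℝ → E := fun r => χ p (Φ r x) with hc
    set W : E → ℝ → E := fun w r =>
      fderiv ℝ (localRep p x (Φ r)) (χ x x) (coframe E x x w) with hW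
    have hcd : HasDerivAt c (P.coordReeb p (c t)) t :=
      hasDerivAt_chart_integralCurve (a := t - 1) (b := t + 1)
        ((h.isMIntegralCurve x).isMIntegralCurveOn _) ⟨by linarith, by linarith⟩ hps
    have hWd : ∀ w, HasDerivAt (W w) (fderiv ℝ (P.coordReeb p) (c t) (W w t)) t := fun w =>
      h.hasDerivAt_fderiv_localRep x hps _
    have hev : ∀ᶠ r in 𝓝 t, Φ r x ∈ (χ p).source :=
      ((h.isMIntegralCurve x t).continuousAt).eventually_mem ((isOpen_chartSource p).mem_nhds hps)
    have hWf : ∀ r, Φ r x ∈ (χ p).source → ∀ w,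
        frame E p (c r) (W w r) = differential E (Φ r) x w := by
      intro r hr w
      have h1 := frame_fderiv_localRep (p := p) (σ := Φ r) hy
        (by rw [hsymm]; exact (h.contMDiffAt_time x r).mdifferentiableAt (by simp))
        (by rw [hsymm]; exact hr) (coframe E x x w)
      rw [localRep, hsymm, frame_chart_coframe hxs] at h1
      exact h1
    have hη : HasFDerivAt (P.coordEta p) (fderiv ℝ (P.coordEta p) (c t)) (c t) :=
      ((contDiffAt_coordEta hpt).differentiableAt (by simp)).hasFDerivAt
    have hg : HasFDerivAt (P.coordG p) (fderiv ℝ (P.coordG p) (c t)) (c t) :=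
      ((contDiffAt_coordG hpt).differentiableAt (by simp)).hasFDerivAt
    constructor
    · have h1 := (hη.comp_hasDerivAt t hcd).clm_apply (hWd v)
      refine (h1.congr_of_eventuallyEq ?_).congr_deriv (lieDeriv_coordEta hpt _)
      filter_upwards [hev] with r hr
      change _ = P.coordEta p (c r) (W v r)
      rw [coordEta_apply, hWf r hr, hc, (χ p).left_inv hr]
    · have h1 := ((hg.comp_hasDerivAt t hcd).clm_apply (hWd u)).clm_apply (hWd v)
      refine (h1.congr_of_eventuallyEq ?_).congr_deriv ?_
      · filter_upwards [hev] with r hr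
        change _ = P.coordG p (c r) (W u r) (W v r)
        rw [← metric_frame ((χ p).map_source hr), hWf r hr, hWf r hr, (χ p).left_inv hr]
      · have := hP.killingAt_coordReeb hpt (W u t) (W v t)
        simpa only [add_apply, Function.comp_apply] using this
  have h0 : Φ 0 = id := funext h.zero
  have hid : ∀ w : E, differential E (id : M → M) x w = w := fun w =>
    DFunLike.congr_fun (mfderiv_id (I := 𝓘(ℝ, E)) (x := x)) w
  constructor
  · have := is_const_of_deriv_eq_zero (fun t => (key t).1.differentiableAt)
      (fun t => (key t).1.deriv) t 0
    simpa only [h0, hid, id] using this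
  · have := is_const_of_deriv_eq_zero (fun t => (key t).2.differentiableAt)
      (fun t => (key t).2.deriv) t 0
    simpa only [h0, hid, id] using this

theorem IsReebFlow.isContactMetricMap [T2Space M] (hP : P.IsSasakian) (h : P.IsReebFlow Φ)
    (t : ℝ) : P.IsContactMetricMap (Φ t) := by
  have hsm : ContMDiffOn 𝓘(ℝ, E) 𝓘(ℝ, E) ∞ (Φ t) univ := fun x _ =>
    (h.contMDiffAt_time x t).contMDiffWithinAt
  have hg : P.PreservesMetricOn (Φ t) univ := fun x _ u v =>
    (h.preservesForm_and_metric hP x t u v).2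
  have hη : P.PreservesFormOn (Φ t) univ := fun x _ v =>
    (h.preservesForm_and_metric hP x t v v).1
  exact ⟨hg, fun x => ⟨hη.preservesReebOn isOpen_univ hsm hg x (mem_univ x), fun v =>
    ⟨hη x (mem_univ x) v, hη.endo isOpen_univ hsm hg (mem_univ x) v⟩⟩⟩

theorem IsCRSymmetric.reebGeneratesAutomorphisms [T2Space M] (hdim : 1 < Module.finrank ℝ E)
    (hP : P.IsSasakian) (h : P.IsCRSymmetric) : P.ReebGeneratesAutomorphisms := by
  choose c hc0 hc using exists_isMIntegralCurve_of_reebDomain (h.reebDomain_eq_univ hdim hP)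
  have hΦ : P.IsReebFlow fun t x => c x t := ⟨hc0, hc⟩
  exact ⟨_, hΦ.contMDiff, hΦ.zero, hΦ.add, hΦ.isMIntegralCurve, hΦ.isContactMetricMap hP⟩

theorem IsSasakian.isCRSymmetric_iff [T2Space M] [ConnectedSpace M]
    (hdim : 1 < Module.finrank ℝ E) (hP : P.IsSasakian) :
    P.IsCRSymmetric ↔ P.IsPhiSymmetric := by
  refine ⟨fun h => ⟨(hP.isLocallyCRSymmetric_iff hdim).1 h.isLocallyCRSymmetric, fun x => ?_,
    h.reebGeneratesAutomorphisms hdim hP⟩, hP.isCRSymmetric_of_isPhiSymmetric⟩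
  obtain ⟨σ, hg, hcr, hr⟩ := h x
  exact ⟨σ, hg, isCharacteristicReflectionOn_of_isCRMapOn hdim isOpen_univ
    σ.contMDiff.contMDiffOn hg hcr hr⟩

end PseudohermitianStructure

end CRGeometry

end

theorem mainTheorem9 (n : ℕ) (hn : 1 ≤ n)
    (M : Type*) [TopologicalSpace M] [T2Space M]
    [ChartedSpace (EuclideanSpace ℝ (Fin (2 * n + 1))) M]
    [IsManifold 𝓘(ℝ, EuclideanSpace ℝ (Fin (2 * n + 1))) ∞ M]
    (P : CRGeometry.PseudohermitianStructure (EuclideanSpace ℝ (Fin (2 * n + 1))) M)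
    (hP : P.IsSasakian) :
    (P.IsLocallyCRSymmetric ↔ P.IsLocallyPhiSymmetric) ∧
      (ConnectedSpace M → (P.IsCRSymmetric ↔ P.IsPhiSymmetric)) := by
  have hdim : 1 < Module.finrank ℝ (EuclideanSpace ℝ (Fin (2 * n + 1))) := by
    rw [finrank_euclideanSpace_fin]
    omega
  exact ⟨hP.isLocallyCRSymmetric_iff hdim, fun _ => hP.isCRSymmetric_iff hdim⟩
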